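/- \textbf{Theorem (Monotonicity Theorem).} Let $m\ge 1$, let $M$ be a smooth $m$-dimensional manifold, possibly with boundary $\partial M$, properly immersed in $\mathbf{R}^n$, and suppose that $M$ is minimal, i.e.\ that its mean curvature vector vanishes everywhere. (Embedded submanifolds that are closed subsets of $\mathbf{R}^n$, in particular compact ones, are included.) Let $p\in\mathbf{R}^n$, let $\mathbf{B}(p,r)$ be the closed ball with center $p$ and radius $r$, and let $R=\operatorname{dist}(p,\partial M)\in[0,\infty]$ (with $R=\infty$ if $\partial M=\emptyset$). Let \[ \Theta(M,p,r)=\frac{\operatorname{area}(M\cap\mathbf{B}(p,r))}{\omega_m r^m}, \] where area is $m$-dimensional area, counted with multiplicity, and $\omega_m$ is the Lebesgue measure of the unit ball in $\mathbf{R}^m$. Then all the areas $\operatorname{area}(M\cap\mathbf{B}(p,r))$ are finite, and: \begin{enumerate} \item $\Theta(M,p,r)$ is a nondecreasing function of $r$ for $0<r<\infty$, $r\le R$. \item If $0<r<R$ and $M$ is nowhere tangent to $\partial\mathbf{B}(p,r)$ (that is, at each point $x\in M\cap\partial\mathbf{B}(p,r)$ the tangent plane $\operatorname{Tan}_xM$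 is not contained in the tangent hyperplane of the sphere), then $\Theta(M,p,\cdot)$ is differentiable at $r$ and \[ \frac{d}{dr}\Theta(M,p,r)\ge 0, \] with equality if and only if $M$ intersects $\partial\mathbf{B}(p,r)$ orthogonally (that is, $x-p\in\operatorname{Tan}_xM$ at every point $x\in M\cap\partial\mathbf{B}(p,r)$). \item If $0<r<R$ is any radius at which $\Theta(M,p,\cdot)$ is differentiable, then $\frac{d}{dr}\Theta(M,p,r)\ge 0$, and if equality holds, then $M$ is orthogonal to $\partial\mathbf{B}(p,r)$ at every point of $M\cap\partial\mathbf{B}(p,r)$ at which $M$ is not tangent to $\partial\mathbf{B}(p,r)$. \end{enumerate} -/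

import Mathlib

open Set Metric MeasureTheory
open scoped Manifold ContDiff ENNReal

noncomputable section

namespace MinimalSubmanifold

/-- The tangent plane at `x` of the manifold with boundary `M`, mapped into `ℝⁿ` by `F`:
the image of the differential of `F` at `x`, a linear subspace of `ℝⁿ`. -/
def tangentPlane (m : ℕ) [NeZero m] {n : ℕ} {M : Type*} [TopologicalSpace M]
    [ChartedSpace (EuclideanHalfSpace m) M]
    (F : M → EuclideanSpace ℝ (Fin n)) (x : M) :
    Submodule ℝ (EuclideanSpace ℝ (Fin n)) :=
  LinearMap.range (mfderiv (𝓡∂ m) 𝓘(ℝ, EuclideanSpace ℝ (Fin n)) F x :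
    EuclideanSpace ℝ (Fin m) →L[ℝ] EuclideanSpace ℝ (Fin n)).toLinearMap

/-- The closed model half-space `{y ∈ ℝᵐ | 0 ≤ y₀}`. -/
def halfSpace (m : ℕ) [NeZero m] : Set (EuclideanSpace ℝ (Fin m)) :=
  {y | 0 ≤ y 0}

/-- `F` read in the chart `e`, a map from (an open subset of) the closed half-space to `ℝⁿ`. -/
def localParam {m : ℕ} [NeZero m] {n : ℕ} {M : Type*} [TopologicalSpace M]
    (F : M → EuclideanSpace ℝ (Fin n))
    (e : OpenPartialHomeomorph M (EuclideanHalfSpace m)) :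
    EuclideanSpace ℝ (Fin m) → EuclideanSpace ℝ (Fin n) :=
  F ∘ (e.extend (𝓡∂ m)).symm

/-- The differential of a map `f` defined on the closed half-space
(one-sided at the boundary hyperplane). -/
def paramD {m : ℕ} [NeZero m] {n : ℕ}
    (f : EuclideanSpace ℝ (Fin m) → EuclideanSpace ℝ (Fin n))
    (y : EuclideanSpace ℝ (Fin m)) :
    EuclideanSpace ℝ (Fin m) →L[ℝ] EuclideanSpace ℝ (Fin n) :=
  fderivWithin ℝ f (halfSpace m) y

/-- The second differential of a map `f` defined on the closed half-space
(one-sided at the boundary hyperplane). -/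
def paramD2 {m : ℕ} [NeZero m] {n : ℕ}
    (f : EuclideanSpace ℝ (Fin m) → EuclideanSpace ℝ (Fin n))
    (y : EuclideanSpace ℝ (Fin m)) :
    EuclideanSpace ℝ (Fin m) →L[ℝ] EuclideanSpace ℝ (Fin m) →L[ℝ] EuclideanSpace ℝ (Fin n) :=
  fderivWithin ℝ (paramD f) (halfSpace m) y

/-- The matrix `gᵢⱼ = ∂ᵢf ⬝ ∂ⱼf` of the first fundamental form of the parametrization `f`. -/
def gram {m : ℕ} [NeZero m] {n : ℕ}
    (f : EuclideanSpace ℝ (Fin m) → EuclideanSpace ℝ (Fin n))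
    (y : EuclideanSpace ℝ (Fin m)) : Matrix (Fin m) (Fin m) ℝ :=
  Matrix.of fun i j =>
    inner ℝ (paramD f y (EuclideanSpace.single i 1)) (paramD f y (EuclideanSpace.single j 1))

/-- The mean curvature vector `H = ∑ᵢⱼ gⁱʲ (∂ᵢ∂ⱼf)ᴺ` of the parametrization `f`, where `(gⁱʲ)` is
the inverse of the first fundamental form and `ᴺ` is the orthogonal projection to the normal
space (the orthogonal complement of the image of `Df`). It is the trace of the second
fundamental form. -/
def paramMeanCurvature {m : ℕ} [NeZero m] {n : ℕ}
    (f : EuclideanSpace ℝ (Fin m) → EuclideanSpace ℝ (Fin n))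
    (y : EuclideanSpace ℝ (Fin m)) : EuclideanSpace ℝ (Fin n) :=
  ∑ i, ∑ j, (gram f y)⁻¹ i j •
    (LinearMap.range (paramD f y).toLinearMap)ᗮ.starProjection
      (paramD2 f y (EuclideanSpace.single i 1) (EuclideanSpace.single j 1))

/-- `F : M → ℝⁿ` is a minimal immersion of the smooth `m`-manifold with boundary `M`: it is smooth,
its differential is injective at every point, and its mean curvature vector, which may be computed
in any chart, is everywhere zero. -/
structure IsMinimalImmersion (m : ℕ) [NeZero m] {n : ℕ} {M : Type*} [TopologicalSpace M]
    [ChartedSpace (EuclideanHalfSpace m) M]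
    (F : M → EuclideanSpace ℝ (Fin n)) : Prop where
  smooth : ContMDiff (𝓡∂ m) 𝓘(ℝ, EuclideanSpace ℝ (Fin n)) ∞ F
  injective_mfderiv : ∀ x : M,
    Function.Injective (mfderiv (𝓡∂ m) 𝓘(ℝ, EuclideanSpace ℝ (Fin n)) F x)
  meanCurvature_eq_zero : ∀ e ∈ atlas (EuclideanHalfSpace m) M, ∀ x ∈ e.source,
    paramMeanCurvature (localParam F e) (e.extend (𝓡∂ m) x) = 0

/-- The distance (possibly infinite, e.g. if `M` has no boundary) in `ℝⁿ` from `p` to the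
boundary of the immersed manifold. -/
def distToBoundary (m : ℕ) [NeZero m] {n : ℕ} {M : Type*} [TopologicalSpace M]
    [ChartedSpace (EuclideanHalfSpace m) M]
    (F : M → EuclideanSpace ℝ (Fin n)) (p : EuclideanSpace ℝ (Fin n)) : ℝ≥0∞ :=
  infEDist p (F '' (𝓡∂ m).boundary M)

/-- The `m`-dimensional area of the part of the immersed manifold `F : M → ℝⁿ` in `S ⊆ ℝⁿ`,
counted with multiplicity: the integral over `S`, with respect to `m`-dimensional Hausdorff measure
(normalized to agree with Lebesgue measure for `m`-planes), of the number of sheets of `M` through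
the point. If `F` is injective, this is the Hausdorff measure of `F(M) ∩ S`. -/
def area (m : ℕ) {n : ℕ} {M : Type*} (F : M → EuclideanSpace ℝ (Fin n))
    (S : Set (EuclideanSpace ℝ (Fin n))) : ℝ≥0∞ :=
  ∫⁻ y in S, ((F ⁻¹' {y}).encard : ℝ≥0∞) ∂μHE[m]

/-- `ω_m`, the Lebesgue measure of the unit ball of `ℝᵐ`. -/
def unitBallVolume (m : ℕ) : ℝ :=
  (volume (ball (0 : EuclideanSpace ℝ (Fin m)) 1)).toReal

/-- The density ratio `Θ(M, p, r) = area(M ∩ B(p, r)) / (ω_m rᵐ)`. -/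
def densityRatio (m : ℕ) {n : ℕ} {M : Type*} (F : M → EuclideanSpace ℝ (Fin n))
    (p : EuclideanSpace ℝ (Fin n)) (r : ℝ) : ℝ :=
  (area m F (closedBall p r)).toReal / (unitBallVolume m * r ^ m)

/-- At `x`, the immersed manifold is tangent to the sphere centred at `p` through `F x`:
the tangent plane is contained in that of the sphere, that is, it is perpendicular to the
radial vector `F x - p`. -/
def TangentToSphereAt (m : ℕ) [NeZero m] {n : ℕ} {M : Type*} [TopologicalSpace M]
    [ChartedSpace (EuclideanHalfSpace m) M]
    (F : M → EuclideanSpace ℝ (Fin n)) (p : EuclideanSpace ℝ (Fin n))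
    (x : M) : Prop :=
  ∀ v ∈ tangentPlane m F x, inner ℝ v (F x - p) = 0

/-- At `x`, the immersed manifold is orthogonal to the sphere centred at `p` through `F x`:
the tangent plane contains the normal `F x - p` of the sphere. -/
def OrthogonalToSphereAt (m : ℕ) [NeZero m] {n : ℕ} {M : Type*} [TopologicalSpace M]
    [ChartedSpace (EuclideanHalfSpace m) M]
    (F : M → EuclideanSpace ℝ (Fin n)) (p : EuclideanSpace ℝ (Fin n))
    (x : M) : Prop :=
  F x - p ∈ tangentPlane m F x

end MinimalSubmanifold

end

open MinimalSubmanifold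

open MinimalSubmanifold Filter Topology
open scoped NNReal

/-! Let `z` be the component tangent to `M` of the radial field `F - p`, let `q = |F - p|²` and `T =
|z|²` (`tangentialSq`). Then `0 ≤ T ≤ q`; at a point of a sphere about `p`, `T = 0` is tangency and
`T = q` is orthogonality. The radial field has divergence `m` along `M`, and its normal component
contributes to the divergence only through its product with the mean curvature vector. Hence on a
minimal `M` the field `z` has divergence `m`. In weak form, `∫ (z·ζ + m ζ) = 0` for every `C¹`
function `ζ` with compact support in the interior (`IsTestFunction.integral_eq_zero`); this is
proved in charts and glued by a partition of unity.

Since `z·q = 2T`, the choice `ζ = h(q) ψ`, with `h' = -g` on `(s, s']` and `h' = 0` elsewhere, turns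
this into an identity between an integral over a ball and one over a shell (`integral_shell_eq`).
Everything else follows from particular choices of `g` and `ψ`.

With `ψ = 1` and `h` a power `q^(-m/2)` on the shell, the identity becomes the monotonicity formula
(`sqDensity_sub_eq`): up to the factor `ω_m`, the increment of the density is the integral of
`q^(-m/2-1) (q - T) ≥ 0` over the shell. With `h` affine on the shell, it shows that difference
quotients of `∫ ψ T` over thin shells converge for every admissible `ψ` (`tendsto_shell_integral`).
If `M` is nowhere tangent to the sphere, `ψ = 1/T` near it gives differentiability of the area.

If `M` is orthogonal to the sphere, `q - T` is uniformly small on thin shells and the monotonicity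
formula makes the derivative zero. Conversely, suppose `0 < T < q` at a point of the sphere. A bump
`ψ` near it satisfies `ψ T ≤ const · q^(-m/2-1) (q - T)`, so a vanishing derivative forces the shell
quotients of `∫ ψ T` to tend to `0`. Their limit is also `∫ (z·ψ + m ψ)` over the ball, and `ψ` can
be built to make this positive (`exists_cutoff`), a contradiction.

Area is handled through a measure on `M` given in charts by the area formula, and radii through
their squares, because `q` is smooth also at `p`. -/

namespace MinimalSubmanifold

/-! ### The area formula for immersions of convex sets -/

/-- Domination of distances gives domination of the Hausdorff measures of images. -/
lemma euclideanHausdorffMeasure_image_le_of_dist_le {X Y Z : Type*} [MetricSpace Y]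
    [MeasurableSpace Y] [BorelSpace Y] [MetricSpace Z] [MeasurableSpace Z] [BorelSpace Z]
    [Nonempty X] (d : ℕ) (f : X → Y) (g : X → Z) (K : ℝ≥0) (S : Set X)
    (h : ∀ x ∈ S, ∀ y ∈ S, dist (f x) (f y) ≤ K * dist (g x) (g y)) :
    μHE[d] (f '' S) ≤ (K : ℝ≥0∞) ^ d * μHE[d] (g '' S) := by
  -- The hypothesis makes `f` factor through `g` on `S`: points with equal `g` have equal `f`. So
  -- `f` after an arbitrary section of `g` is a well-determined `K`-Lipschitz map carrying `g '' S`
  -- onto `f '' S`.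
  set φ : Z → Y := fun z => f (Function.invFunOn g S z) with hφ
  have hmem : ∀ z ∈ g '' S, Function.invFunOn g S z ∈ S := fun z hz =>
    Function.invFunOn_mem (by simpa using hz)
  have heq : ∀ z ∈ g '' S, g (Function.invFunOn g S z) = z := fun z hz =>
    Function.invFunOn_eq (by simpa using hz)
  have hLip : LipschitzOnWith K φ (g '' S) := by
    refine LipschitzOnWith.of_dist_le_mul fun z hz z' hz' => ?_
    have := h _ (hmem z hz) _ (hmem z' hz')
    rwa [heq z hz, heq z' hz'] at this
  have himg : φ '' (g '' S) = f '' S := by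
    ext y
    constructor
    · rintro ⟨z, hz, rfl⟩
      exact ⟨_, hmem z hz, rfl⟩
    · rintro ⟨x, hx, rfl⟩
      refine ⟨g x, mem_image_of_mem _ hx, ?_⟩
      have h0 := h _ (hmem (g x) (mem_image_of_mem _ hx)) x hx
      rw [heq _ (mem_image_of_mem _ hx), dist_self, mul_zero] at h0
      exact dist_le_zero.1 h0
  have := hLip.hausdorffMeasure_image_le (Nat.cast_nonneg d)
  rw [himg, ENNReal.rpow_natCast] at this
  simp only [Measure.euclideanHausdorffMeasure_def, Measure.smul_apply]
  rw [mul_smul_comm]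
  gcongr

section Chart

variable {E E' : Type*} [NormedAddCommGroup E] [InnerProductSpace ℝ E] [FiniteDimensional ℝ E]
  [NormedAddCommGroup E'] [InnerProductSpace ℝ E']

/-- A `C¹` map on a convex set is, near a point where its differential is injective,
bi-Lipschitz close to that differential. -/
lemma exists_nhds_dist_comparison {f : E → E'} {f' : E → E →L[ℝ] E'} {C : Set E}
    (hC : Convex ℝ C) {x₀ : E}
    (hf : ∀ᶠ x in 𝓝[C] x₀, HasFDerivWithinAt f (f' x) C x) (hc : ContinuousWithinAt f' C x₀)
    (hinj : Function.Injective (f' x₀)) {K : ℝ} (hK : 1 < K) :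
    ∃ r > 0, ∀ x ∈ C ∩ ball x₀ r, ∀ y ∈ C ∩ ball x₀ r,
      dist (f x) (f y) ≤ K * dist (f' x₀ x) (f' x₀ y) ∧
      dist (f' x₀ x) (f' x₀ y) ≤ K * dist (f x) (f y) := by
  obtain ⟨c, hc0, hcl⟩ : ∃ c : ℝ, 0 < c ∧ ∀ v, c * ‖v‖ ≤ ‖f' x₀ v‖ := by
    obtain ⟨k, hk, hanti⟩ := (f' x₀ : E →ₗ[ℝ] E').exists_antilipschitzWith
      (LinearMap.ker_eq_bot.2 hinj)
    refine ⟨(k : ℝ)⁻¹, by positivity, fun v => ?_⟩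
    have := hanti.le_mul_dist v 0
    simp only [dist_zero_right, map_zero, ContinuousLinearMap.coe_coe] at this
    rw [inv_mul_le_iff₀ (by positivity)]
    exact this
  -- As `c` bounds the differential from below, an error `ε ‖x - y‖` is at most `1 - K⁻¹` times the
  -- length of the image of `x - y` under that differential.
  set ε : ℝ := c * (1 - K⁻¹) with hε
  have hK1 : K⁻¹ < 1 := inv_lt_one_of_one_lt₀ hK
  have hε0 : 0 < ε := mul_pos hc0 (by linarith)
  have hev : ∀ᶠ x in 𝓝[C] x₀, HasFDerivWithinAt f (f' x) C x ∧ ‖f' x - f' x₀‖ ≤ ε := by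
    refine hf.and ?_
    have := hc.tendsto.eventually (Metric.closedBall_mem_nhds (f' x₀) hε0)
    filter_upwards [this] with x hx
    simpa [dist_eq_norm] using hx
  obtain ⟨r, hr, hball⟩ := Metric.mem_nhdsWithin_iff.1 hev
  refine ⟨r, hr, fun x hx y hy => ?_⟩
  have hmain : ‖f x - f y - f' x₀ (x - y)‖ ≤ ε * ‖x - y‖ := by
    refine Convex.norm_image_sub_le_of_norm_hasFDerivWithin_le' (f := f) (f' := f')
      (s := C ∩ ball x₀ r) (fun z hz => ?_) (fun z hz => (hball ⟨hz.2, hz.1⟩).2)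
      (hC.inter (convex_ball _ _)) hy hx
    exact (hball ⟨hz.2, hz.1⟩).1.mono inter_subset_left
  have hd : ‖x - y‖ ≤ c⁻¹ * ‖f' x₀ (x - y)‖ := by
    rw [le_inv_mul_iff₀ hc0]; exact hcl _
  have hmain' : ‖f x - f y - f' x₀ (x - y)‖ ≤ (1 - K⁻¹) * ‖f' x₀ (x - y)‖ := by
    calc _ ≤ ε * (c⁻¹ * ‖f' x₀ (x - y)‖) := hmain.trans (by gcongr)
      _ = _ := by rw [hε]; field_simp
  rw [dist_eq_norm, dist_eq_norm, ← map_sub]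
  set a := ‖f' x₀ (x - y)‖
  have ha : 0 ≤ a := norm_nonneg _
  -- Since `2 ≤ K + K⁻¹`, the tolerance needed for the lower bound also serves for the upper bound.
  have hKK : 1 - K⁻¹ ≤ K - 1 := by
    have : K * K⁻¹ = 1 := mul_inv_cancel₀ (by linarith)
    nlinarith [sq_nonneg (K - 1), sq_nonneg (1 - K⁻¹)]
  constructor
  · have := norm_le_norm_add_norm_sub (f' x₀ (x - y)) (f x - f y)
    rw [norm_sub_rev (f' x₀ (x - y)) (f x - f y)] at this
    have h2 : (1 - K⁻¹) * a ≤ (K - 1) * a := by gcongr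
    linarith
  · have := norm_le_norm_add_norm_sub (f x - f y) (f' x₀ (x - y))
    have h1 : K⁻¹ * a ≤ ‖f x - f y‖ := by linarith
    rwa [inv_mul_le_iff₀ (by linarith)] at h1

/-- The Jacobian is the square root of a Gram determinant, which is polynomial in the inner products
of the columns. -/
lemma continuousWithinAt_normDet {f' : E → E →L[ℝ] E'} {C : Set E} {x₀ : E}
    (hc : ContinuousWithinAt f' C x₀) :
    ContinuousWithinAt (fun x => (f' x).toLinearMap.normDet) C x₀ := by
  have : (fun x => (f' x).toLinearMap.normDet) = fun x => √(Matrix.gram ℝ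
      (fun i => f' x (stdOrthonormalBasis ℝ E i))).det := by
    ext x
    have := (f' x).toLinearMap.normDet_sq_eq_det_gram (stdOrthonormalBasis ℝ E)
    simp only [ContinuousLinearMap.coe_coe, RCLike.ofReal_real_eq_id, id] at this
    rw [← this, Real.sqrt_sq (LinearMap.normDet_nonneg _)]
  rw [this]
  have hg : Continuous fun A : E →L[ℝ] E' =>
      √(Matrix.gram ℝ (fun i => A (stdOrthonormalBasis ℝ E i))).det := by
    refine Real.continuous_sqrt.comp (Continuous.matrix_det ?_)
    refine continuous_matrix fun i j => ?_
    simp only [Matrix.gram_apply]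
    fun_prop
  exact hg.continuousAt.comp_continuousWithinAt hc

lemma normDet_pos {A : E →L[ℝ] E'} (hA : Function.Injective A) : 0 < A.toLinearMap.normDet := by
  refine lt_of_le_of_ne (LinearMap.normDet_nonneg _) (Ne.symm fun h => ?_)
  exact (LinearMap.normDet_eq_zero_iff_ker_ne_bot.1 h) (LinearMap.ker_eq_bot.2 hA)

variable [MeasurableSpace E] [BorelSpace E] [MeasurableSpace E'] [BorelSpace E']

/-- Local form of the area formula, up to a factor close to one. -/
lemma exists_nhds_area_comparison {f : E → E'} {f' : E → E →L[ℝ] E'} {C : Set E}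
    (hC : Convex ℝ C) {x₀ : E}
    (hf : ∀ᶠ x in 𝓝[C] x₀, HasFDerivWithinAt f (f' x) C x) (hc : ContinuousWithinAt f' C x₀)
    (hinj : Function.Injective (f' x₀)) {K : ℝ≥0} (hK : 1 < K) :
    ∃ r > 0, ∀ S ⊆ C ∩ ball x₀ r, MeasurableSet S →
      μHE[Module.finrank ℝ E] (f '' S) ≤ (K : ℝ≥0∞) ^ (Module.finrank ℝ E + 1) *
        ∫⁻ x in S, ENNReal.ofReal (f' x).toLinearMap.normDet ∧
      ∫⁻ x in S, ENNReal.ofReal (f' x).toLinearMap.normDet ≤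
        (K : ℝ≥0∞) ^ (Module.finrank ℝ E + 1) * μHE[Module.finrank ℝ E] (f '' S) := by
  obtain ⟨r₁, hr₁, h₁⟩ := exists_nhds_dist_comparison hC hf hc hinj
    (show (1 : ℝ) < (K : ℝ) from mod_cast hK)
  have hJ := normDet_pos hinj
  have hJc := continuousWithinAt_normDet hc
  set J := fun x => (f' x).toLinearMap.normDet with hJdef
  have hK0 : (0 : ℝ) < K := by have : (1 : ℝ) < K := mod_cast hK
                               linarith
  have hev : ∀ᶠ x in 𝓝[C] x₀, J x₀ ≤ K * J x ∧ J x ≤ K * J x₀ := by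
    have h1 : (K : ℝ)⁻¹ * J x₀ < J x₀ := by
      have : (K : ℝ)⁻¹ < 1 := inv_lt_one_of_one_lt₀ (mod_cast hK)
      nlinarith
    have h2 : J x₀ < K * J x₀ := by
      have : (1 : ℝ) < K := mod_cast hK
      nlinarith
    filter_upwards [hJc.tendsto.eventually (lt_mem_nhds h1),
      hJc.tendsto.eventually (gt_mem_nhds h2)] with x hx hx'
    exact ⟨by rw [← inv_mul_le_iff₀ hK0]; exact hx.le, hx'.le⟩
  obtain ⟨r₂, hr₂, h₂⟩ := Metric.mem_nhdsWithin_iff.1 hev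
  refine ⟨min r₁ r₂, lt_min hr₁ hr₂, fun S hS hSm => ?_⟩
  have hS1 : ∀ x ∈ S, x ∈ C ∩ ball x₀ r₁ := fun x hx =>
    ⟨(hS hx).1, ball_subset_ball (min_le_left _ _) (hS hx).2⟩
  have hS2 : ∀ x ∈ S, J x₀ ≤ K * J x ∧ J x ≤ K * J x₀ := fun x hx =>
    h₂ ⟨ball_subset_ball (min_le_right _ _) (hS hx).2, (hS hx).1⟩
  -- For the linearization at `x₀` the area formula is exact; both sides are compared with it.
  have hlin : μHE[Module.finrank ℝ E] (f' x₀ '' S) = ENNReal.ofReal (J x₀) * volume S :=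
    (f' x₀).toLinearMap.euclideanHausdorffMeasure_image_eq_normDet_mul_volume S
  have hA := euclideanHausdorffMeasure_image_le_of_dist_le (Module.finrank ℝ E) f (f' x₀) K S
    fun x hx y hy => (h₁ x (hS1 x hx) y (hS1 y hy)).1
  have hB := euclideanHausdorffMeasure_image_le_of_dist_le (Module.finrank ℝ E) (f' x₀) f K S
    fun x hx y hy => (h₁ x (hS1 x hx) y (hS1 y hy)).2
  rw [hlin] at hA hB
  have hI1 : ENNReal.ofReal (J x₀) * volume S ≤ K * ∫⁻ x in S, ENNReal.ofReal (J x) := by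
    rw [← lintegral_const_mul' _ _ ENNReal.coe_ne_top, ← setLIntegral_const]
    refine setLIntegral_mono' hSm fun x hx => ?_
    rw [← ENNReal.ofReal_coe_nnreal, ← ENNReal.ofReal_mul hK0.le]
    exact ENNReal.ofReal_le_ofReal (hS2 x hx).1
  have hI2 : ∫⁻ x in S, ENNReal.ofReal (J x) ≤ K * (ENNReal.ofReal (J x₀) * volume S) := by
    rw [← mul_assoc, ← setLIntegral_const]
    refine setLIntegral_mono' hSm fun x hx => ?_
    rw [← ENNReal.ofReal_coe_nnreal, ← ENNReal.ofReal_mul hK0.le]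
    exact ENNReal.ofReal_le_ofReal (hS2 x hx).2
  -- The exponent `finrank + 1` splits as `finrank` factors `K` from the distortion of Hausdorff
  -- measure and one from the oscillation of the Jacobian.
  constructor
  · calc _ ≤ _ := hA
      _ ≤ (K : ℝ≥0∞) ^ Module.finrank ℝ E * (K * ∫⁻ x in S, ENNReal.ofReal (J x)) := by gcongr
      _ = _ := by rw [← mul_assoc, pow_succ]
  · calc _ ≤ _ := hI2
      _ ≤ (K : ℝ≥0∞) * ((K : ℝ≥0∞) ^ Module.finrank ℝ E *
          μHE[Module.finrank ℝ E] (f '' S)) := by gcongr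
      _ = _ := by rw [← mul_assoc, pow_succ']

/-- Let `K` decrease to `1`. The limit is legitimate even for `b = ⊤`, because the other factor
tends to `1 ≠ 0`. -/
lemma le_of_forall_one_lt_pow_mul {a b : ℝ≥0∞} (k : ℕ)
    (h : ∀ K : ℝ≥0, 1 < K → a ≤ (K : ℝ≥0∞) ^ k * b) : a ≤ b := by
  have hlim : Tendsto (fun K : ℝ≥0 => (K : ℝ≥0∞) ^ k * b) (𝓝[>] 1) (𝓝 (1 * b)) := by
    refine ENNReal.Tendsto.mul_const ?_ (Or.inl one_ne_zero)
    have : Continuous fun K : ℝ≥0 => (K : ℝ≥0∞) ^ k := by fun_prop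
    have := (this.tendsto 1).mono_left (nhdsWithin_le_nhds (s := Ioi 1))
    simpa using this
  rw [one_mul] at hlim
  have : (𝓝[>] (1 : ℝ≥0)).NeBot := inferInstance
  refine ge_of_tendsto hlim ?_
  filter_upwards [self_mem_nhdsWithin] with K hK using h K hK

/-- The area formula for injective immersions defined on a convex set with possibly a boundary. -/
theorem euclideanHausdorffMeasure_image_eq_lintegral [CompleteSpace E']
    [SecondCountableTopology E'] {f : E → E'} {f' : E → E →L[ℝ] E'}
    {C : Set E} (hC : Convex ℝ C) {S : Set E} (hSC : S ⊆ C) (hS : MeasurableSet S)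
    (hf : ∀ x ∈ S, ∀ᶠ y in 𝓝[C] x, HasFDerivWithinAt f (f' y) C y)
    (hc : ∀ x ∈ S, ContinuousWithinAt f' C x)
    (hinj : ∀ x ∈ S, Function.Injective (f' x)) (hfS : InjOn f S) :
    μHE[Module.finrank ℝ E] (f '' S) = ∫⁻ x in S, ENNReal.ofReal (f' x).toLinearMap.normDet := by
  have hcont : ContinuousOn f S := fun x hx => by
    have h := mem_of_mem_nhdsWithin (hSC hx) (hf x hx)
    exact (HasFDerivWithinAt.continuousWithinAt h).mono hSC
  -- For each tolerance `K` the set is cut into countably many disjoint Borel pieces, each inside a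
  -- ball on which the local comparison holds. The errors are multiplicative, so they survive
  -- summation and disappear as `K` tends to `1`.
  have key : ∀ K : ℝ≥0, 1 < K → ∃ t : ℕ → Set E, (∀ k, MeasurableSet (t k)) ∧
      Pairwise (Function.onFun Disjoint t) ∧ S = ⋃ k, t k ∧ ∀ k,
      μHE[Module.finrank ℝ E] (f '' t k) ≤ (K : ℝ≥0∞) ^ (Module.finrank ℝ E + 1) *
        ∫⁻ x in t k, ENNReal.ofReal (f' x).toLinearMap.normDet ∧
      ∫⁻ x in t k, ENNReal.ofReal (f' x).toLinearMap.normDet ≤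
        (K : ℝ≥0∞) ^ (Module.finrank ℝ E + 1) * μHE[Module.finrank ℝ E] (f '' t k) := by
    intro K hK
    have hr : ∀ x : E, ∃ r > 0, x ∈ S → ∀ T ⊆ C ∩ ball x r, MeasurableSet T →
      μHE[Module.finrank ℝ E] (f '' T) ≤ (K : ℝ≥0∞) ^ (Module.finrank ℝ E + 1) *
        ∫⁻ x in T, ENNReal.ofReal (f' x).toLinearMap.normDet ∧
      ∫⁻ x in T, ENNReal.ofReal (f' x).toLinearMap.normDet ≤
        (K : ℝ≥0∞) ^ (Module.finrank ℝ E + 1) * μHE[Module.finrank ℝ E] (f '' T) := by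
      intro x
      by_cases hx : x ∈ S
      · obtain ⟨r, hr, h⟩ := exists_nhds_area_comparison hC (hf x hx) (hc x hx)
          (hinj x hx) hK
        exact ⟨r, hr, fun _ => h⟩
      · exact ⟨1, one_pos, fun h => absurd h hx⟩
    choose r hr0 hr using hr
    rcases S.eq_empty_or_nonempty with rfl | hne
    · exact ⟨fun _ => ∅, by simp, fun i j _ => by simp [Function.onFun], by simp, by simp⟩
    obtain ⟨s, hsS, hsc, hcov⟩ := TopologicalSpace.countable_cover_nhdsWithin
      (f := fun x => ball x (r x)) (s := S)
      (fun x _ => mem_nhdsWithin_of_mem_nhds (ball_mem_nhds x (hr0 x)))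
    have hsne : s.Nonempty := by
      rw [Set.nonempty_iff_ne_empty]
      rintro rfl
      simp at hcov
      exact hne.ne_empty hcov
    obtain ⟨a, rfl⟩ := hsc.exists_eq_range hsne
    refine ⟨fun k => S ∩ disjointed (fun k => ball (a k) (r (a k))) k, fun k => ?_, ?_, ?_, ?_⟩
    · exact hS.inter (MeasurableSet.disjointed (fun _ => measurableSet_ball) k)
    · intro i j hij
      exact (disjoint_disjointed _ hij).mono inter_subset_right inter_subset_right
    · rw [← inter_iUnion, iUnion_disjointed]
      rw [biUnion_range] at hcov
      exact (inter_eq_left.2 hcov).symm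
    · intro k
      refine hr (a k) (hsS ⟨k, rfl⟩) _ (fun x hx => ⟨hSC hx.1, disjointed_le (fun k => ball (a k) (r (a k))) k hx.2⟩) ?_
      exact hS.inter (MeasurableSet.disjointed (fun _ => measurableSet_ball) k)
  -- Injectivity keeps the images of the pieces disjoint, and injective continuous images of Borel
  -- sets are Borel (Lusin–Souslin), so the measure of the image is additive.
  have himg : ∀ t : ℕ → Set E, (∀ k, MeasurableSet (t k)) → Pairwise (Function.onFun Disjoint t) →
      S = (⋃ k, t k) → μHE[Module.finrank ℝ E] (f '' S) =
        ∑' k, μHE[Module.finrank ℝ E] (f '' t k) := by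
    intro t ht hd hSt
    have hsub : ∀ k, t k ⊆ S := fun k => hSt ▸ subset_iUnion t k
    rw [hSt, image_iUnion, measure_iUnion]
    · intro i j hij
      exact (hd hij).image hfS (hsub i) (hsub j)
    · intro k
      exact (ht k).image_of_continuousOn_injOn (hcont.mono (hsub k)) (hfS.mono (hsub k))
  apply le_antisymm
  · refine le_of_forall_one_lt_pow_mul (Module.finrank ℝ E + 1) fun K hK => ?_
    obtain ⟨t, ht, hd, hSt, h⟩ := key K hK
    rw [himg t ht hd hSt]
    conv_rhs => rw [hSt]
    rw [lintegral_iUnion ht hd, ← ENNReal.tsum_mul_left]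
    exact ENNReal.tsum_le_tsum fun k => (h k).1
  · refine le_of_forall_one_lt_pow_mul (Module.finrank ℝ E + 1) fun K hK => ?_
    obtain ⟨t, ht, hd, hSt, h⟩ := key K hK
    rw [himg t ht hd hSt]
    conv_lhs => rw [hSt]
    rw [lintegral_iUnion ht hd, ← ENNReal.tsum_mul_left]
    exact ENNReal.tsum_le_tsum fun k => (h k).2

end Chart

/-! ### The immersion in charts, up to the boundary -/

section ChartCalculus

variable {m n : ℕ} [NeZero m]

lemma halfSpace_eq_range : halfSpace m = range (𝓡∂ m) :=
  (range_modelWithCornersEuclideanHalfSpace m).symm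

lemma convex_halfSpace : Convex ℝ (halfSpace m) := by
  rw [halfSpace_eq_range]; exact (𝓡∂ m).convex_range

lemma uniqueDiffOn_halfSpace : UniqueDiffOn ℝ (halfSpace m) := by
  rw [halfSpace_eq_range]; exact (𝓡∂ m).uniqueDiffOn

variable {M : Type*} [TopologicalSpace M] [ChartedSpace (EuclideanHalfSpace m) M]

lemma extChartAt_target_subset_halfSpace (x₀ : M) :
    (extChartAt (𝓡∂ m) x₀).target ⊆ halfSpace m := by
  rw [halfSpace_eq_range]; exact extChartAt_target_subset_range x₀

lemma extChartAt_target_mem_nhdsWithin_halfSpace {x₀ : M} {y : EuclideanSpace ℝ (Fin m)}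
    (hy : y ∈ (extChartAt (𝓡∂ m) x₀).target) :
    (extChartAt (𝓡∂ m) x₀).target ∈ 𝓝[halfSpace m] y := by
  rw [halfSpace_eq_range]; exact extChartAt_target_mem_nhdsWithin_of_mem hy

lemma measurableSet_extChartAt_target (x₀ : M) :
    MeasurableSet (extChartAt (𝓡∂ m) x₀).target := by
  rw [extChartAt_target, inter_comm]
  exact (𝓡∂ m).isClosed_range.measurableSet.inter
    (((chartAt _ x₀).open_target.preimage (𝓡∂ m).continuous_symm).measurableSet)

lemma measurableSet_image_extChartAt [MeasurableSpace M] [BorelSpace M] {x₀ : M} {S : Set M}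
    (hS : MeasurableSet S) (hSs : S ⊆ (extChartAt (𝓡∂ m) x₀).source) :
    MeasurableSet (extChartAt (𝓡∂ m) x₀ '' S) := by
  set e := extChartAt (𝓡∂ m) x₀ with he
  -- The image under the chart is the preimage under the inverse chart, which is continuous on the
  -- measurable set `e.target`.
  have heq : e '' S = Subtype.val '' ((e.target.domRestrict e.symm) ⁻¹' S) := by
    ext y
    constructor
    · rintro ⟨x, hx, rfl⟩
      exact ⟨⟨e x, e.map_source (hSs hx)⟩, by
        rw [mem_preimage, domRestrict_apply, e.left_inv (hSs hx)]; exact hx, rfl⟩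
    · rintro ⟨⟨y, hy⟩, hx, rfl⟩
      exact ⟨e.symm y, hx, e.right_inv hy⟩
  rw [heq]
  have hc : Continuous (e.target.domRestrict e.symm) :=
    (continuousOn_extChartAt_symm x₀).domRestrict
  exact (measurableSet_extChartAt_target x₀).subtype_image (hc.measurable hS)

variable {F : M → EuclideanSpace ℝ (Fin n)}

lemma localParam_image (F : M → EuclideanSpace ℝ (Fin n)) {x₀ : M} {S : Set M}
    (hS : S ⊆ (extChartAt (𝓡∂ m) x₀).source) :
    localParam F (chartAt _ x₀) '' (extChartAt (𝓡∂ m) x₀ '' S) = F '' S := by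
  rw [image_image]
  refine image_congr fun x hx => ?_
  show F ((extChartAt (𝓡∂ m) x₀).symm (extChartAt (𝓡∂ m) x₀ x)) = F x
  rw [(extChartAt (𝓡∂ m) x₀).left_inv (hS hx)]

lemma localParam_injOn {x₀ : M} {S : Set M}
    (hS : S ⊆ (extChartAt (𝓡∂ m) x₀).source) (hinj : InjOn F S) :
    InjOn (localParam F (chartAt _ x₀)) (extChartAt (𝓡∂ m) x₀ '' S) := by
  rintro _ ⟨x, hx, rfl⟩ _ ⟨x', hx', rfl⟩ h
  have h3 : ∀ z ∈ S, localParam F (chartAt _ x₀) (extChartAt (𝓡∂ m) x₀ z) = F z := fun z hz => by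
    show F ((extChartAt (𝓡∂ m) x₀).symm (extChartAt (𝓡∂ m) x₀ z)) = F z
    rw [(extChartAt (𝓡∂ m) x₀).left_inv (hS hz)]
  rw [h3 x hx, h3 x' hx'] at h
  rw [hinj hx hx' h]

/-- The area element of the parametrization of `M` by the chart at `x₀`. -/
noncomputable def areaElement (F : M → EuclideanSpace ℝ (Fin n)) (x₀ : M)
    (y : EuclideanSpace ℝ (Fin m)) : ℝ :=
  (paramD (localParam F (chartAt _ x₀)) y).toLinearMap.normDet

variable [IsManifold (𝓡∂ m) ∞ M]

/-- A `C^k` map on a manifold is `C^k` in charts, within the half-space. -/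
lemma contDiffWithinAt_comp_extChartAt_symm {V : Type*} [NormedAddCommGroup V] [NormedSpace ℝ V]
    {k : ℕ∞} {ψ : M → V} {x₀ : M} {y : EuclideanSpace ℝ (Fin m)}
    (hy : y ∈ (extChartAt (𝓡∂ m) x₀).target)
    (hψ : ContMDiffAt (𝓡∂ m) 𝓘(ℝ, V) k ψ ((extChartAt (𝓡∂ m) x₀).symm y)) :
    ContDiffWithinAt ℝ k (ψ ∘ (extChartAt (𝓡∂ m) x₀).symm) (halfSpace m) y := by
  rw [← contMDiffWithinAt_iff_contDiffWithinAt]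
  have h1 : ContMDiffWithinAt 𝓘(ℝ, EuclideanSpace ℝ (Fin m)) (𝓡∂ m) k
      (extChartAt (𝓡∂ m) x₀).symm (halfSpace m) y := by
    have := (contMDiffOn_extChartAt_symm (I := 𝓡∂ m) (n := ∞) x₀ y hy).mono_of_mem_nhdsWithin
      (extChartAt_target_mem_nhdsWithin_halfSpace hy)
    exact this.of_le (mod_cast le_top)
  exact hψ.comp_contMDiffWithinAt y h1

/-- The differential of a map at a point in terms of a fixed chart. -/
lemma mfderiv_eq_fderivWithin_comp {V : Type*} [NormedAddCommGroup V] [NormedSpace ℝ V]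
    {ψ : M → V} {x₀ x : M} (hx : x ∈ (extChartAt (𝓡∂ m) x₀).source)
    (hψ : ContMDiffAt (𝓡∂ m) 𝓘(ℝ, V) 1 ψ x) :
    mfderiv (𝓡∂ m) 𝓘(ℝ, V) ψ x =
      (fderivWithin ℝ (ψ ∘ (extChartAt (𝓡∂ m) x₀).symm) (halfSpace m)
        (extChartAt (𝓡∂ m) x₀ x)).comp
        (mfderiv (𝓡∂ m) 𝓘(ℝ, EuclideanSpace ℝ (Fin m)) (extChartAt (𝓡∂ m) x₀) x) := by
  set e := extChartAt (𝓡∂ m) x₀ with he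
  have hy : e x ∈ e.target := e.map_source hx
  have h1 : ContDiffWithinAt ℝ 1 (ψ ∘ e.symm) (halfSpace m) (e x) := by
    refine contDiffWithinAt_comp_extChartAt_symm (k := 1) hy ?_
    rw [e.left_inv hx]; exact hψ
  have h2 : HasMFDerivWithinAt 𝓘(ℝ, EuclideanSpace ℝ (Fin m)) 𝓘(ℝ, V) (ψ ∘ e.symm) (halfSpace m)
      (e x) (fderivWithin ℝ (ψ ∘ e.symm) (halfSpace m) (e x)) :=
    (h1.differentiableWithinAt one_ne_zero).hasFDerivWithinAt.hasMFDerivWithinAt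
  have h3 := (mdifferentiableAt_extChartAt (I := 𝓡∂ m)
    (by rwa [extChartAt_source] at hx : x ∈ (chartAt _ x₀).source)).hasMFDerivAt
  rw [← he] at h3
  have h4 := h2.comp x (s := univ) h3.hasMFDerivWithinAt (fun z hz => ?_)
  · rw [hasMFDerivWithinAt_univ] at h4
    have hev : ((ψ ∘ e.symm) ∘ e) =ᶠ[𝓝 x] ψ := by
      filter_upwards [extChartAt_source_mem_nhds' hx] with z hz
      simp [e.left_inv hz]
    exact (h4.congr_of_eventuallyEq hev.symm).mfderiv
  · show e z ∈ halfSpace m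
    rw [halfSpace_eq_range, he, extChartAt_coe]
    exact mem_range_self _

lemma IsMinimalImmersion.contDiffWithinAt_localParam (hF : IsMinimalImmersion m F) {x₀ : M}
    {y : EuclideanSpace ℝ (Fin m)} (hy : y ∈ (extChartAt (𝓡∂ m) x₀).target) :
    ContDiffWithinAt ℝ ∞ (localParam F (chartAt _ x₀)) (halfSpace m) y :=
  contDiffWithinAt_comp_extChartAt_symm hy hF.smooth.contMDiffAt

lemma IsMinimalImmersion.eventually_hasFDerivWithinAt (hF : IsMinimalImmersion m F) {x₀ : M}
    {y : EuclideanSpace ℝ (Fin m)} (hy : y ∈ (extChartAt (𝓡∂ m) x₀).target) :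
    ∀ᶠ w in 𝓝[halfSpace m] y, HasFDerivWithinAt (localParam F (chartAt _ x₀))
      (paramD (localParam F (chartAt _ x₀)) w) (halfSpace m) w := by
  filter_upwards [extChartAt_target_mem_nhdsWithin_halfSpace hy] with w hw
  exact ((hF.contDiffWithinAt_localParam hw).differentiableWithinAt (by simp)).hasFDerivWithinAt

lemma IsMinimalImmersion.continuousWithinAt_paramD (hF : IsMinimalImmersion m F) {x₀ : M}
    {y : EuclideanSpace ℝ (Fin m)} (hy : y ∈ (extChartAt (𝓡∂ m) x₀).target) :
    ContinuousWithinAt (paramD (localParam F (chartAt _ x₀))) (halfSpace m) y :=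
  ((hF.contDiffWithinAt_localParam hy).fderivWithin_right (m := 0) uniqueDiffOn_halfSpace
    (by simp) (extChartAt_target_subset_halfSpace x₀ hy)).continuousWithinAt

lemma IsMinimalImmersion.mfderiv_eq (hF : IsMinimalImmersion m F) {x₀ x : M}
    (hx : x ∈ (extChartAt (𝓡∂ m) x₀).source) :
    mfderiv (𝓡∂ m) 𝓘(ℝ, EuclideanSpace ℝ (Fin n)) F x =
      (paramD (localParam F (chartAt _ x₀)) (extChartAt (𝓡∂ m) x₀ x)).comp
        (mfderiv (𝓡∂ m) 𝓘(ℝ, EuclideanSpace ℝ (Fin m)) (extChartAt (𝓡∂ m) x₀) x) :=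
  mfderiv_eq_fderivWithin_comp hx (hF.smooth.contMDiffAt.of_le (mod_cast le_top))

lemma surjective_mfderiv_extChartAt {x₀ x : M} (hx : x ∈ (extChartAt (𝓡∂ m) x₀).source) :
    Function.Surjective
      (mfderiv (𝓡∂ m) 𝓘(ℝ, EuclideanSpace ℝ (Fin m)) (extChartAt (𝓡∂ m) x₀) x) :=
  have : IsManifold (𝓡∂ m) 1 M := .of_le (n := ∞) (mod_cast le_top)
  (isInvertible_mfderiv_extChartAt hx).bijective.surjective

lemma IsMinimalImmersion.injective_paramD (hF : IsMinimalImmersion m F) {x₀ : M}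
    {y : EuclideanSpace ℝ (Fin m)} (hy : y ∈ (extChartAt (𝓡∂ m) x₀).target) :
    Function.Injective (paramD (localParam F (chartAt _ x₀)) y) := by
  set e := extChartAt (𝓡∂ m) x₀ with he
  have hx : e.symm y ∈ e.source := e.map_target hy
  have h := hF.mfderiv_eq hx
  rw [← he, e.right_inv hy] at h
  have hinj := hF.injective_mfderiv (e.symm y)
  intro v w hvw
  obtain ⟨v', rfl⟩ := surjective_mfderiv_extChartAt hx v
  obtain ⟨w', rfl⟩ := surjective_mfderiv_extChartAt hx w
  have : v' = w' := by
    apply hinj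
    rw [h]
    exact hvw
  rw [this]

lemma IsMinimalImmersion.tangentPlane_eq (hF : IsMinimalImmersion m F) {x₀ x : M}
    (hx : x ∈ (extChartAt (𝓡∂ m) x₀).source) :
    tangentPlane m F x = LinearMap.range
      (paramD (localParam F (chartAt _ x₀)) (extChartAt (𝓡∂ m) x₀ x)).toLinearMap := by
  ext v
  unfold tangentPlane
  rw [hF.mfderiv_eq hx]
  constructor
  · rintro ⟨w, rfl⟩
    exact ⟨_, rfl⟩
  · rintro ⟨w, rfl⟩
    obtain ⟨w', rfl⟩ := surjective_mfderiv_extChartAt hx w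
    exact ⟨w', rfl⟩

/-- An immersion is locally injective, also at the boundary. -/
lemma IsMinimalImmersion.exists_isOpen_injOn (hF : IsMinimalImmersion m F) (x₀ : M) :
    ∃ U : Set M, IsOpen U ∧ x₀ ∈ U ∧ U ⊆ (extChartAt (𝓡∂ m) x₀).source ∧ InjOn F U := by
  set e := extChartAt (𝓡∂ m) x₀ with he
  have hy : e x₀ ∈ e.target := mem_extChartAt_target x₀
  -- The factor `2` is arbitrary: only the fact that `F` does not collapse distances is used. The
  -- comparison is made on the half-space, so boundary points need no separate treatment.
  obtain ⟨r, hr, h⟩ := exists_nhds_dist_comparison convex_halfSpace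
    (hF.eventually_hasFDerivWithinAt hy) (hF.continuousWithinAt_paramD hy)
    (hF.injective_paramD hy) one_lt_two
  refine ⟨e.source ∩ e ⁻¹' ball (e x₀) r, isOpen_extChartAt_preimage' x₀ isOpen_ball,
    ⟨mem_extChartAt_source x₀, mem_ball_self hr⟩, inter_subset_left, fun x hx x' hx' hxx' => ?_⟩
  apply e.injOn hx.1 hx'.1
  apply hF.injective_paramD hy
  have h2 := (h (e x) ⟨extChartAt_target_subset_halfSpace x₀ (e.map_source hx.1), hx.2⟩
    (e x') ⟨extChartAt_target_subset_halfSpace x₀ (e.map_source hx'.1), hx'.2⟩).2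
  have h3 : ∀ z ∈ e.source, localParam F (chartAt _ x₀) (e z) = F z := fun z hz => by
    show F (e.symm (e z)) = F z
    rw [e.left_inv hz]
  rw [h3 x hx.1, h3 x' hx'.1, hxx', dist_self, mul_zero] at h2
  exact dist_le_zero.1 h2

lemma IsMinimalImmersion.continuousOn_localParam (hF : IsMinimalImmersion m F) (x₀ : M) :
    ContinuousOn (localParam F (chartAt _ x₀)) (extChartAt (𝓡∂ m) x₀).target := fun _ hy =>
  (hF.contDiffWithinAt_localParam hy).continuousWithinAt.mono
    (extChartAt_target_subset_halfSpace x₀)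

variable [MeasurableSpace M] [BorelSpace M]

lemma IsMinimalImmersion.measurableSet_image (hF : IsMinimalImmersion m F) {x₀ : M} {S : Set M}
    (hS : MeasurableSet S) (hSs : S ⊆ (extChartAt (𝓡∂ m) x₀).source) (hinj : InjOn F S) :
    MeasurableSet (F '' S) := by
  rw [← localParam_image F hSs]
  exact (measurableSet_image_extChartAt hS hSs).image_of_continuousOn_injOn
    ((hF.continuousOn_localParam x₀).mono (by
      rintro _ ⟨x, hx, rfl⟩; exact (extChartAt (𝓡∂ m) x₀).map_source (hSs hx)))
    (localParam_injOn hSs hinj)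

/-- The area formula in a chart of an immersed manifold. -/
lemma IsMinimalImmersion.euclideanHausdorffMeasure_image (hF : IsMinimalImmersion m F) {x₀ : M}
    {S : Set M} (hS : MeasurableSet S) (hSs : S ⊆ (extChartAt (𝓡∂ m) x₀).source)
    (hinj : InjOn F S) :
    μHE[m] (F '' S) = ∫⁻ y in extChartAt (𝓡∂ m) x₀ '' S, ENNReal.ofReal (areaElement F x₀ y) := by
  have hsub : extChartAt (𝓡∂ m) x₀ '' S ⊆ (extChartAt (𝓡∂ m) x₀).target := by
    rintro _ ⟨x, hx, rfl⟩; exact (extChartAt (𝓡∂ m) x₀).map_source (hSs hx)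
  have := euclideanHausdorffMeasure_image_eq_lintegral convex_halfSpace
    (hsub.trans (extChartAt_target_subset_halfSpace x₀)) (measurableSet_image_extChartAt hS hSs)
    (fun y hy => hF.eventually_hasFDerivWithinAt (hsub hy))
    (fun y hy => hF.continuousWithinAt_paramD (hsub hy))
    (fun y hy => hF.injective_paramD (hsub hy)) (localParam_injOn hSs hinj)
  rwa [localParam_image F hSs, finrank_euclideanSpace_fin] at this

end ChartCalculus

/-! ### The area measure on the manifold -/

section AreaMeasure

variable {m n : ℕ} [NeZero m] {M : Type*} [TopologicalSpace M]

/-- `μ` is the `m`-dimensional area measure on the manifold `M` immersed by `F`. -/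
structure IsAreaMeasure (m : ℕ) [MeasurableSpace M] (F : M → EuclideanSpace ℝ (Fin n))
    (μ : Measure M) : Prop where
  apply_of_injOn : ∀ S, MeasurableSet S → InjOn F S → μ S = μHE[m] (F '' S)
  area_eq : ∀ B, MeasurableSet B → area m F B = μ (F ⁻¹' B)

/-- The fibre is the disjoint union of its traces on the pieces, each with at most one point.
Counting measure on the discrete σ-algebra turns this into a sum, valid also for infinite fibres. -/
lemma encard_fiber_eq_tsum {X Y : Type*} (F : X → Y) {A : ℕ → Set X}
    (hd : Pairwise (Function.onFun Disjoint A)) (hA : ⋃ k, A k = univ)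
    (hinj : ∀ k, InjOn F (A k)) (y : Y) :
    ((F ⁻¹' {y}).encard : ℝ≥0∞) = ∑' k, (F '' A k).indicator (fun _ => 1) y := by
  let _ : MeasurableSpace X := ⊤
  have h1 : F ⁻¹' {y} = ⋃ k, F ⁻¹' {y} ∩ A k := by rw [← inter_iUnion, hA, inter_univ]
  rw [← Measure.count_apply MeasurableSpace.measurableSet_top, h1, measure_iUnion]
  · refine tsum_congr fun k => ?_
    by_cases hy : y ∈ F '' A k
    · obtain ⟨x, hx, rfl⟩ := hy
      have : F ⁻¹' {F x} ∩ A k = {x} := by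
        ext z
        simp only [mem_inter_iff, mem_preimage, mem_singleton_iff]
        exact ⟨fun h => hinj k h.2 hx h.1, by rintro rfl; exact ⟨rfl, hx⟩⟩
      rw [this, indicator_of_mem (mem_image_of_mem F hx), Measure.count_singleton]
    · have : F ⁻¹' {y} ∩ A k = ∅ := by
        ext z
        simp only [mem_inter_iff, mem_preimage, mem_singleton_iff, mem_empty_iff_false, iff_false]
        rintro ⟨rfl, hz⟩
        exact hy ⟨z, hz, rfl⟩
      rw [this, indicator_of_notMem hy, measure_empty]
  · intro i j hij
    exact (hd hij).mono inter_subset_right inter_subset_right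
  · exact fun _ => MeasurableSpace.measurableSet_top

variable [ChartedSpace (EuclideanHalfSpace m) M] {F : M → EuclideanSpace ℝ (Fin n)}

lemma IsMinimalImmersion.continuous (hF : IsMinimalImmersion m F) : Continuous F :=
  hF.smooth.continuous

variable [IsManifold (𝓡∂ m) ∞ M]

lemma IsMinimalImmersion.continuousWithinAt_areaElement (hF : IsMinimalImmersion m F) {x₀ : M}
    {y : EuclideanSpace ℝ (Fin m)} (hy : y ∈ (extChartAt (𝓡∂ m) x₀).target) :
    ContinuousWithinAt (areaElement F x₀) (halfSpace m) y :=
  continuousWithinAt_normDet (hF.continuousWithinAt_paramD hy)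

lemma IsMinimalImmersion.areaElement_pos (hF : IsMinimalImmersion m F) {x₀ : M}
    {y : EuclideanSpace ℝ (Fin m)} (hy : y ∈ (extChartAt (𝓡∂ m) x₀).target) :
    0 < areaElement F x₀ y :=
  normDet_pos (hF.injective_paramD hy)

/-- The interior of the chart target consists of the images of the interior points. -/
lemma mem_interior_extChartAt_target {x₀ x : M} (hx : x ∈ (extChartAt (𝓡∂ m) x₀).source)
    (hxi : x ∈ (𝓡∂ m).interior M) :
    extChartAt (𝓡∂ m) x₀ x ∈ interior (extChartAt (𝓡∂ m) x₀).target :=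
  ((𝓡∂ m).isInteriorPoint_iff_of_mem_atlas (n := ∞) (by simp) (chart_mem_atlas _ x₀)
    (by rwa [extChartAt_source] at hx)).1 hxi

lemma extChartAt_image_mem_nhds {x₀ x : M} {W : Set M} (hWs : W ⊆ (extChartAt (𝓡∂ m) x₀).source)
    (hW : IsOpen W) (hxW : x ∈ W) (hxi : x ∈ (𝓡∂ m).interior M) :
    extChartAt (𝓡∂ m) x₀ '' W ∈ 𝓝 (extChartAt (𝓡∂ m) x₀ x) := by
  set e := extChartAt (𝓡∂ m) x₀ with he
  have hint := mem_interior_extChartAt_target (hWs hxW) hxi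
  have hc : ContinuousAt e.symm (e x) :=
    ((continuousOn_extChartAt_symm x₀).continuousAt (mem_interior_iff_mem_nhds.1 hint))
  have h1 : e.symm ⁻¹' W ∈ 𝓝 (e x) :=
    hc (by rw [e.left_inv (hWs hxW)]; exact hW.mem_nhds hxW)
  filter_upwards [h1, mem_interior_iff_mem_nhds.1 hint] with y hy hyt
  exact ⟨e.symm y, hy, e.right_inv hyt⟩

variable [MeasurableSpace M] [BorelSpace M]

/-- A countable Borel partition of an immersed manifold into injectively immersed pieces. -/
lemma IsMinimalImmersion.exists_partition [SecondCountableTopology M]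
    (hF : IsMinimalImmersion m F) :
    ∃ A : ℕ → Set M, (∀ k, MeasurableSet (A k)) ∧ Pairwise (Function.onFun Disjoint A) ∧
      (⋃ k, A k = univ) ∧ (∀ k, InjOn F (A k)) ∧
      ∀ k, ∀ S ⊆ A k, MeasurableSet S → MeasurableSet (F '' S) := by
  choose U hUo hxU hUs hUi using fun x => hF.exists_isOpen_injOn x
  rcases isEmpty_or_nonempty M with hM | hM
  · exact ⟨fun _ => ∅, by simp, fun i j _ => by simp [Function.onFun], by
      simp [univ_eq_empty_iff.2 hM], by simp, fun k S hS _ => by simp [subset_empty_iff.1 hS]⟩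
  obtain ⟨s, hsc, hcov⟩ := TopologicalSpace.countable_cover_nhds
    (f := U) (fun x => (hUo x).mem_nhds (hxU x))
  have hsne : s.Nonempty := by
    rw [Set.nonempty_iff_ne_empty]
    rintro rfl
    simp only [mem_empty_iff_false, iUnion_of_empty, iUnion_empty] at hcov
    exact empty_ne_univ hcov
  obtain ⟨a, rfl⟩ := hsc.exists_eq_range hsne
  rw [biUnion_range] at hcov
  refine ⟨disjointed fun k => U (a k), fun k => ?_, disjoint_disjointed _, ?_, fun k => ?_,
    fun k S hS hSm => ?_⟩
  · exact MeasurableSet.disjointed (fun j => (hUo (a j)).measurableSet) k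
  · rw [iUnion_disjointed, hcov]
  · exact (hUi (a k)).mono (disjointed_le (fun k => U (a k)) k)
  · have hSU : S ⊆ U (a k) := hS.trans (disjointed_le (fun k => U (a k)) k)
    exact hF.measurableSet_image hSm (hSU.trans (hUs (a k))) ((hUi (a k)).mono hSU)

/-- The area measure exists. -/
theorem IsMinimalImmersion.exists_isAreaMeasure [SecondCountableTopology M]
    (hF : IsMinimalImmersion m F) : ∃ μ : Measure M, IsAreaMeasure m F μ := by
  obtain ⟨A, hAm, hAd, hAu, hAi, hAF⟩ := hF.exists_partition
  have hunion : ∀ (k : ℕ) (f : ℕ → Set M), (∀ i, MeasurableSet (f i)) →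
      Pairwise (Function.onFun Disjoint f) →
      μHE[m] (F '' ((⋃ i, f i) ∩ A k)) = ∑' i, μHE[m] (F '' (f i ∩ A k)) := by
    intro k f hf hd
    rw [iUnion_inter, image_iUnion, measure_iUnion]
    · intro i j hij
      exact ((hd hij).mono inter_subset_left inter_subset_left).image (hAi k)
        inter_subset_right inter_subset_right
    · exact fun i => hAF k _ inter_subset_right ((hf i).inter (hAm k))
  -- On an injectively immersed piece the area is the Hausdorff measure of the image. Summing over
  -- the partition counts every sheet separately.
  let μ : Measure M := Measure.ofMeasurable (fun S _ => ∑' k, μHE[m] (F '' (S ∩ A k)))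
    (by simp) (by
      intro f hf hd
      simp_rw [hunion _ f hf hd]
      exact ENNReal.tsum_comm)
  have hμ : ∀ S, MeasurableSet S → μ S = ∑' k, μHE[m] (F '' (S ∩ A k)) := fun S hS =>
    Measure.ofMeasurable_apply S hS
  refine ⟨μ, fun S hS hinj => ?_, fun B hB => ?_⟩
  · have h1 : F '' S = ⋃ k, F '' (S ∩ A k) := by
      rw [← image_iUnion, ← inter_iUnion, hAu, inter_univ]
    rw [hμ S hS, h1, measure_iUnion]
    · intro i j hij
      exact ((hAd hij).mono inter_subset_right inter_subset_right).image hinj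
        inter_subset_left inter_subset_left
    · exact fun k => hAF k _ inter_subset_right (hS.inter (hAm k))
  · rw [hμ _ (hF.continuous.measurable hB), area]
    -- The multiplicity is a sum of indicators of the measurable images of the pieces, so the
    -- integral can be taken term by term.
    simp_rw [encard_fiber_eq_tsum F hAd hAu hAi]
    have hFA : ∀ k, MeasurableSet (F '' A k) := fun k => hAF k _ le_rfl (hAm k)
    rw [lintegral_tsum fun k => (measurable_const.indicator (hFA k)).aemeasurable]
    refine tsum_congr fun k => ?_
    rw [lintegral_indicator (hFA k), setLIntegral_one, Measure.restrict_apply (hFA k),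
      inter_comm, ← image_preimage_inter]

variable {μ : Measure M}

lemma IsAreaMeasure.apply_eq_lintegral (hμ : IsAreaMeasure m F μ) (hF : IsMinimalImmersion m F)
    {x₀ : M} {S : Set M} (hS : MeasurableSet S) (hSs : S ⊆ (extChartAt (𝓡∂ m) x₀).source)
    (hinj : InjOn F S) :
    μ S = ∫⁻ y in extChartAt (𝓡∂ m) x₀ '' S, ENNReal.ofReal (areaElement F x₀ y) := by
  rw [hμ.apply_of_injOn S hS hinj, hF.euclideanHausdorffMeasure_image hS hSs hinj]

/-- The area element is continuous on the half-space up to its boundary, hence bounded near any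
point, and balls have finite volume. -/
lemma IsAreaMeasure.isLocallyFiniteMeasure (hμ : IsAreaMeasure m F μ)
    (hF : IsMinimalImmersion m F) : IsLocallyFiniteMeasure μ := by
  refine ⟨fun x₀ => ?_⟩
  obtain ⟨U, hUo, hxU, hUs, hUi⟩ := hF.exists_isOpen_injOn x₀
  set e := extChartAt (𝓡∂ m) x₀ with he
  have hy : e x₀ ∈ e.target := mem_extChartAt_target x₀
  have hev : ∀ᶠ y in 𝓝[halfSpace m] (e x₀), areaElement F x₀ y < areaElement F x₀ (e x₀) + 1 :=
    (hF.continuousWithinAt_areaElement hy).tendsto.eventually (gt_mem_nhds (by linarith))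
  obtain ⟨r, hr, hball⟩ := Metric.mem_nhdsWithin_iff.1 hev
  set W := U ∩ (e.source ∩ e ⁻¹' ball (e x₀) r) with hW
  have hWo : IsOpen W := hUo.inter (isOpen_extChartAt_preimage' x₀ isOpen_ball)
  refine ⟨W, hWo.mem_nhds ⟨hxU, mem_extChartAt_source x₀, mem_ball_self hr⟩, ?_⟩
  rw [hμ.apply_eq_lintegral hF hWo.measurableSet (x₀ := x₀) (inter_subset_left.trans hUs)
    (hUi.mono inter_subset_left)]
  have hsub : e '' W ⊆ ball (e x₀) r := by
    rintro _ ⟨x, hx, rfl⟩; exact hx.2.2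
  calc ∫⁻ y in e '' W, ENNReal.ofReal (areaElement F x₀ y)
      ≤ ∫⁻ y in e '' W, ENNReal.ofReal (areaElement F x₀ (e x₀) + 1) := by
        refine setLIntegral_mono' (measurableSet_image_extChartAt hWo.measurableSet
          (inter_subset_left.trans hUs)) fun y hy => ENNReal.ofReal_le_ofReal ?_
        obtain ⟨x, hx, rfl⟩ := hy
        exact (hball ⟨hx.2.2, extChartAt_target_subset_halfSpace x₀
          (e.map_source hx.2.1)⟩ : _ < _).le
    _ = ENNReal.ofReal (areaElement F x₀ (e x₀) + 1) * volume (e '' W) := setLIntegral_const _ _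
    _ ≤ ENNReal.ofReal (areaElement F x₀ (e x₀) + 1) * volume (ball (e x₀) r) := by gcongr
    _ < ⊤ := ENNReal.mul_lt_top ENNReal.ofReal_lt_top measure_ball_lt_top

/-- Around an interior point the chart image contains a Euclidean ball, and the area element is
positive there. This supplies strict positivity in the rigidity argument. -/
lemma IsAreaMeasure.pos_of_isOpen (hμ : IsAreaMeasure m F μ) (hF : IsMinimalImmersion m F)
    {W : Set M} (hW : IsOpen W) {x : M} (hxW : x ∈ W) (hxi : x ∈ (𝓡∂ m).interior M) :
    0 < μ W := by
  obtain ⟨U, hUo, hxU, hUs, hUi⟩ := hF.exists_isOpen_injOn x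
  set e := extChartAt (𝓡∂ m) x with he
  refine lt_of_lt_of_le (pos_iff_ne_zero.2 fun h0 => ?_) (measure_mono (inter_subset_left (t := U)))
  have hWU := hW.inter hUo
  rw [hμ.apply_eq_lintegral hF hWU.measurableSet (x₀ := x) (inter_subset_right.trans hUs)
    (hUi.mono inter_subset_right)] at h0
  have hms := measurableSet_image_extChartAt (x₀ := x) hWU.measurableSet
    (inter_subset_right.trans hUs)
  have hsub : e '' (W ∩ U) ⊆ e.target := by
    rintro _ ⟨z, hz, rfl⟩; exact e.map_source (hUs hz.2)
  have hpos : 0 < volume (e '' (W ∩ U)) :=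
    Measure.measure_pos_of_mem_nhds _ (extChartAt_image_mem_nhds (inter_subset_right.trans hUs) hWU
      ⟨hxW, hxU⟩ hxi)
  rw [setLIntegral_eq_zero_iff' hms] at h0
  · have h1 : ∀ᵐ y ∂(volume.restrict (e '' (W ∩ U))), False := by
      rw [ae_restrict_iff' hms]
      filter_upwards [h0] with y hy hmem
      have := hy hmem
      rw [ENNReal.ofReal_eq_zero] at this
      exact absurd (hF.areaElement_pos (hsub hmem)) (not_lt.2 this)
    rw [ae_restrict_iff' hms] at h1
    simp only [imp_false] at h1
    exact hpos.ne' (measure_eq_zero_iff_ae_notMem.2 h1)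
  · refine ENNReal.measurable_ofReal.comp_aemeasurable (ContinuousOn.aemeasurable (fun y hy => ?_)
      hms)
    exact (hF.continuousWithinAt_areaElement (hsub hy)).mono
      (hsub.trans (extChartAt_target_subset_halfSpace x))

/-- On each Borel set this is the area formula in the chart. As an equality of measures, it
transfers integrals of functions. -/
lemma IsAreaMeasure.map_extChartAt (hμ : IsAreaMeasure m F μ) (hF : IsMinimalImmersion m F)
    {x₀ : M} {U : Set M} (hU : MeasurableSet U) (hUs : U ⊆ (extChartAt (𝓡∂ m) x₀).source)
    (hinj : InjOn F U) :
    (μ.restrict U).map (extChartAt (𝓡∂ m) x₀) =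
      (volume.restrict (extChartAt (𝓡∂ m) x₀ '' U)).withDensity
        fun y => ENNReal.ofReal (areaElement F x₀ y) := by
  set e := extChartAt (𝓡∂ m) x₀ with he
  have hae : AEMeasurable e (μ.restrict U) :=
    ((continuousOn_extChartAt x₀).mono hUs).aemeasurable hU
  have hmeas : ∀ B, MeasurableSet B → MeasurableSet (U ∩ e ⁻¹' B) := by
    intro B hB
    have : U ∩ e ⁻¹' B = Subtype.val '' ((U.domRestrict e) ⁻¹' B) := by
      ext x
      simp [and_comm]
    rw [this]
    exact hU.subtype_image ((((continuousOn_extChartAt x₀).mono hUs).domRestrict).measurable hB)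
  ext B hB
  rw [Measure.map_apply_of_aemeasurable hae hB, withDensity_apply _ hB, Measure.restrict_restrict hB,
    Measure.restrict_apply' hU, inter_comm,
    hμ.apply_eq_lintegral hF (hmeas B hB) (inter_subset_left.trans hUs)
      (hinj.mono inter_subset_left), image_inter_preimage, inter_comm]

/-- Integration over `M` in a chart. -/
lemma IsAreaMeasure.setIntegral_eq (hμ : IsAreaMeasure m F μ) (hF : IsMinimalImmersion m F)
    {x₀ : M} {U : Set M} (hU : MeasurableSet U) (hUs : U ⊆ (extChartAt (𝓡∂ m) x₀).source)
    (hinj : InjOn F U) {g : M → ℝ} (hg : ContinuousOn g U) :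
    ∫ x in U, g x ∂μ = ∫ y in extChartAt (𝓡∂ m) x₀ '' U,
      areaElement F x₀ y * g ((extChartAt (𝓡∂ m) x₀).symm y) := by
  set e := extChartAt (𝓡∂ m) x₀ with he
  have hms := measurableSet_image_extChartAt (x₀ := x₀) hU hUs
  have hsub : e '' U ⊆ e.target := by
    rintro _ ⟨z, hz, rfl⟩; exact e.map_source (hUs hz)
  have hmaps : MapsTo e.symm (e '' U) U := by
    rintro _ ⟨z, hz, rfl⟩; rwa [e.left_inv (hUs hz)]
  have hae : AEMeasurable e (μ.restrict U) :=
    ((continuousOn_extChartAt x₀).mono hUs).aemeasurable hU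
  have hgs : AEStronglyMeasurable (g ∘ e.symm) (volume.restrict (e '' U)) :=
    (hg.comp ((continuousOn_extChartAt_symm x₀).mono hsub) hmaps).aestronglyMeasurable hms
  have hJ : AEMeasurable (fun y => ENNReal.ofReal (areaElement F x₀ y))
      (volume.restrict (e '' U)) := by
    refine ENNReal.measurable_ofReal.comp_aemeasurable (ContinuousOn.aemeasurable (fun y hy => ?_)
      hms)
    exact (hF.continuousWithinAt_areaElement (hsub hy)).mono
      (hsub.trans (extChartAt_target_subset_halfSpace x₀))
  have h1 : ∫ x in U, g x ∂μ = ∫ x in U, (g ∘ e.symm) (e x) ∂μ := by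
    refine setIntegral_congr_fun hU fun x hx => ?_
    simp [e.left_inv (hUs hx)]
  rw [h1, ← integral_map hae, hμ.map_extChartAt hF hU hUs hinj,
    integral_withDensity_eq_integral_toReal_smul₀ hJ (by simp)]
  · refine setIntegral_congr_fun hms fun y _ => ?_
    simp [ENNReal.toReal_ofReal (LinearMap.normDet_nonneg _), areaElement]
  · rw [hμ.map_extChartAt hF hU hUs hinj]
    exact hgs.mono_ac (withDensity_absolutelyContinuous _ _)

end AreaMeasure

/-! ### Smoothness and derivative of determinants -/

section Jacobi

variable {ι X : Type*} [Fintype ι] [DecidableEq ι] [NormedAddCommGroup X] [NormedSpace ℝ X]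

lemma contDiffAt_matrix_det {k : WithTop ℕ∞} {g : X → Matrix ι ι ℝ} {y : X}
    (h : ∀ i j, ContDiffAt ℝ k (fun x => g x i j) y) :
    ContDiffAt ℝ k (fun x => (g x).det) y := by
  simp only [Matrix.det_apply']
  refine ContDiffAt.sum fun σ _ => contDiffAt_const.mul ?_
  exact contDiffAt_prod fun i _ => h _ _

lemma contDiffAt_matrix_inv {k : WithTop ℕ∞} {g : X → Matrix ι ι ℝ} {y : X}
    (h : ∀ i j, ContDiffAt ℝ k (fun x => g x i j) y) (hdet : (g y).det ≠ 0) (i j : ι) :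
    ContDiffAt ℝ k (fun x => (g x)⁻¹ i j) y := by
  simp only [Matrix.inv_def, Matrix.smul_apply, smul_eq_mul, Ring.inverse_eq_inv',
    Matrix.adjugate_apply]
  refine ((contDiffAt_matrix_det h).inv hdet).mul (contDiffAt_matrix_det fun a b => ?_)
  by_cases hab : a = j
  · subst hab
    simp only [Matrix.updateRow_self]
    exact contDiffAt_const
  · simp only [Matrix.updateRow_ne hab]
    exact h a b

/-- Factoring out `A` leaves the determinant of `1 + t • (A⁻¹ * B)`, whose linear coefficient in `t`
is the trace. -/
lemma hasDerivAt_det_add_smul (A B : Matrix ι ι ℝ) (hA : A.det ≠ 0) :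
    HasDerivAt (fun t : ℝ => (A + t • B).det) (A.det * (A⁻¹ * B).trace) 0 := by
  have hfac : ∀ t : ℝ, (A + t • B).det = A.det * (1 + t • (A⁻¹ * B)).det := fun t => by
    rw [← Matrix.det_mul, mul_add, mul_one, mul_smul_comm, ← mul_assoc,
      Matrix.mul_nonsing_inv _ (isUnit_iff_ne_zero.2 hA), one_mul]
  simp_rw [hfac]
  refine HasDerivAt.const_mul _ ?_
  -- What remains of this polynomial in `t` after the constant and linear terms are removed and `t ^
  -- 2` is divided out.
  set P := (1 + (Polynomial.X : Polynomial ℝ) • (A⁻¹ * B).map Polynomial.C).det.divX.divX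
  have h1 : HasDerivAt (fun t : ℝ => (A⁻¹ * B).trace * t) (A⁻¹ * B).trace 0 := by
    simpa using (hasDerivAt_id (0 : ℝ)).const_mul (A⁻¹ * B).trace
  have h2 : HasDerivAt (fun t : ℝ => P.eval t * t ^ 2) 0 0 := by
    have := (P.hasDerivAt 0).mul ((hasDerivAt_id (0 : ℝ)).pow 2)
    simpa [Pi.mul_def] using this
  have h3 : (fun t : ℝ => (1 + t • (A⁻¹ * B)).det) =
      fun t : ℝ => 1 + (A⁻¹ * B).trace * t + P.eval t * t ^ 2 :=
    funext fun t => Matrix.det_one_add_smul t _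
  rw [h3]
  have h4 := (h1.const_add 1).add h2
  rw [add_zero] at h4
  exact h4

/-- Jacobi's formula. -/
lemma fderiv_matrix_det {g : X → Matrix ι ι ℝ} {y : X}
    (h : ∀ i j, DifferentiableAt ℝ (fun x => g x i j) y) (hdet : (g y).det ≠ 0) (v : X) :
    fderiv ℝ (fun x => (g x).det) y v =
      (g y).det * ∑ i, ∑ j, (g y)⁻¹ i j * fderiv ℝ (fun x => g x j i) y v := by
  set Det : (ι → ι → ℝ) → ℝ := fun A => (Matrix.of A).det with hDet
  have hd : ∀ A, DifferentiableAt ℝ Det A := fun A => by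
    refine ContDiffAt.differentiableAt (n := 1) (contDiffAt_matrix_det fun i j => ?_) one_ne_zero
    simp only [Matrix.of_apply]
    fun_prop
  set g' : X → ι → ι → ℝ := fun x i j => g x i j with hg'
  have hg : DifferentiableAt ℝ g' y :=
    differentiableAt_pi.2 fun i => differentiableAt_pi.2 fun j => h i j
  have hcomp : (fun x => (g x).det) = Det ∘ g' := rfl
  rw [hcomp, fderiv_comp y (hd _) hg, ContinuousLinearMap.comp_apply]
  set B := fderiv ℝ g' y v with hB
  have hBij : ∀ i j, B i j = fderiv ℝ (fun x => g x i j) y v := fun i j => by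
    have h1 := (hasFDerivAt_pi'.1 hg.hasFDerivAt i)
    have h2 := (hasFDerivAt_pi'.1 h1 j).fderiv
    have h3 : (fun x => g x i j) = fun x => g' x i j := rfl
    rw [h3, h2]
    rfl
  have hline : HasDerivAt (fun t : ℝ => Det (g' y + t • B)) (fderiv ℝ Det (g' y) B) 0 := by
    have h1 : HasDerivAt (fun t : ℝ => g' y + t • B) B 0 := by
      simpa using ((hasDerivAt_id (0 : ℝ)).smul_const B).const_add (g' y)
    have h2 : HasFDerivAt Det (fderiv ℝ Det (g' y)) (g' y + (0 : ℝ) • B) := by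
      simpa using (hd (g' y)).hasFDerivAt
    exact h2.comp_hasDerivAt 0 h1
  have hjac := hasDerivAt_det_add_smul (g y) (Matrix.of B) hdet
  have := hline.unique hjac
  rw [this]
  congr 1
  simp only [Matrix.trace, Matrix.diag_apply, Matrix.mul_apply, Matrix.of_apply, hBij]

end Jacobi

/-! ### Gram matrices and orthogonal projection in coordinates -/

section LinearAlgebra

variable {m : ℕ} {E' : Type*} [NormedAddCommGroup E'] [InnerProductSpace ℝ E']

/-- The Gram matrix of the images of the standard basis. -/
noncomputable def linGram (D : EuclideanSpace ℝ (Fin m) →L[ℝ] E') : Matrix (Fin m) (Fin m) ℝ :=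
  Matrix.of fun i j =>
    inner ℝ (D (EuclideanSpace.single i 1)) (D (EuclideanSpace.single j 1))

/-- The coordinates of the projection of `w` to the range of `D`. -/
noncomputable def projCoord (D : EuclideanSpace ℝ (Fin m) →L[ℝ] E') (w : E') :
    EuclideanSpace ℝ (Fin m) :=
  WithLp.toLp 2 ((linGram D)⁻¹.mulVec fun j => inner ℝ (D (EuclideanSpace.single j 1)) w)

lemma normDet_sq_eq_det_linGram (D : EuclideanSpace ℝ (Fin m) →L[ℝ] E') :
    D.toLinearMap.normDet ^ 2 = (linGram D).det := by
  have := D.toLinearMap.normDet_sq_eq_det_gram (EuclideanSpace.basisFun (Fin m) ℝ)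
  simp only [ContinuousLinearMap.coe_coe, RCLike.ofReal_real_eq_id, id,
    EuclideanSpace.basisFun_apply] at this
  rw [this]
  rfl

variable {D : EuclideanSpace ℝ (Fin m) →L[ℝ] E'}

lemma det_linGram_pos (hD : Function.Injective D) : 0 < (linGram D).det := by
  rw [← normDet_sq_eq_det_linGram]
  exact pow_pos (normDet_pos hD) 2

lemma normDet_eq_sqrt (D : EuclideanSpace ℝ (Fin m) →L[ℝ] E') :
    D.toLinearMap.normDet = √(linGram D).det := by
  rw [← normDet_sq_eq_det_linGram, Real.sqrt_sq (LinearMap.normDet_nonneg _)]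

lemma euclideanSpace_eq_sum (v : EuclideanSpace ℝ (Fin m)) :
    v = ∑ i, v i • EuclideanSpace.single i (1 : ℝ) := by
  have := (EuclideanSpace.basisFun (Fin m) ℝ).sum_repr v
  simpa using this.symm

/-- These are the normal equations of least squares: the coordinate vector is defined by inverting
the Gram matrix, which checks the identity on the standard basis, and linearity does the rest. -/
lemma inner_projCoord (hD : Function.Injective D) (w : E') (v : EuclideanSpace ℝ (Fin m)) :
    inner ℝ (D (projCoord D w)) (D v) = inner ℝ w (D v) := by
  have hdet := (det_linGram_pos hD).ne'
  have hbasis : ∀ j, inner ℝ (D (projCoord D w)) (D (EuclideanSpace.single j 1)) =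
      inner ℝ w (D (EuclideanSpace.single j 1)) := by
    intro j
    have h1 : (linGram D).mulVec (projCoord D w) =
        fun j => inner ℝ (D (EuclideanSpace.single j 1)) w := by
      show (linGram D).mulVec ((linGram D)⁻¹.mulVec _) = _
      rw [Matrix.mulVec_mulVec, Matrix.mul_nonsing_inv _ (isUnit_iff_ne_zero.2 hdet),
        Matrix.one_mulVec]
    have h2 := congrFun h1 j
    simp only [Matrix.mulVec, dotProduct, linGram, Matrix.of_apply] at h2
    rw [real_inner_comm, real_inner_comm _ w, ← h2]
    conv_lhs => rw [euclideanSpace_eq_sum (projCoord D w)]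
    rw [map_sum, inner_sum]
    refine Finset.sum_congr rfl fun i _ => ?_
    rw [map_smul, inner_smul_right, mul_comm]
  conv_lhs => rw [euclideanSpace_eq_sum v]
  conv_rhs => rw [euclideanSpace_eq_sum v]
  simp only [map_sum, inner_sum, map_smul, inner_smul_right, hbasis]

lemma map_projCoord (hD : Function.Injective D) (w : E') :
    D (projCoord D w) = (LinearMap.range D.toLinearMap).starProjection w := by
  refine (Submodule.eq_starProjection_of_mem_orthogonal (LinearMap.mem_range_self _ _) ?_).symm
  rw [Submodule.mem_orthogonal]
  rintro _ ⟨v, rfl⟩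
  rw [real_inner_comm, inner_sub_left]
  have := inner_projCoord hD w v
  simp only [ContinuousLinearMap.coe_coe]
  linarith

/-- The trace of an endomorphism in terms of the Gram matrix. -/
lemma sum_inv_linGram_mul_inner (hD : Function.Injective D)
    (L : EuclideanSpace ℝ (Fin m) →L[ℝ] EuclideanSpace ℝ (Fin m)) :
    ∑ i, ∑ j, (linGram D)⁻¹ i j * inner ℝ (D (L (EuclideanSpace.single i 1)))
      (D (EuclideanSpace.single j 1)) = ∑ i, L (EuclideanSpace.single i 1) i := by
  have hdet := (det_linGram_pos hD).ne'
  refine Finset.sum_congr rfl fun i _ => ?_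
  set u := L (EuclideanSpace.single i 1)
  have h1 : ∀ j, inner ℝ (D u) (D (EuclideanSpace.single j 1)) = (linGram D).mulVec u j := by
    intro j
    conv_lhs => rw [euclideanSpace_eq_sum u]
    rw [map_sum, sum_inner]
    simp only [Matrix.mulVec, dotProduct, linGram, Matrix.of_apply]
    refine Finset.sum_congr rfl fun k _ => ?_
    rw [map_smul, inner_smul_left, mul_comm, real_inner_comm]
    rfl
  simp only [h1]
  have h2 : (linGram D)⁻¹.mulVec ((linGram D).mulVec u) = u := by
    rw [Matrix.mulVec_mulVec, Matrix.nonsing_inv_mul _ (isUnit_iff_ne_zero.2 hdet),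
      Matrix.one_mulVec]
  exact congrFun h2 i

lemma linGram_inv_symm (D : EuclideanSpace ℝ (Fin m) →L[ℝ] E')
    (i j : Fin m) : (linGram D)⁻¹ i j = (linGram D)⁻¹ j i := by
  have hsymm : (linGram D).transpose = linGram D := by
    ext i j
    simp only [linGram, Matrix.transpose_apply, Matrix.of_apply]
    rw [real_inner_comm]
  have := Matrix.transpose_nonsing_inv (linGram D)
  rw [hsymm] at this
  exact (congrFun (congrFun this j) i)

end LinearAlgebra

/-! ### The divergence identity in a chart -/

section ChartDivergence

variable {m n : ℕ} [NeZero m] {f : EuclideanSpace ℝ (Fin m) → EuclideanSpace ℝ (Fin n)}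
  {O : Set (EuclideanSpace ℝ (Fin m))} {y : EuclideanSpace ℝ (Fin m)}

lemma halfSpace_mem_nhds_of_subset (hO : IsOpen O) (hOC : O ⊆ halfSpace m) (hy : y ∈ O) :
    halfSpace m ∈ 𝓝 y :=
  mem_of_superset (hO.mem_nhds hy) hOC

lemma paramD_eventuallyEq (hO : IsOpen O) (hOC : O ⊆ halfSpace m) (hy : y ∈ O) :
    paramD f =ᶠ[𝓝 y] fderiv ℝ f := by
  filter_upwards [hO.mem_nhds hy] with w hw
  exact fderivWithin_of_mem_nhds (halfSpace_mem_nhds_of_subset hO hOC hw)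

lemma contDiffAt_paramD (hO : IsOpen O) (hOC : O ⊆ halfSpace m) (hf : ContDiffOn ℝ ∞ f O)
    (hy : y ∈ O) : ContDiffAt ℝ ∞ (paramD f) y := by
  refine ContDiffAt.congr_of_eventuallyEq ?_ (paramD_eventuallyEq hO hOC hy)
  exact (hf.contDiffAt (hO.mem_nhds hy)).fderiv_right (m := ∞) (by simp)

lemma hasFDerivAt_paramD (hO : IsOpen O) (hOC : O ⊆ halfSpace m) (hf : ContDiffOn ℝ ∞ f O)
    (hy : y ∈ O) : HasFDerivAt f (paramD f y) y := by
  rw [(paramD_eventuallyEq hO hOC hy).eq_of_nhds]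
  exact ((hf.contDiffAt (hO.mem_nhds hy)).differentiableAt (by simp)).hasFDerivAt

lemma hasFDerivAt_paramD2 (hO : IsOpen O) (hOC : O ⊆ halfSpace m) (hf : ContDiffOn ℝ ∞ f O)
    (hy : y ∈ O) : HasFDerivAt (paramD f) (paramD2 f y) y := by
  have : paramD2 f y = fderiv ℝ (paramD f) y :=
    fderivWithin_of_mem_nhds (halfSpace_mem_nhds_of_subset hO hOC hy)
  rw [this]
  exact ((contDiffAt_paramD hO hOC hf hy).differentiableAt (by simp)).hasFDerivAt

lemma paramD2_symm (hO : IsOpen O) (hOC : O ⊆ halfSpace m) (hf : ContDiffOn ℝ ∞ f O)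
    (hy : y ∈ O) (v w : EuclideanSpace ℝ (Fin m)) : paramD2 f y v w = paramD2 f y w v :=
  second_derivative_symmetric_of_eventually
    (by filter_upwards [hO.mem_nhds hy] with z hz using hasFDerivAt_paramD hO hOC hf hz)
    (hasFDerivAt_paramD2 hO hOC hf hy) v w

lemma contDiffAt_linGram_paramD (hO : IsOpen O) (hOC : O ⊆ halfSpace m)
    (hf : ContDiffOn ℝ ∞ f O) (hy : y ∈ O) (i j : Fin m) :
    ContDiffAt ℝ ∞ (fun z => linGram (paramD f z) i j) y := by
  simp only [linGram, Matrix.of_apply]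
  have h := contDiffAt_paramD hO hOC hf hy
  exact (h.clm_apply contDiffAt_const).inner ℝ (h.clm_apply contDiffAt_const)

lemma contDiffAt_normDet_paramD (hO : IsOpen O) (hOC : O ⊆ halfSpace m)
    (hf : ContDiffOn ℝ ∞ f O) (hy : y ∈ O) (hinj : Function.Injective (paramD f y)) :
    ContDiffAt ℝ ∞ (fun z => (paramD f z).toLinearMap.normDet) y := by
  simp only [normDet_eq_sqrt]
  exact (contDiffAt_matrix_det fun i j => contDiffAt_linGram_paramD hO hOC hf hy i j).sqrt
    (det_linGram_pos hinj).ne'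

/-- The coordinates of the tangential part of the radial vector field. -/
noncomputable def radialCoord (f : EuclideanSpace ℝ (Fin m) → EuclideanSpace ℝ (Fin n))
    (p : EuclideanSpace ℝ (Fin n)) (y : EuclideanSpace ℝ (Fin m)) : EuclideanSpace ℝ (Fin m) :=
  projCoord (paramD f y) (f y - p)

lemma contDiffAt_radialCoord (hO : IsOpen O) (hOC : O ⊆ halfSpace m)
    (hf : ContDiffOn ℝ ∞ f O) (hy : y ∈ O) (hinj : Function.Injective (paramD f y))
    (p : EuclideanSpace ℝ (Fin n)) : ContDiffAt ℝ ∞ (radialCoord f p) y := by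
  rw [contDiffAt_piLp]
  intro i
  have h := contDiffAt_paramD hO hOC hf hy
  show ContDiffAt ℝ ∞ (fun z => ∑ j, (linGram (paramD f z))⁻¹ i j *
    inner ℝ (paramD f z (EuclideanSpace.single j 1)) (f z - p)) y
  refine ContDiffAt.sum fun j _ => ContDiffAt.mul ?_ ?_
  · exact contDiffAt_matrix_inv (fun i j => contDiffAt_linGram_paramD hO hOC hf hy i j)
      (det_linGram_pos hinj).ne' i j
  · exact (h.clm_apply contDiffAt_const).inner ℝ
      ((hf.contDiffAt (hO.mem_nhds hy)).sub contDiffAt_const)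

/-- The logarithmic derivative of the area element. -/
lemma fderiv_normDet_paramD (hO : IsOpen O) (hOC : O ⊆ halfSpace m)
    (hf : ContDiffOn ℝ ∞ f O) (hy : y ∈ O) (hinj : Function.Injective (paramD f y))
    (v : EuclideanSpace ℝ (Fin m)) :
    fderiv ℝ (fun z => (paramD f z).toLinearMap.normDet) y v =
      (paramD f y).toLinearMap.normDet * ∑ i, ∑ j, (linGram (paramD f y))⁻¹ i j *
        inner ℝ (paramD2 f y v (EuclideanSpace.single i 1))
          (paramD f y (EuclideanSpace.single j 1)) := by
  have hdet := det_linGram_pos hinj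
  have hD := hasFDerivAt_paramD2 hO hOC hf hy
  have hG : ∀ i j, DifferentiableAt ℝ (fun z => linGram (paramD f z) i j) y := fun i j =>
    (contDiffAt_linGram_paramD hO hOC hf hy i j).differentiableAt (by simp)
  have hGd : ∀ i j, fderiv ℝ (fun z => linGram (paramD f z) i j) y v =
      inner ℝ (paramD2 f y v (EuclideanSpace.single i 1))
        (paramD f y (EuclideanSpace.single j 1)) +
      inner ℝ (paramD2 f y v (EuclideanSpace.single j 1))
        (paramD f y (EuclideanSpace.single i 1)) := by
    intro i j
    have h1 : ∀ i : Fin m, HasFDerivAt (fun z => paramD f z (EuclideanSpace.single i 1))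
        ((paramD2 f y).flip (EuclideanSpace.single i 1)) y := fun i => by
      have := hD.clm_apply (hasFDerivAt_const (EuclideanSpace.single i (1 : ℝ)) y)
      simpa using this
    have h2 := ((h1 i).inner ℝ (h1 j)).fderiv
    have h3 : (fun z => linGram (paramD f z) i j) = fun z =>
      inner ℝ (paramD f z (EuclideanSpace.single i 1))
        (paramD f z (EuclideanSpace.single j 1)) := rfl
    rw [h3, h2]
    simp only [ContinuousLinearMap.comp_apply, ContinuousLinearMap.prod_apply,
      fderivInnerCLM_apply, ContinuousLinearMap.flip_apply]
    rw [real_inner_comm, add_comm]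
  simp only [normDet_eq_sqrt]
  have hdd : DifferentiableAt ℝ (fun z => (linGram (paramD f z)).det) y :=
    (contDiffAt_matrix_det fun i j =>
      contDiffAt_linGram_paramD hO hOC hf hy i j).differentiableAt (by simp)
  rw [fderiv_sqrt hdd hdet.ne', _root_.smul_apply, smul_eq_mul,
    fderiv_matrix_det hG hdet.ne']
  set a : Fin m → Fin m → ℝ := fun i j => inner ℝ (paramD2 f y v (EuclideanSpace.single i 1))
          (paramD f y (EuclideanSpace.single j 1)) with ha
  set b := (linGram (paramD f y))⁻¹ with hb
  -- The product rule gives two terms for each Gram entry. They contribute equally because the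
  -- inverse Gram matrix is symmetric, and the resulting `2` cancels the one from differentiating
  -- the square root.
  have hsum : ∑ i, ∑ j, b i j * fderiv ℝ (fun z => linGram (paramD f z) j i) y v =
      2 * ∑ i, ∑ j, b i j * a i j := by
    simp only [hGd]
    have h1 : ∑ i, ∑ j, b i j * a j i = ∑ i, ∑ j, b i j * a i j := by
      rw [Finset.sum_comm]
      refine Finset.sum_congr rfl fun i _ => Finset.sum_congr rfl fun j _ => ?_
      rw [hb, linGram_inv_symm]
    simp only [mul_add, Finset.sum_add_distrib]
    have h2 : ∀ i j, inner ℝ (paramD2 f y v (EuclideanSpace.single i 1))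
          (paramD f y (EuclideanSpace.single j 1)) = a i j := fun _ _ => rfl
    simp only [h2]
    rw [h1]
    ring
  rw [hsum]
  set d := (linGram (paramD f y)).det
  have hs : √d * √d = d := Real.mul_self_sqrt hdet.le
  have hs0 : √d ≠ 0 := (Real.sqrt_pos.2 hdet).ne'
  field_simp
  rw [sq, hs]

/-- On a minimal submanifold the divergence of the tangential part of the radial vector field,
in coordinates. -/
lemma sum_fderiv_radialCoord (hO : IsOpen O) (hOC : O ⊆ halfSpace m)
    (hf : ContDiffOn ℝ ∞ f O) (hinj : ∀ z ∈ O, Function.Injective (paramD f z))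
    (hy : y ∈ O) (hH : paramMeanCurvature f y = 0) (p : EuclideanSpace ℝ (Fin n)) :
    ∑ i, fderiv ℝ (radialCoord f p) y (EuclideanSpace.single i 1) i =
      m - ∑ i, ∑ j, (linGram (paramD f y))⁻¹ i j *
        inner ℝ (paramD2 f y (radialCoord f p y) (EuclideanSpace.single i 1))
          (paramD f y (EuclideanSpace.single j 1)) := by
  have hD := hasFDerivAt_paramD2 hO hOC hf hy
  have hfd := hasFDerivAt_paramD hO hOC hf hy
  have hc := ((contDiffAt_radialCoord hO hOC hf hy (hinj y hy) p).differentiableAt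
    (by simp)).hasFDerivAt
  set c := radialCoord f p with hcdef
  set c' := fderiv ℝ c y with hc'
  set D := paramD f y with hDdef
  -- Differentiate `⟨D c, D v⟩ = ⟨f - p, D v⟩`, which holds near `y`, in the direction `u`. The
  -- terms with second derivatives of `f` against `D v` collect into one involving only the normal
  -- part of `f - p`.
  have key : ∀ u v, inner ℝ (D (c' u)) (D v) = inner ℝ (D u) (D v) +
      inner ℝ ((f y - p) - D (c y)) (paramD2 f y u v) - inner ℝ (paramD2 f y (c y) u) (D v) := by
    intro u v
    have hv : HasFDerivAt (fun z => paramD f z v) ((paramD2 f y).flip v) y := by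
      have := hD.clm_apply (hasFDerivAt_const v y)
      simpa using this
    have h1 := ((hD.clm_apply hc).inner ℝ hv).fderiv
    have h2 := ((hfd.sub_const p).inner ℝ hv).fderiv
    have heq : (fun z => inner ℝ (paramD f z (c z)) (paramD f z v)) =ᶠ[𝓝 y]
        fun z => inner ℝ (f z - p) (paramD f z v) := by
      filter_upwards [hO.mem_nhds hy] with z hz
      exact inner_projCoord (hinj z hz) _ _
    rw [heq.fderiv_eq, h2] at h1
    have h3 := DFunLike.congr_fun h1 u
    simp only [ContinuousLinearMap.comp_apply, ContinuousLinearMap.prod_apply,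
      fderivInnerCLM_apply, ContinuousLinearMap.flip_apply, _root_.add_apply,
      inner_add_left] at h3
    rw [inner_sub_left, paramD2_symm hO hOC hf hy (c y) u]
    linarith
  have hid := sum_inv_linGram_mul_inner (hinj y hy) (ContinuousLinearMap.id ℝ _)
  have htr := sum_inv_linGram_mul_inner (hinj y hy) c'
  simp only [ContinuousLinearMap.id_apply, PiLp.single_apply, if_true,
    Finset.sum_const, Finset.card_univ, Fintype.card_fin, nsmul_eq_mul, mul_one] at hid
  rw [← htr]
  simp only [← hDdef, key, mul_sub, mul_add, Finset.sum_add_distrib, Finset.sum_sub_distrib]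
  rw [hid]
  -- The trace of the normal term is the inner product of `f - p` with the mean curvature vector.
  -- This is where minimality enters.
  have hzero : ∑ i, ∑ j, (linGram D)⁻¹ i j * inner ℝ ((f y - p) - D (c y))
      (paramD2 f y (EuclideanSpace.single i 1) (EuclideanSpace.single j 1)) = 0 := by
    have h1 : (f y - p) - D (c y) =
        (LinearMap.range D.toLinearMap)ᗮ.starProjection (f y - p) := by
      rw [Submodule.starProjection_orthogonal_val]
      rw [hcdef, radialCoord, ← hDdef, map_projCoord (hinj y hy)]
    have h2 : inner ℝ (f y - p) (paramMeanCurvature f y) = 0 := by rw [hH, inner_zero_right]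
    rw [← h2, paramMeanCurvature, inner_sum]
    refine Finset.sum_congr rfl fun i _ => ?_
    rw [inner_sum]
    refine Finset.sum_congr rfl fun j _ => ?_
    rw [inner_smul_right, h1, Submodule.inner_starProjection_left_eq_right]
    rfl
  rw [hzero, add_zero]

/-- The weighted divergence identity in a chart, integrated against a test function. -/
theorem integral_radialCoord_eq_zero (hO : IsOpen O) (hOC : O ⊆ halfSpace m)
    (hf : ContDiffOn ℝ ∞ f O) (hinj : ∀ z ∈ O, Function.Injective (paramD f z))
    (hH : ∀ z ∈ O, paramMeanCurvature f z = 0) (p : EuclideanSpace ℝ (Fin n))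
    {ζ : EuclideanSpace ℝ (Fin m) → ℝ} (hζ : ContDiff ℝ 1 ζ) (hζc : HasCompactSupport ζ)
    (hζO : tsupport ζ ⊆ O) :
    ∫ y, (paramD f y).toLinearMap.normDet * (fderiv ℝ ζ y (radialCoord f p y) + m * ζ y) = 0 := by
  set J := fun z => (paramD f z).toLinearMap.normDet with hJ
  set c := radialCoord f p with hc
  set X : Fin m → EuclideanSpace ℝ (Fin m) → ℝ := fun i y => ζ y * (J y * c y i) with hX
  have hJd : ∀ y ∈ O, ContDiffAt ℝ ∞ J y := fun y hy =>
    contDiffAt_normDet_paramD hO hOC hf hy (hinj y hy)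
  have hcd : ∀ y ∈ O, ContDiffAt ℝ ∞ c y := fun y hy =>
    contDiffAt_radialCoord hO hOC hf hy (hinj y hy) p
  have hXc : ∀ i, HasCompactSupport (X i) := fun i => hζc.mul_right
  have hXd : ∀ i, ContDiff ℝ 1 (X i) := by
    intro i
    rw [contDiff_iff_contDiffAt]
    intro y
    by_cases hy : y ∈ tsupport ζ
    · have h1 : ContDiffAt ℝ 1 J y := (hJd y (hζO hy)).of_le (mod_cast le_top)
      have h2 : ContDiffAt ℝ 1 c y := (hcd y (hζO hy)).of_le (mod_cast le_top)
      have h2 := (contDiffAt_piLp 2).1 h2 i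
      exact hζ.contDiffAt.mul (h1.mul h2)
    · have : X i =ᶠ[𝓝 y] fun _ => 0 := by
        filter_upwards [notMem_tsupport_iff_eventuallyEq.1 hy] with z hz
        simp [hX, hz]
      exact contDiffAt_const.congr_of_eventuallyEq this
  have hXi : ∀ i, Integrable (fun y => fderiv ℝ (X i) y (EuclideanSpace.single i 1)) := by
    intro i
    refine Continuous.integrable_of_hasCompactSupport ?_ ?_
    · exact ((hXd i).continuous_fderiv one_ne_zero).clm_apply continuous_const
    · exact (hXc i).fderiv_apply (𝕜 := ℝ) _
  have hXint : ∀ i, ∫ y, fderiv ℝ (X i) y (EuclideanSpace.single i 1) = 0 := by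
    intro i
    -- Integration by parts against the constant `1`: the derivative of a compactly supported `C¹`
    -- function has integral zero.
    have := integral_mul_fderiv_eq_neg_fderiv_mul_of_integrable (μ := volume) (f := X i)
      (g := fun _ => (1 : ℝ)) (v := EuclideanSpace.single i 1) (by simpa using hXi i) (by simp)
      (by simpa using (hXd i).continuous.integrable_of_hasCompactSupport (hXc i))
      (fun x _ => (hXd i).differentiable one_ne_zero x) (fun x _ => differentiableAt_const _)
    simp at this
    exact this
  -- The integrand is the Euclidean divergence of `ζ J c`. The derivative of `J` along `c` cancels
  -- the second-order sum left over in the divergence of `c`, so that `J c` has divergence `m J`.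
  have hsum : ∀ y, J y * (fderiv ℝ ζ y (c y) + m * ζ y) =
      ∑ i, fderiv ℝ (X i) y (EuclideanSpace.single i 1) := by
    intro y
    by_cases hy : y ∈ tsupport ζ
    · have hyO := hζO hy
      have hζy := (hζ.differentiable one_ne_zero y).hasFDerivAt
      have hJy := ((hJd y hyO).differentiableAt (by simp)).hasFDerivAt
      have hcy := ((hcd y hyO).differentiableAt (by simp)).hasFDerivAt
      have hXf : ∀ i, fderiv ℝ (X i) y (EuclideanSpace.single i 1) =
          J y * (c y i * fderiv ℝ ζ y (EuclideanSpace.single i 1)) +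
          ζ y * (c y i * fderiv ℝ J y (EuclideanSpace.single i 1)) +
          ζ y * J y * (fderiv ℝ c y (EuclideanSpace.single i 1) i) := by
        intro i
        have hci : HasFDerivAt (fun z => c z i)
            ((EuclideanSpace.proj i : _ →L[ℝ] ℝ).comp (fderiv ℝ c y)) y :=
          (EuclideanSpace.proj i : _ →L[ℝ] ℝ).hasFDerivAt.comp y hcy
        have hXi : X i = ζ * (J * fun z => c z i) := rfl
        rw [hXi, (hζy.mul (hJy.mul hci)).fderiv]
        simp
        ring
      have hlin : ∀ L : EuclideanSpace ℝ (Fin m) →L[ℝ] ℝ,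
          ∑ i, c y i * L (EuclideanSpace.single i 1) = L (c y) := by
        intro L
        conv_rhs => rw [euclideanSpace_eq_sum (c y)]
        simp
      simp only [hXf, Finset.sum_add_distrib, ← Finset.mul_sum, hlin]
      rw [sum_fderiv_radialCoord hO hOC hf hinj hyO (hH y hyO) p,
        fderiv_normDet_paramD hO hOC hf hyO (hinj y hyO)]
      ring
    · have hζ0 := notMem_tsupport_iff_eventuallyEq.1 hy
      have hX0 : ∀ i, X i =ᶠ[𝓝 y] fun _ => 0 := fun i => by
        filter_upwards [hζ0] with z hz
        simp [hX, hz]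
      have h1 : ∀ i, fderiv ℝ (X i) y = 0 := fun i => by
        rw [(hX0 i).fderiv_eq]; simp
      have h2 : fderiv ℝ ζ y = 0 := by
        rw [hζ0.fderiv_eq]; simp
      simp [h1, h2, hζ0.eq_of_nhds]
  rw [integral_congr_ae (ae_of_all _ hsum), integral_finsetSum _ fun i _ => hXi i]
  simp [hXint]

end ChartDivergence

/-! ### The tangential radial field on the manifold -/

section RadialField

variable {m n : ℕ} [NeZero m] {M : Type*} [TopologicalSpace M]
  [ChartedSpace (EuclideanHalfSpace m) M]

/-- The tangential part of the radial vector field `F x - p`, as a tangent vector of `M`. -/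
noncomputable def radialField (F : M → EuclideanSpace ℝ (Fin n)) (p : EuclideanSpace ℝ (Fin n))
    (x : M) : TangentSpace (𝓡∂ m) x :=
  projCoord (mfderiv (𝓡∂ m) 𝓘(ℝ, EuclideanSpace ℝ (Fin n)) F x :
    EuclideanSpace ℝ (Fin m) →L[ℝ] EuclideanSpace ℝ (Fin n)) (F x - p)

/-- The derivative of `ψ` along the tangential part of the radial vector field. -/
noncomputable def radialDeriv (m : ℕ) [NeZero m] [ChartedSpace (EuclideanHalfSpace m) M]
    (F : M → EuclideanSpace ℝ (Fin n)) (p : EuclideanSpace ℝ (Fin n))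
    (ψ : M → ℝ) (x : M) : ℝ :=
  (mfderiv (𝓡∂ m) 𝓘(ℝ, ℝ) ψ x : EuclideanSpace ℝ (Fin m) →L[ℝ] ℝ) (radialField F p x)

/-- The squared length of the tangential part of the radial vector field. -/
noncomputable def tangentialSq (m : ℕ) [NeZero m] [ChartedSpace (EuclideanHalfSpace m) M]
    (F : M → EuclideanSpace ℝ (Fin n)) (p : EuclideanSpace ℝ (Fin n)) (x : M) : ℝ :=
  ‖(tangentPlane m F x).starProjection (F x - p)‖ ^ 2

variable {F : M → EuclideanSpace ℝ (Fin n)}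

lemma mfderiv_radialField (hF : IsMinimalImmersion m F) (p : EuclideanSpace ℝ (Fin n)) (x : M) :
    (mfderiv (𝓡∂ m) 𝓘(ℝ, EuclideanSpace ℝ (Fin n)) F x :
      EuclideanSpace ℝ (Fin m) →L[ℝ] EuclideanSpace ℝ (Fin n)) (radialField F p x) =
      (tangentPlane m F x).starProjection (F x - p) :=
  map_projCoord (hF.injective_mfderiv x) (F x - p)

lemma radialDeriv_of_eventuallyEq_zero {ψ : M → ℝ} {x : M} (p : EuclideanSpace ℝ (Fin n))
    (h : ψ =ᶠ[𝓝 x] fun _ => 0) : radialDeriv m F p ψ x = 0 := by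
  unfold radialDeriv
  rw [h.mfderiv_eq, mfderiv_const]
  rfl

lemma interior_extChartAt_target_subset (x₀ : M) :
    interior (extChartAt (𝓡∂ m) x₀).target ⊆ halfSpace m :=
  interior_subset.trans (extChartAt_target_subset_halfSpace x₀)

lemma radialDeriv_mul (p : EuclideanSpace ℝ (Fin n)) {u v : M → ℝ} {x : M}
    (hu : MDifferentiableAt (𝓡∂ m) 𝓘(ℝ, ℝ) u x) (hv : MDifferentiableAt (𝓡∂ m) 𝓘(ℝ, ℝ) v x) :
    radialDeriv m F p (fun z => u z * v z) x =
      u x * radialDeriv m F p v x + v x * radialDeriv m F p u x := by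
  have := (hu.hasMFDerivAt.mul hv.hasMFDerivAt).mfderiv
  unfold radialDeriv
  have h2 : (fun z => u z * v z) = u * v := rfl
  rw [h2, this]
  rfl

lemma radialDeriv_finsetSum (p : EuclideanSpace ℝ (Fin n)) {ι : Type*} {t : Finset ι}
    {u : ι → M → ℝ} {x : M} (hu : ∀ i ∈ t, MDifferentiableAt (𝓡∂ m) 𝓘(ℝ, ℝ) (u i) x) :
    radialDeriv m F p (fun z => ∑ i ∈ t, u i z) x = ∑ i ∈ t, radialDeriv m F p (u i) x := by
  classical
  have key : ∀ t : Finset ι, (∀ i ∈ t, MDifferentiableAt (𝓡∂ m) 𝓘(ℝ, ℝ) (u i) x) →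
      MDifferentiableAt (𝓡∂ m) 𝓘(ℝ, ℝ) (fun z => ∑ i ∈ t, u i z) x ∧
      radialDeriv m F p (fun z => ∑ i ∈ t, u i z) x = ∑ i ∈ t, radialDeriv m F p (u i) x := by
    intro t
    induction t using Finset.induction_on with
    | empty =>
      intro _
      simp only [Finset.sum_empty]
      exact ⟨mdifferentiableAt_const, radialDeriv_of_eventuallyEq_zero p (by rfl)⟩
    | insert a t ha ih =>
      intro h
      obtain ⟨h1, h2⟩ := ih fun i hi => h i (Finset.mem_insert_of_mem hi)
      have h3 := (h a (Finset.mem_insert_self a t)).hasMFDerivAt.add h1.hasMFDerivAt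
      have h4 : (fun z => ∑ i ∈ insert a t, u i z) = u a + fun z => ∑ i ∈ t, u i z := by
        ext z
        rw [Finset.sum_insert ha, Pi.add_apply]
      rw [h4, Finset.sum_insert ha, ← h2]
      refine ⟨h3.mdifferentiableAt, ?_⟩
      unfold radialDeriv
      rw [h3.mfderiv]
      rfl
  exact (key t hu).2

/-- The radial derivative of the restriction to `M` of a function on `ℝⁿ`. -/
lemma radialDeriv_comp (hF : IsMinimalImmersion m F) (p : EuclideanSpace ℝ (Fin n))
    {φ : EuclideanSpace ℝ (Fin n) → ℝ} {φ' : EuclideanSpace ℝ (Fin n) →L[ℝ] ℝ} {x : M}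
    (hφ : HasFDerivAt φ φ' (F x)) :
    radialDeriv m F p (fun z => φ (F z)) x =
      φ' ((tangentPlane m F x).starProjection (F x - p)) := by
  have h3 := (hφ.hasMFDerivAt.comp x
    (hF.smooth.contMDiffAt.mdifferentiableAt (by simp)).hasMFDerivAt).mfderiv
  have h4 : (fun z => φ (F z)) = φ ∘ F := rfl
  unfold radialDeriv
  rw [h4, h3, ← mfderiv_radialField hF]
  rfl

/-- The projection is self-adjoint and idempotent. This is the source of `z·q = 2T`. -/
lemma inner_starProjection_tangentPlane (p : EuclideanSpace ℝ (Fin n)) (x : M) :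
    inner ℝ (F x - p) ((tangentPlane m F x).starProjection (F x - p)) =
      tangentialSq m F p x := by
  rw [tangentialSq, ← real_inner_self_eq_norm_sq, Submodule.inner_starProjection_left_eq_right,
    Submodule.starProjection_eq_self_iff.2 (Submodule.starProjection_apply_mem _ _)]

/-- The chain rule for functions of the squared distance to `p`. -/
lemma radialDeriv_comp_normSq (hF : IsMinimalImmersion m F) (p : EuclideanSpace ℝ (Fin n))
    {h : ℝ → ℝ} {h' : ℝ} {x : M} (hh : HasDerivAt h h' (‖F x - p‖ ^ 2)) :
    radialDeriv m F p (fun z => h (‖F z - p‖ ^ 2)) x = h' * (2 * tangentialSq m F p x) := by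
  have h1 : HasFDerivAt (fun w : EuclideanSpace ℝ (Fin n) => ‖w - p‖ ^ 2)
      (2 • (innerSL ℝ (F x - p)).comp (ContinuousLinearMap.id ℝ _)) (F x) :=
    ((hasFDerivAt_id (F x)).sub_const p).norm_sq
  refine (radialDeriv_comp hF p (hh.comp_hasFDerivAt (F x) h1)).trans ?_
  simp only [_root_.smul_apply, ContinuousLinearMap.comp_apply,
    ContinuousLinearMap.id_apply, innerSL_apply_apply, smul_eq_mul, nsmul_eq_mul,
    inner_starProjection_tangentPlane]
  norm_num

variable [IsManifold (𝓡∂ m) ∞ M]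

/-- The radial field in a chart. -/
lemma mfderiv_extChartAt_radialField (hF : IsMinimalImmersion m F)
    (p : EuclideanSpace ℝ (Fin n)) {x₀ x : M} (hx : x ∈ (extChartAt (𝓡∂ m) x₀).source) :
    (mfderiv (𝓡∂ m) 𝓘(ℝ, EuclideanSpace ℝ (Fin m)) (extChartAt (𝓡∂ m) x₀) x :
      EuclideanSpace ℝ (Fin m) →L[ℝ] EuclideanSpace ℝ (Fin m)) (radialField F p x) =
      radialCoord (localParam F (chartAt _ x₀)) p (extChartAt (𝓡∂ m) x₀ x) := by
  have hy := (extChartAt (𝓡∂ m) x₀).map_source hx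
  apply hF.injective_paramD hy
  have h1 := mfderiv_radialField hF p x
  rw [hF.mfderiv_eq hx, hF.tangentPlane_eq hx] at h1
  have h3 : localParam F (chartAt _ x₀) (extChartAt (𝓡∂ m) x₀ x) = F x := by
    show F ((extChartAt (𝓡∂ m) x₀).symm (extChartAt (𝓡∂ m) x₀ x)) = F x
    rw [(extChartAt (𝓡∂ m) x₀).left_inv hx]
  rw [radialCoord, map_projCoord (hF.injective_paramD hy), h3]
  exact h1

lemma radialDeriv_eq_fderivWithin (hF : IsMinimalImmersion m F)
    (p : EuclideanSpace ℝ (Fin n)) {ψ : M → ℝ} {x₀ x : M}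
    (hx : x ∈ (extChartAt (𝓡∂ m) x₀).source) (hψ : ContMDiffAt (𝓡∂ m) 𝓘(ℝ, ℝ) 1 ψ x) :
    radialDeriv m F p ψ x = fderivWithin ℝ (ψ ∘ (extChartAt (𝓡∂ m) x₀).symm) (halfSpace m)
      (extChartAt (𝓡∂ m) x₀ x)
      (radialCoord (localParam F (chartAt _ x₀)) p (extChartAt (𝓡∂ m) x₀ x)) := by
  rw [← mfderiv_extChartAt_radialField hF p hx, radialDeriv, mfderiv_eq_fderivWithin_comp hx hψ]
  rfl

lemma IsMinimalImmersion.contDiffOn_localParam (hF : IsMinimalImmersion m F) (x₀ : M) :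
    ContDiffOn ℝ ∞ (localParam F (chartAt _ x₀)) (interior (extChartAt (𝓡∂ m) x₀).target) :=
  fun _ hy => (hF.contDiffWithinAt_localParam (interior_subset hy)).mono
    (interior_subset.trans (extChartAt_target_subset_halfSpace x₀))

lemma contDiffAt_radialCoord_localParam (hF : IsMinimalImmersion m F)
    (p : EuclideanSpace ℝ (Fin n)) {x₀ : M} {y : EuclideanSpace ℝ (Fin m)}
    (hy : y ∈ interior (extChartAt (𝓡∂ m) x₀).target) :
    ContDiffAt ℝ ∞ (radialCoord (localParam F (chartAt _ x₀)) p) y :=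
  contDiffAt_radialCoord isOpen_interior (interior_extChartAt_target_subset x₀)
    (hF.contDiffOn_localParam x₀) hy (hF.injective_paramD (interior_subset hy)) p

/-- The radial derivative of a `C¹` function is continuous in the interior. -/
lemma continuousAt_radialDeriv (hF : IsMinimalImmersion m F)
    (p : EuclideanSpace ℝ (Fin n)) {ψ : M → ℝ} {x : M} (hxi : x ∈ (𝓡∂ m).interior M)
    (hψ : ContMDiffAt (𝓡∂ m) 𝓘(ℝ, ℝ) 1 ψ x) : ContinuousAt (radialDeriv m F p ψ) x := by
  have : IsManifold (𝓡∂ m) 1 M := .of_le (n := ∞) (mod_cast le_top)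
  set e := extChartAt (𝓡∂ m) x with he
  have hxs : x ∈ e.source := mem_extChartAt_source x
  have hy := mem_interior_extChartAt_target hxs hxi
  have hev : radialDeriv m F p ψ =ᶠ[𝓝 x] fun z =>
      fderivWithin ℝ (ψ ∘ e.symm) (halfSpace m) (e z)
        (radialCoord (localParam F (chartAt _ x)) p (e z)) := by
    filter_upwards [extChartAt_source_mem_nhds (I := 𝓡∂ m) x,
      (contMDiffAt_iff_contMDiffAt_nhds (by simp)).1 hψ] with z hz hzψ
    exact radialDeriv_eq_fderivWithin hF p hz hzψ
  refine ContinuousAt.congr ?_ hev.symm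
  have hC : halfSpace m ∈ 𝓝 (e x) :=
    halfSpace_mem_nhds_of_subset isOpen_interior (interior_extChartAt_target_subset x) hy
  have h1 : ContinuousAt (fderivWithin ℝ (ψ ∘ e.symm) (halfSpace m)) (e x) := by
    have := contDiffWithinAt_comp_extChartAt_symm (k := 1) (x₀ := x) (e.map_source hxs)
      (by rw [e.left_inv hxs]; exact hψ)
    exact ((this.fderivWithin_right (m := 0) uniqueDiffOn_halfSpace (by simp)
      (extChartAt_target_subset_halfSpace x (e.map_source hxs))).continuousWithinAt).continuousAt hC
  have h2 := (contDiffAt_radialCoord_localParam hF p hy).continuousAt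
  have h3 : ContinuousAt (fun y => fderivWithin ℝ (ψ ∘ e.symm) (halfSpace m) y
        (radialCoord (localParam F (chartAt _ x)) p y)) (e x) := h1.clm_apply h2
  exact h3.comp (continuousAt_extChartAt x)

/-- The tangential part of the radial field has smooth length in the interior. -/
lemma contMDiffAt_tangentialSq (hF : IsMinimalImmersion m F) (p : EuclideanSpace ℝ (Fin n))
    {x : M} (hxi : x ∈ (𝓡∂ m).interior M) :
    ContMDiffAt (𝓡∂ m) 𝓘(ℝ, ℝ) ∞ (tangentialSq m F p) x := by
  set e := extChartAt (𝓡∂ m) x with he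
  set f := localParam F (chartAt (EuclideanHalfSpace m) x) with hf
  have hxs : x ∈ e.source := mem_extChartAt_source x
  have hy := mem_interior_extChartAt_target hxs hxi
  have hev : tangentialSq m F p =ᶠ[𝓝 x]
      (fun y => ‖paramD f y (radialCoord f p y)‖ ^ 2) ∘ e := by
    filter_upwards [extChartAt_source_mem_nhds (I := 𝓡∂ m) x] with z hz
    rw [Function.comp_apply, tangentialSq, ← mfderiv_radialField hF, hF.mfderiv_eq hz, hf, he,
      ← mfderiv_extChartAt_radialField hF p hz]
    rfl
  refine ContMDiffAt.congr_of_eventuallyEq ?_ hev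
  have h1 : ContDiffAt ℝ ∞ (fun y => ‖paramD f y (radialCoord f p y)‖ ^ 2) (e x) :=
    (((contDiffAt_paramD isOpen_interior (interior_extChartAt_target_subset x)
      (hF.contDiffOn_localParam x) hy).clm_apply
      (contDiffAt_radialCoord_localParam hF p hy)).norm_sq ℝ)
  exact ContMDiffAt.comp x h1.contMDiffAt contMDiffAt_extChartAt

end RadialField

/-! ### The weak divergence identity -/

section WeakIdentity

variable {m n : ℕ} [NeZero m] {M : Type*} [TopologicalSpace M]
  [ChartedSpace (EuclideanHalfSpace m) M] {F : M → EuclideanSpace ℝ (Fin n)}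

lemma radialDeriv_of_notMem_tsupport (p : EuclideanSpace ℝ (Fin n)) {ζ : M → ℝ} {x : M}
    (hx : x ∉ tsupport ζ) : radialDeriv m F p ζ x = 0 :=
  radialDeriv_of_eventuallyEq_zero p (notMem_tsupport_iff_eventuallyEq.1 hx)

/-- `ζ` is a `C¹` function with compact support in the interior of `M`. -/
structure IsTestFunction (m : ℕ) [NeZero m] [ChartedSpace (EuclideanHalfSpace m) M]
    (ζ : M → ℝ) : Prop where
  hasCompactSupport : HasCompactSupport ζ
  mem_interior : ∀ x ∈ tsupport ζ, x ∈ (𝓡∂ m).interior M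
  contMDiffAt : ∀ x ∈ tsupport ζ, ContMDiffAt (𝓡∂ m) 𝓘(ℝ, ℝ) 1 ζ x

lemma IsTestFunction.contMDiff {ζ : M → ℝ} (hζ : IsTestFunction m ζ) :
    ContMDiff (𝓡∂ m) 𝓘(ℝ, ℝ) 1 ζ := by
  intro x
  by_cases hx : x ∈ tsupport ζ
  · exact hζ.contMDiffAt x hx
  · exact contMDiffAt_const.congr_of_eventuallyEq (notMem_tsupport_iff_eventuallyEq.1 hx)

lemma IsTestFunction.mul_left {ζ χ : M → ℝ} (hζ : IsTestFunction m ζ)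
    (hχ : ContMDiff (𝓡∂ m) 𝓘(ℝ, ℝ) 1 χ) : IsTestFunction m (fun x => χ x * ζ x) where
  hasCompactSupport := hζ.hasCompactSupport.mul_left
  mem_interior x hx := hζ.mem_interior x (tsupport_mul_subset_right hx)
  contMDiffAt _ _ := hχ.contMDiffAt.mul hζ.contMDiff.contMDiffAt

variable [IsManifold (𝓡∂ m) ∞ M]

lemma IsTestFunction.continuous_radialDeriv (hF : IsMinimalImmersion m F)
    (p : EuclideanSpace ℝ (Fin n)) {ζ : M → ℝ} (hζ : IsTestFunction m ζ) :
    Continuous (radialDeriv m F p ζ) := by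
  rw [continuous_iff_continuousAt]
  intro x
  by_cases hx : x ∈ tsupport ζ
  · exact continuousAt_radialDeriv hF p (hζ.mem_interior x hx) (hζ.contMDiffAt x hx)
  · have : radialDeriv m F p ζ =ᶠ[𝓝 x] fun _ => 0 := by
      filter_upwards [(isClosed_tsupport ζ).isOpen_compl.mem_nhds hx] with z hz
      exact radialDeriv_of_notMem_tsupport p hz
    exact continuousAt_const.congr this.symm

variable [MeasurableSpace M] [BorelSpace M] {μ : Measure M}

/-- The weak form of the identity `div z = m`, for test functions supported in a chart. -/
lemma IsTestFunction.integral_eq_zero_of_subset (hF : IsMinimalImmersion m F)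
    (hμ : IsAreaMeasure m F μ)
    (p : EuclideanSpace ℝ (Fin n)) {ζ : M → ℝ} (hζ : IsTestFunction m ζ) {x₀ : M} {U : Set M}
    (hU : IsOpen U) (hUs : U ⊆ (extChartAt (𝓡∂ m) x₀).source) (hinj : InjOn F U)
    (hζU : tsupport ζ ⊆ U) :
    ∫ x, (radialDeriv m F p ζ x + m * ζ x) ∂μ = 0 := by
  set e := extChartAt (𝓡∂ m) x₀ with he
  set f := localParam F (chartAt (EuclideanHalfSpace m) x₀) with hf
  have hcont : Continuous fun x => radialDeriv m F p ζ x + m * ζ x :=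
    (hζ.continuous_radialDeriv hF p).add (continuous_const.mul hζ.contMDiff.continuous)
  have hzero : ∀ x, x ∉ tsupport ζ → radialDeriv m F p ζ x + m * ζ x = 0 := fun x hx => by
    rw [radialDeriv_of_notMem_tsupport p hx, image_eq_zero_of_notMem_tsupport hx]
    simp
  rw [← setIntegral_eq_integral_of_forall_compl_eq_zero (s := U)
    fun x hx => hzero x fun h => hx (hζU h)]
  rw [hμ.setIntegral_eq hF hU.measurableSet hUs hinj hcont.continuousOn]
  set O := interior e.target with hO
  -- The chart expression of `ζ`, extended by zero. Its support is a compact subset of the open set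
  -- `O`, so the extension is `C¹` on the whole space.
  set ζ' : EuclideanSpace ℝ (Fin m) → ℝ := fun y => O.indicator (ζ ∘ e.symm) y with hζ'
  have hKO : e '' tsupport ζ ⊆ O := by
    rintro _ ⟨x, hx, rfl⟩
    exact mem_interior_extChartAt_target (hUs (hζU hx)) (hζ.mem_interior x hx)
  have hK : IsCompact (e '' tsupport ζ) :=
    hζ.hasCompactSupport.isCompact.image_of_continuousOn
      ((continuousOn_extChartAt x₀).mono (hζU.trans hUs))
  have hoff : ∀ y, y ∉ e '' tsupport ζ → ζ' y = 0 := by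
    intro y hy
    by_cases hyO : y ∈ O
    · rw [hζ']
      simp only [indicator_of_mem hyO, Function.comp_apply]
      refine image_eq_zero_of_notMem_tsupport fun h => hy ⟨_, h, ?_⟩
      exact e.right_inv (interior_subset hyO)
    · exact indicator_of_notMem hyO _
  have hsupp : tsupport ζ' ⊆ e '' tsupport ζ :=
    closure_minimal (fun y hy => by_contra fun h => hy (hoff y h)) hK.isClosed
  have heq : ∀ y ∈ O, ζ' =ᶠ[𝓝 y] ζ ∘ e.symm := fun y hy => by
    filter_upwards [isOpen_interior.mem_nhds hy] with z hz
    exact indicator_of_mem hz _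
  have hCn : ∀ y ∈ O, halfSpace m ∈ 𝓝 y := fun y hy =>
    halfSpace_mem_nhds_of_subset isOpen_interior (interior_extChartAt_target_subset x₀) hy
  have hζ'd : ContDiff ℝ 1 ζ' := by
    rw [contDiff_iff_contDiffAt]
    intro y
    by_cases hy : y ∈ tsupport ζ'
    · have hyO := hKO (hsupp hy)
      refine ContDiffAt.congr_of_eventuallyEq ?_ (heq y hyO)
      exact (contDiffWithinAt_comp_extChartAt_symm (k := 1) (interior_subset hyO)
        hζ.contMDiff.contMDiffAt).contDiffAt (hCn y hyO)
    · exact contDiffAt_const.congr_of_eventuallyEq (notMem_tsupport_iff_eventuallyEq.1 hy)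
  have hmain := integral_radialCoord_eq_zero (O := O) isOpen_interior
    (interior_extChartAt_target_subset x₀) (hF.contDiffOn_localParam x₀)
    (fun z hz => hF.injective_paramD (interior_subset hz)) (fun z hz => by
      have h1 := hF.meanCurvature_eq_zero _ (chart_mem_atlas (EuclideanHalfSpace m) x₀) (e.symm z)
        (by rw [← extChartAt_source (𝓡∂ m)]; exact e.map_target (interior_subset hz))
      have h2 : (chartAt (EuclideanHalfSpace m) x₀).extend (𝓡∂ m) (e.symm z) = z :=
        e.right_inv (interior_subset hz)
      rwa [h2] at h1) p hζ'd (hK.of_isClosed_subset (isClosed_tsupport _) hsupp)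
    (hsupp.trans hKO)
  rw [← hmain]
  have hz' : ∀ y, y ∉ tsupport ζ' → fderiv ℝ ζ' y = 0 := fun y hy => by
    rw [(notMem_tsupport_iff_eventuallyEq.1 hy).fderiv_eq]; simp
  rw [← setIntegral_eq_integral_of_forall_compl_eq_zero (s := e '' U) (μ := volume)]
  · refine setIntegral_congr_fun (measurableSet_image_extChartAt hU.measurableSet hUs) ?_
    rintro _ ⟨x, hx, rfl⟩
    simp only [areaElement]
    rw [e.left_inv (hUs hx)]
    congr 1
    by_cases hxs : x ∈ tsupport ζ
    · have hyO := hKO (mem_image_of_mem e hxs)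
      rw [radialDeriv_eq_fderivWithin hF p (hUs hx) (hζ.contMDiffAt x hxs),
        (heq _ hyO).fderiv_eq, fderivWithin_of_mem_nhds (hCn _ hyO), (heq _ hyO).eq_of_nhds,
        Function.comp_apply, e.left_inv (hUs hx)]
    · have hxn : e x ∉ e '' tsupport ζ := by
        rintro ⟨x', hx', h⟩
        exact hxs (e.injOn (hUs (hζU hx')) (hUs hx) h ▸ hx')
      rw [hzero x hxs, hz' _ fun h => hxn (hsupp h), hoff _ hxn]
      simp
  · intro y hy
    have hyn : y ∉ e '' tsupport ζ := fun h => hy (image_mono hζU h)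
    rw [hz' _ fun h => hyn (hsupp h), hoff _ hyn]
    simp

/-- The weak form of the identity `div z = m` for the tangential part `z` of the radial field. -/
theorem IsTestFunction.integral_eq_zero [T2Space M] [SecondCountableTopology M]
    (hF : IsMinimalImmersion m F) (hμ : IsAreaMeasure m F μ)
    (p : EuclideanSpace ℝ (Fin n)) {ζ : M → ℝ} (hζ : IsTestFunction m ζ) :
    ∫ x, (radialDeriv m F p ζ x + m * ζ x) ∂μ = 0 := by
  have : LocallyCompactSpace M := Manifold.locallyCompact_of_finiteDimensional (𝓡∂ m)
  have : IsLocallyFiniteMeasure μ := hμ.isLocallyFiniteMeasure hF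
  choose U hUo hxU hUs hUi using fun x => hF.exists_isOpen_injOn x
  -- A partition of unity over the support of `ζ`, subordinate to injectively immersed chart
  -- domains. Only finitely many of its members meet the compact support, so `ζ` is a finite sum of
  -- test functions, each living in one chart.
  obtain ⟨χ, hχ⟩ := SmoothPartitionOfUnity.exists_isSubordinate (𝓡∂ m) (isClosed_tsupport ζ) U hUo
    (fun x _ => mem_iUnion.2 ⟨x, hxU x⟩)
  have hfin := χ.locallyFinite'.finite_nonempty_inter_compact hζ.hasCompactSupport.isCompact
  set t := hfin.toFinset with ht
  have hsum : ∀ x ∈ tsupport ζ, ∑ i ∈ t, χ i x = 1 := by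
    intro x hx
    rw [← χ.sum_eq_one hx, finsum_eq_sum_of_support_subset]
    intro i hi
    rw [ht, hfin.coe_toFinset]
    exact ⟨x, hi, hx⟩
  have hζi : ∀ i, IsTestFunction m fun x => χ i x * ζ x := fun i =>
    hζ.mul_left ((χ i).contMDiff.of_le (mod_cast le_top))
  have hdec : ζ = fun x => ∑ i ∈ t, χ i x * ζ x := by
    ext x
    by_cases hx : x ∈ tsupport ζ
    · rw [← Finset.sum_mul, hsum x hx, one_mul]
    · simp [image_eq_zero_of_notMem_tsupport hx]
  have hrd : ∀ x, radialDeriv m F p ζ x + m * ζ x =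
      ∑ i ∈ t, (radialDeriv m F p (fun x => χ i x * ζ x) x + m * (χ i x * ζ x)) := by
    intro x
    rw [Finset.sum_add_distrib, ← Finset.mul_sum]
    conv_lhs => rw [hdec]
    rw [radialDeriv_finsetSum p fun i _ =>
      ((hζi i).contMDiff.contMDiffAt).mdifferentiableAt one_ne_zero]
  have hint : ∀ i, Integrable
      (fun x => radialDeriv m F p (fun x => χ i x * ζ x) x + m * (χ i x * ζ x)) μ := by
    intro i
    refine Continuous.integrable_of_hasCompactSupport
      (((hζi i).continuous_radialDeriv hF p).add
        (continuous_const.mul (hζi i).contMDiff.continuous)) ?_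
    refine HasCompactSupport.add ?_ (hζi i).hasCompactSupport.mul_left
    exact HasCompactSupport.intro (hζi i).hasCompactSupport.isCompact fun x hx =>
      radialDeriv_of_notMem_tsupport p hx
  rw [integral_congr_ae (ae_of_all _ hrd), integral_finsetSum _ fun i _ => hint i]
  refine Finset.sum_eq_zero fun i _ => ?_
  exact (hζi i).integral_eq_zero_of_subset hF hμ p (hUo i) (hUs i) (hUi i)
    ((tsupport_mul_subset_left).trans (hχ i))

end WeakIdentity

/-! ### Radial cutoffs of the weak identity -/

section Trapezoid

/-- A continuous approximation of the indicator function of `(s, s']`. -/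
noncomputable def trapezoid (s s' : ℝ) (k : ℕ) (u : ℝ) : ℝ :=
  -- Both ramps have length `1 / k` and lie to the right of their endpoints: the value is `0` at `s`
  -- and, for large `k` when `s < s'`, `1` at `s'`. This is why the limit is the half-open interval.
  max 0 (min 1 (k * (u - s))) * max 0 (min 1 (k * (s' - u) + 1))

lemma continuous_trapezoid (s s' : ℝ) (k : ℕ) : Continuous (trapezoid s s' k) := by
  unfold trapezoid; fun_prop

lemma abs_trapezoid_le (s s' : ℝ) (k : ℕ) (u : ℝ) : |trapezoid s s' k u| ≤ 1 := by
  unfold trapezoid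
  have h : ∀ t : ℝ, 0 ≤ max 0 (min 1 t) ∧ max 0 (min 1 t) ≤ 1 := fun t =>
    ⟨le_max_left _ _, max_le zero_le_one (min_le_left _ _)⟩
  rw [abs_of_nonneg (mul_nonneg (h _).1 (h _).1)]
  exact mul_le_one₀ (h _).2 (h _).1 (h _).2

lemma trapezoid_eq_zero {s s' u : ℝ} {k : ℕ} (hu : k * (s' - u) + 1 ≤ 0) :
    trapezoid s s' k u = 0 := by
  unfold trapezoid
  rw [max_eq_left (a := (0 : ℝ)) (b := min 1 (k * (s' - u) + 1)) ((min_le_right _ _).trans hu),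
    mul_zero]

lemma tendsto_trapezoid (s s' u : ℝ) :
    Tendsto (fun k => trapezoid s s' k u) atTop (𝓝 ((Ioc s s').indicator (fun _ => 1) u)) := by
  -- At each fixed `u` the sequence is eventually constant.
  refine tendsto_const_nhds.congr' ?_
  rcases le_or_gt u s with hus | hus
  · refine Eventually.of_forall fun k => ?_
    rw [indicator_of_notMem (fun h => not_lt.2 hus h.1)]
    simp only [trapezoid]
    rw [max_eq_left (a := (0 : ℝ)) (b := min 1 (k * (u - s))), zero_mul]
    refine (min_le_right _ _).trans ?_
    exact mul_nonpos_of_nonneg_of_nonpos (Nat.cast_nonneg k) (by linarith)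
  rcases le_or_gt u s' with hus' | hus'
  · obtain ⟨K, hK⟩ := exists_nat_ge (1 / (u - s))
    filter_upwards [eventually_ge_atTop K] with k hk
    rw [indicator_of_mem (show u ∈ Ioc s s' from ⟨hus, hus'⟩)]
    simp only [trapezoid]
    have h1 : 1 ≤ k * (u - s) := by
      have : (K : ℝ) ≤ k := by exact_mod_cast hk
      rw [← div_le_iff₀ (by linarith)]
      linarith
    have h2 : 1 ≤ k * (s' - u) + 1 := by
      have := mul_nonneg (Nat.cast_nonneg (α := ℝ) k) (sub_nonneg.2 hus')
      linarith
    rw [min_eq_left h1, min_eq_left h2]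
    simp
  · obtain ⟨K, hK⟩ := exists_nat_ge (1 / (u - s'))
    filter_upwards [eventually_ge_atTop K] with k hk
    rw [indicator_of_notMem (fun h => not_lt.2 h.2 hus')]
    refine (trapezoid_eq_zero ?_).symm
    have : (K : ℝ) ≤ k := by exact_mod_cast hk
    have h1 : 1 ≤ k * (u - s') := by
      rw [← div_le_iff₀ (by linarith)]
      linarith
    linarith

end Trapezoid

section RadialIdentity

variable {m n : ℕ} [NeZero m] {M : Type*} [TopologicalSpace M]
  {F : M → EuclideanSpace ℝ (Fin n)}

/-- Properness enters here: it gives finite area and bounds for continuous functions on balls. For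
negative `S` the set is empty and the junk value of `√S` is harmless. -/
lemma isCompact_sublevel (hproper : IsProperMap F) (p : EuclideanSpace ℝ (Fin n)) (S : ℝ) :
    IsCompact {x | ‖F x - p‖ ^ 2 ≤ S} := by
  have h : {x | ‖F x - p‖ ^ 2 ≤ S} ⊆ F ⁻¹' closedBall p √S := fun x hx => by
    rw [mem_preimage, mem_closedBall, dist_eq_norm]
    exact Real.le_sqrt_of_sq_le hx
  refine (hproper.isCompact_preimage (isCompact_closedBall p √S)).of_isClosed_subset ?_ h
  exact isClosed_le (by have := hproper.continuous; fun_prop) continuous_const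

variable [ChartedSpace (EuclideanHalfSpace m) M] [IsManifold (𝓡∂ m) ∞ M]

lemma continuousOn_radialDeriv_add (hF : IsMinimalImmersion m F) (p : EuclideanSpace ℝ (Fin n))
    {K : Set M} (hS : ∀ x ∈ K, x ∈ (𝓡∂ m).interior M) {ψ : M → ℝ}
    (hψ : ∀ x ∈ K, ContMDiffAt (𝓡∂ m) 𝓘(ℝ, ℝ) 1 ψ x) :
    ContinuousOn (fun x => radialDeriv m F p ψ x + m * ψ x) K := fun x hx =>
  ((continuousAt_radialDeriv hF p (hS x hx) (hψ x hx)).add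
    (continuousAt_const.mul (hψ x hx).continuousAt)).continuousWithinAt

lemma continuousOn_mul_tangentialSq (hF : IsMinimalImmersion m F) (p : EuclideanSpace ℝ (Fin n))
    {K : Set M} (hS : ∀ x ∈ K, x ∈ (𝓡∂ m).interior M) {ψ : M → ℝ}
    (hψ : ∀ x ∈ K, ContMDiffAt (𝓡∂ m) 𝓘(ℝ, ℝ) 1 ψ x) :
    ContinuousOn (fun x => ψ x * tangentialSq m F p x) K := fun x hx =>
  ((hψ x hx).continuousAt.mul
    (contMDiffAt_tangentialSq hF p (hS x hx)).continuousAt).continuousWithinAt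

variable [T2Space M] [SecondCountableTopology M] [MeasurableSpace M] [BorelSpace M] {μ : Measure M}

/-- The first variation identity for a radial cutoff of the radial field. -/
lemma integral_radial_cutoff (hF : IsMinimalImmersion m F) (hμ : IsAreaMeasure m F μ)
    (hproper : IsProperMap F) (p : EuclideanSpace ℝ (Fin n)) {S : ℝ}
    (hS : ∀ x, ‖F x - p‖ ^ 2 ≤ S → x ∈ (𝓡∂ m).interior M) {ψ : M → ℝ}
    (hψ : ∀ x, ‖F x - p‖ ^ 2 ≤ S → ContMDiffAt (𝓡∂ m) 𝓘(ℝ, ℝ) 1 ψ x)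
    {h : ℝ → ℝ} (hh : ContDiff ℝ 1 h) (hhS : ∀ u, S ≤ u → h u = 0) :
    ∫ x, (h (‖F x - p‖ ^ 2) * (radialDeriv m F p ψ x + m * ψ x) +
      2 * (deriv h (‖F x - p‖ ^ 2) * (ψ x * tangentialSq m F p x))) ∂μ = 0 := by
  have hq : Continuous fun x => ‖F x - p‖ ^ 2 := by have := hproper.continuous; fun_prop
  have hclosed : IsClosed {x | ‖F x - p‖ ^ 2 ≤ S} := (isCompact_sublevel hproper p S).isClosed
  have hhq : ContMDiff (𝓡∂ m) 𝓘(ℝ, ℝ) 1 fun x => h (‖F x - p‖ ^ 2) := by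
    have h1 : ContDiff ℝ 1 fun w : EuclideanSpace ℝ (Fin n) => h (‖w - p‖ ^ 2) :=
      hh.comp ((contDiff_id.sub contDiff_const).norm_sq ℝ)
    exact h1.contMDiff.comp (hF.smooth.of_le (mod_cast le_top))
  -- As `h` vanishes from `S` on, `ζ` is supported in a compact sublevel consisting of interior
  -- points, and `ψ` need only be regular there.
  set ζ : M → ℝ := fun x => h (‖F x - p‖ ^ 2) * ψ x with hζ
  have hsupp : tsupport ζ ⊆ {x | ‖F x - p‖ ^ 2 ≤ S} := by
    refine closure_minimal (fun x hx => ?_) hclosed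
    by_contra hn
    exact hx (by simp [hζ, hhS _ (not_le.1 hn).le])
  have hζt : IsTestFunction m ζ :=
    ⟨(isCompact_sublevel hproper p S).of_isClosed_subset (isClosed_tsupport _) hsupp,
      fun x hx => hS x (hsupp hx), fun x hx => hhq.contMDiffAt.mul (hψ x (hsupp hx))⟩
  rw [← hζt.integral_eq_zero hF hμ p]
  refine integral_congr_ae (ae_of_all _ fun x => ?_)
  simp only
  have hd : HasDerivAt h (deriv h (‖F x - p‖ ^ 2)) (‖F x - p‖ ^ 2) :=
    (hh.differentiable one_ne_zero _).hasDerivAt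
  by_cases hx : ‖F x - p‖ ^ 2 ≤ S
  · rw [radialDeriv_mul p (hhq.contMDiffAt.mdifferentiableAt one_ne_zero)
      ((hψ x hx).mdifferentiableAt one_ne_zero), radialDeriv_comp_normSq hF p hd]
    ring
  · have h1 : deriv h (‖F x - p‖ ^ 2) = 0 := by
      have : h =ᶠ[𝓝 (‖F x - p‖ ^ 2)] fun _ => 0 := by
        filter_upwards [lt_mem_nhds (not_le.1 hx)] with u hu using hhS u hu.le
      rw [this.deriv_eq]; simp
    rw [radialDeriv_of_notMem_tsupport p fun h => hx (hsupp h), h1, hhS _ (not_le.1 hx).le]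
    simp [hζ, hhS _ (not_le.1 hx).le]

/-- The first variation identity for a radial cutoff with piecewise continuous derivative. -/
theorem integral_shell_eq (hF : IsMinimalImmersion m F) (hμ : IsAreaMeasure m F μ)
    (hproper : IsProperMap F) (p : EuclideanSpace ℝ (Fin n)) {S : ℝ}
    (hS : ∀ x, ‖F x - p‖ ^ 2 ≤ S → x ∈ (𝓡∂ m).interior M) {ψ : M → ℝ}
    (hψ : ∀ x, ‖F x - p‖ ^ 2 ≤ S → ContMDiffAt (𝓡∂ m) 𝓘(ℝ, ℝ) 1 ψ x)
    {s s' : ℝ} (hss' : s ≤ s') (hs'S : s' < S) {g : ℝ → ℝ} (hg : Continuous g) :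
    ∫ x in {x | ‖F x - p‖ ^ 2 ≤ S}, (∫ v in (max s (min (‖F x - p‖ ^ 2) s'))..s', g v) *
        (radialDeriv m F p ψ x + m * ψ x) ∂μ =
      2 * ∫ x in {x | s < ‖F x - p‖ ^ 2 ∧ ‖F x - p‖ ^ 2 ≤ s'},
        g (‖F x - p‖ ^ 2) * (ψ x * tangentialSq m F p x) ∂μ := by
  have : LocallyCompactSpace M := Manifold.locallyCompact_of_finiteDimensional (𝓡∂ m)
  have : IsLocallyFiniteMeasure μ := hμ.isLocallyFiniteMeasure hF
  set q : M → ℝ := fun x => ‖F x - p‖ ^ 2 with hqdef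
  have hq : Continuous q := by have := hproper.continuous; fun_prop
  set K : Set M := {x | q x ≤ S} with hK
  have hKc : IsCompact K := isCompact_sublevel hproper p S
  have hKm : MeasurableSet K := hKc.measurableSet
  have : IsFiniteMeasure (μ.restrict K) := ⟨by
    rw [Measure.restrict_apply_univ]; exact hKc.measure_lt_top⟩
  set A : M → ℝ := fun x => radialDeriv m F p ψ x + m * ψ x with hA
  set B : M → ℝ := fun x => ψ x * tangentialSq m F p x with hB
  have hAc : ContinuousOn A K := continuousOn_radialDeriv_add hF p hS hψ
  have hBc : ContinuousOn B K := continuousOn_mul_tangentialSq hF p hS hψ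
  obtain ⟨CA, hCA⟩ := hKc.exists_bound_of_continuousOn hAc
  obtain ⟨CB, hCB⟩ := hKc.exists_bound_of_continuousOn hBc
  -- From index `k₀` on, the descending ramp, of length at most `S - s'`, ends before `S`.
  obtain ⟨k₀, hk₀⟩ := exists_nat_ge (1 / (S - s'))
  set g' : ℕ → ℝ → ℝ := fun k v => trapezoid s s' (k + k₀) v * g v with hg'
  have hg'c : ∀ k, Continuous (g' k) := fun k => (continuous_trapezoid _ _ _).mul hg
  have hg'0 : ∀ k v, S ≤ v → g' k v = 0 := by
    intro k v hv
    have h1 : trapezoid s s' (k + k₀) v = 0 := by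
      apply trapezoid_eq_zero
      have h2 : 1 ≤ (k₀ : ℝ) * (S - s') := by rwa [← div_le_iff₀ (by linarith)]
      push_cast
      nlinarith [Nat.cast_nonneg (α := ℝ) k, Nat.cast_nonneg (α := ℝ) k₀]
    simp only [hg', h1, zero_mul]
  -- The primitive of `-g' k` that vanishes from `S` on; it is `C¹`, hence an admissible cutoff.
  set h : ℕ → ℝ → ℝ := fun k u => -∫ v in S..u, g' k v with hh
  have hhd : ∀ k u, HasDerivAt (h k) (-g' k u) u := fun k u =>
    ((hg'c k).integral_hasStrictDerivAt S u).hasDerivAt.neg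
  have hhC : ∀ k, ContDiff ℝ 1 (h k) := fun k => by
    rw [contDiff_one_iff_deriv]
    refine ⟨fun u => (hhd k u).differentiableAt, ?_⟩
    have : deriv (h k) = fun u => -g' k u := funext fun u => (hhd k u).deriv
    rw [this]
    exact (hg'c k).neg
  have hh0 : ∀ k u, S ≤ u → h k u = 0 := by
    intro k u hu
    simp only [hh, neg_eq_zero]
    rw [intervalIntegral.integral_congr (g := fun _ => (0 : ℝ))]
    · simp
    · intro v hv
      rw [uIcc_of_le hu] at hv
      exact hg'0 k v hv.1
  have hI : ∀ k, ∫ x in K, (h k (q x) * A x + 2 * (-g' k (q x) * B x)) ∂μ = 0 := by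
    intro k
    have h1 := integral_radial_cutoff hF hμ hproper p hS hψ (hhC k) (hh0 k)
    rw [← h1, setIntegral_eq_integral_of_forall_compl_eq_zero]
    · simp only [(hhd k _).deriv]
      rfl
    · intro x hx
      have hx' : S ≤ q x := (not_le.1 hx).le
      rw [hh0 k _ hx', hg'0 k _ hx']
      simp
  -- The pointwise limit of the cutoffs: clamping the lower endpoint to `[s, s']` encodes the
  -- integral of `g` over the part of `(s, s']` beyond `u`.
  set hlim : ℝ → ℝ := fun u => ∫ v in (max s (min u s'))..s', g v with hhlim
  have hlimc : Continuous hlim := by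
    have h1 : Continuous fun u => ∫ v in s'..u, g v :=
      intervalIntegral.continuous_primitive (fun a b => hg.intervalIntegrable a b) s'
    have h2 : hlim = fun u => -∫ v in s'..(max s (min u s')), g v :=
      funext fun u => intervalIntegral.integral_symm _ _
    rw [h2]
    exact (h1.comp (by fun_prop : Continuous fun u => max s (min u s'))).neg
  have hq0 : ∀ x, 0 ≤ q x := fun x => sq_nonneg _
  obtain ⟨Cg, hCg⟩ := (isCompact_Icc (a := (0 : ℝ)) (b := S)).exists_bound_of_continuousOn
    hg.continuousOn
  have hg'b : ∀ k, ∀ v ∈ Icc 0 S, |g' k v| ≤ Cg := by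
    intro k v hv
    simp only [hg', abs_mul]
    have h1 := abs_trapezoid_le s s' (k + k₀) v
    have h2 := hCg v hv
    rw [Real.norm_eq_abs] at h2
    nlinarith [abs_nonneg (g v), abs_nonneg (trapezoid s s' (k + k₀) v)]
  have hg'lim : ∀ v, Tendsto (fun k => g' k v) atTop (𝓝 ((Ioc s s').indicator g v)) := by
    intro v
    have h1 := ((tendsto_trapezoid s s' v).comp (tendsto_add_atTop_nat k₀)).mul_const (g v)
    by_cases hv : v ∈ Ioc s s'
    · rw [indicator_of_mem hv, one_mul] at h1
      rwa [indicator_of_mem hv]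
    · rw [indicator_of_notMem hv, zero_mul] at h1
      rwa [indicator_of_notMem hv]
  have hhlimk : ∀ u ∈ Icc 0 S, Tendsto (fun k => h k u) atTop (𝓝 (hlim u)) := by
    intro u hu
    have h1 : Tendsto (fun k => ∫ v in u..S, g' k v) atTop
        (𝓝 (∫ v in u..S, (Ioc s s').indicator g v)) := by
      refine intervalIntegral.tendsto_integral_filter_of_dominated_convergence (fun _ => Cg)
        (Eventually.of_forall fun k => (hg'c k).aestronglyMeasurable)
        (Eventually.of_forall fun k => ae_of_all _ fun v hv => ?_) (by simp)
        (ae_of_all _ fun v _ => hg'lim v)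
      rw [uIoc_of_le hu.2] at hv
      exact hg'b k v ⟨hu.1.trans hv.1.le, hv.2⟩
    have h2 : ∫ v in u..S, (Ioc s s').indicator g v = hlim u := by
      rw [intervalIntegral.integral_of_le hu.2, setIntegral_indicator measurableSet_Ioc,
        Ioc_inter_Ioc, min_eq_right hs'S.le]
      simp only [hhlim]
      rcases le_or_gt u s' with hus | hus
      · rw [min_eq_left hus, intervalIntegral.integral_of_le (max_le hss' hus), max_comm]
      · rw [min_eq_right hus.le, max_eq_right hss', intervalIntegral.integral_same,
          Ioc_eq_empty (not_lt.2 (hus.le.trans (le_max_left _ _))), setIntegral_empty]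
    rw [← h2]
    refine h1.congr fun k => ?_
    simp only [hh]
    exact intervalIntegral.integral_symm _ _
  have hhb : ∀ k, ∀ u ∈ Icc 0 S, |h k u| ≤ Cg * S := by
    intro k u hu
    have hCg0 : 0 ≤ Cg := (abs_nonneg _).trans (hg'b k u hu)
    have h1 := intervalIntegral.norm_integral_le_of_norm_le_const (a := S) (b := u) (C := Cg)
      (f := g' k) fun v hv => by
        rw [uIoc_of_ge hu.2] at hv
        exact hg'b k v ⟨hu.1.trans hv.1.le, hv.2⟩
    simp only [hh, abs_neg]
    refine h1.trans ?_
    gcongr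
    rw [abs_sub_comm, abs_of_nonneg (by linarith [hu.2])]
    linarith [hu.1]
  have hlimI : Tendsto (fun k => ∫ x in K, (h k (q x) * A x + 2 * (-g' k (q x) * B x)) ∂μ) atTop
      (𝓝 (∫ x in K, (hlim (q x) * A x + 2 * (-(Ioc s s').indicator g (q x) * B x)) ∂μ)) := by
    refine tendsto_integral_of_dominated_convergence (fun _ => Cg * S * CA + 2 * (Cg * CB))
      (fun k => ?_) (integrable_const _) (fun k => ?_) ?_
    · refine ContinuousOn.aestronglyMeasurable ?_ hKm
      have h1 := (hhC k).continuous
      have h2 := hg'c k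
      exact ((h1.comp hq).continuousOn.mul hAc).add
        (continuousOn_const.mul (((h2.comp hq).neg).continuousOn.mul hBc))
    · rw [ae_restrict_iff' hKm]
      refine ae_of_all _ fun x hx => ?_
      have h1 := hhb k (q x) ⟨hq0 x, hx⟩
      have h2 := hg'b k (q x) ⟨hq0 x, hx⟩
      have h3 := hCA x hx
      have h4 := hCB x hx
      rw [Real.norm_eq_abs] at h3 h4 ⊢
      refine (abs_add_le _ _).trans ?_
      have e1 : |h k (q x) * A x| = |h k (q x)| * |A x| := abs_mul _ _
      have e2 : |2 * (-g' k (q x) * B x)| = 2 * (|g' k (q x)| * |B x|) := by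
        rw [abs_mul, abs_two, abs_mul, abs_neg (g' k (q x))]
      rw [e1, e2]
      have hCg0 : 0 ≤ Cg := (abs_nonneg _).trans h2
      have h5 := mul_le_mul h1 h3 (abs_nonneg _) ((abs_nonneg _).trans h1)
      have h6 := mul_le_mul h2 h4 (abs_nonneg _) hCg0
      linarith
    · rw [ae_restrict_iff' hKm]
      refine ae_of_all _ fun x hx => ?_
      exact ((hhlimk (q x) ⟨hq0 x, hx⟩).mul_const _).add
        ((((hg'lim (q x)).neg).mul_const _).const_mul _)
  simp only [hI] at hlimI
  have hzero := tendsto_nhds_unique hlimI tendsto_const_nhds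
  set W : Set M := {x | s < q x ∧ q x ≤ s'} with hW
  have hWm : MeasurableSet W :=
    (measurableSet_lt measurable_const hq.measurable).inter
      (measurableSet_le hq.measurable measurable_const)
  have hWK : W ⊆ K := fun x hx => hx.2.trans hs'S.le
  have hi1 : IntegrableOn (fun x => hlim (q x) * A x) K μ :=
    ((hlimc.comp hq).continuousOn.mul hAc).integrableOn_compact hKc
  have hi2 : IntegrableOn (fun x => g (q x) * B x) K μ :=
    ((hg.comp hq).continuousOn.mul hBc).integrableOn_compact hKc
  have hind : ∀ x, 2 * (-(Ioc s s').indicator g (q x) * B x) =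
      -(2 * W.indicator (fun x => g (q x) * B x) x) := by
    intro x
    by_cases hx : x ∈ W
    · rw [indicator_of_mem hx, indicator_of_mem (show q x ∈ Ioc s s' from hx)]
      ring
    · rw [indicator_of_notMem hx, indicator_of_notMem (show q x ∉ Ioc s s' from hx)]
      ring
  simp only [hind] at hzero
  have hi3 : Integrable (fun x => -(2 * W.indicator (fun x => g (q x) * B x) x)) (μ.restrict K) :=
    ((Integrable.indicator hi2 hWm).const_mul 2).neg
  rw [integral_add hi1 hi3, integral_neg, integral_const_mul, setIntegral_indicator hWm,
    inter_eq_right.2 hWK] at hzero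
  linarith

end RadialIdentity

/-! ### The monotonicity formula and limits over thin shells -/

section Density

variable {m n : ℕ} [NeZero m] {M : Type*} [TopologicalSpace M]
  [ChartedSpace (EuclideanHalfSpace m) M] {F : M → EuclideanSpace ℝ (Fin n)}

lemma tangentialSq_nonneg (p : EuclideanSpace ℝ (Fin n)) (x : M) :
    0 ≤ tangentialSq m F p x := sq_nonneg _

lemma tangentialSq_le (p : EuclideanSpace ℝ (Fin n)) (x : M) :
    tangentialSq m F p x ≤ ‖F x - p‖ ^ 2 := by
  unfold tangentialSq
  have := (tangentPlane m F x).norm_starProjection_apply_le (F x - p)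
  gcongr

lemma tangentToSphereAt_iff (p : EuclideanSpace ℝ (Fin n)) (x : M) :
    TangentToSphereAt m F p x ↔ tangentialSq m F p x = 0 := by
  unfold TangentToSphereAt tangentialSq
  rw [sq_eq_zero_iff, norm_eq_zero, Submodule.starProjection_apply_eq_zero_iff,
    Submodule.mem_orthogonal]

/-- Pythagoras: equality of lengths means that the normal component vanishes. -/
lemma orthogonalToSphereAt_iff (p : EuclideanSpace ℝ (Fin n)) (x : M) :
    OrthogonalToSphereAt m F p x ↔ tangentialSq m F p x = ‖F x - p‖ ^ 2 := by
  unfold OrthogonalToSphereAt tangentialSq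
  rw [Submodule.norm_sq_eq_add_norm_sq_starProjection (F x - p) (tangentPlane m F x)]
  rw [left_eq_add, sq_eq_zero_iff, norm_eq_zero, Submodule.starProjection_apply_eq_zero_iff,
    Submodule.orthogonal_orthogonal]

variable [IsManifold (𝓡∂ m) ∞ M]

variable [T2Space M] [SecondCountableTopology M] [MeasurableSpace M] [BorelSpace M] {μ : Measure M}

/-- The density, as a function of the squared radius `s` and up to the volume of the unit ball. -/
noncomputable def sqDensity (m : ℕ) (F : M → EuclideanSpace ℝ (Fin n)) (μ : Measure M)
    (p : EuclideanSpace ℝ (Fin n)) (s : ℝ) : ℝ :=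
  s ^ (-(m / 2 : ℝ)) * μ.real {x | ‖F x - p‖ ^ 2 ≤ s}

/-- The monotonicity formula. -/
theorem sqDensity_sub_eq (hF : IsMinimalImmersion m F) (hμ : IsAreaMeasure m F μ)
    (hproper : IsProperMap F) (p : EuclideanSpace ℝ (Fin n)) {S : ℝ}
    (hS : ∀ x, ‖F x - p‖ ^ 2 ≤ S → x ∈ (𝓡∂ m).interior M) {s s' : ℝ} (hs : 0 < s)
    (hss' : s ≤ s') (hs'S : s' < S) :
    sqDensity m F μ p s' - sqDensity m F μ p s =
      ∫ x in {x | s < ‖F x - p‖ ^ 2 ∧ ‖F x - p‖ ^ 2 ≤ s'},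
        (‖F x - p‖ ^ 2) ^ (-(m / 2 : ℝ) - 1) * (‖F x - p‖ ^ 2 - tangentialSq m F p x) ∂μ := by
  have : LocallyCompactSpace M := Manifold.locallyCompact_of_finiteDimensional (𝓡∂ m)
  have : IsLocallyFiniteMeasure μ := hμ.isLocallyFiniteMeasure hF
  set q : M → ℝ := fun x => ‖F x - p‖ ^ 2 with hqdef
  have hq : Continuous q := by have := hproper.continuous; fun_prop
  have hm : (0 : ℝ) < m := by exact_mod_cast Nat.pos_of_ne_zero (NeZero.ne m)
  set α : ℝ := -(m / 2 : ℝ) with hα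
  -- On the shell this is minus the derivative of `v ^ (-m/2)`. The `max` only makes it continuous
  -- on all of `ℝ`, without changing the values used.
  have hg : Continuous fun v : ℝ => (m / 2 : ℝ) * (max v s) ^ (α - 1) :=
    continuous_const.mul ((continuous_id.max continuous_const).rpow_const fun v =>
      Or.inl (hs.trans_le (le_max_right _ _)).ne')
  have key := integral_shell_eq hF hμ hproper p hS (ψ := fun _ => 1)
    (fun x _ => contMDiffAt_const) hss' hs'S hg
  have hprim : ∀ a, s ≤ a → a ≤ s' →
      ∫ v in a..s', (m / 2 : ℝ) * (max v s) ^ (α - 1) = a ^ α - s' ^ α := by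
    intro a ha has'
    have h1 : ∀ v ∈ uIcc a s', HasDerivAt (fun v => -v ^ α) ((m / 2 : ℝ) * (max v s) ^ (α - 1)) v := by
      intro v hv
      rw [uIcc_of_le has'] at hv
      have hv0 : s ≤ v := ha.trans hv.1
      rw [max_eq_left hv0]
      have h2 := (Real.hasDerivAt_rpow_const (x := v) (p := α)
        (Or.inl (hs.trans_le hv0).ne')).neg
      refine h2.congr_deriv ?_
      rw [hα]; ring
    rw [intervalIntegral.integral_eq_sub_of_hasDerivAt h1 (hg.intervalIntegrable _ _)]
    ring
  have hrd : ∀ x : M, radialDeriv m F p (fun _ => (1 : ℝ)) x = 0 := by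
    intro x
    unfold radialDeriv
    rw [mfderiv_const]
    rfl
  have hcle : ∀ t, IsCompact {x | q x ≤ t} := isCompact_sublevel hproper p
  have hmle : ∀ t, MeasurableSet {x | q x ≤ t} := fun t => (hcle t).measurableSet
  have hfin : ∀ t, μ {x | q x ≤ t} ≠ ⊤ := fun t => (hcle t).measure_lt_top.ne
  set W : Set M := {x | s < q x ∧ q x ≤ s'} with hW
  have hWm : MeasurableSet W :=
    (measurableSet_lt measurable_const hq.measurable).inter (hmle s')
  have hWs' : W ⊆ {x | q x ≤ s'} := fun x hx => hx.2
  have hsplit : {x | q x ≤ s'} = {x | q x ≤ s} ∪ W := by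
    ext x
    simp only [mem_ofPred_eq, mem_union, hW]
    constructor
    · intro h
      rcases le_or_gt (q x) s with h' | h'
      exacts [Or.inl h', Or.inr ⟨h', h⟩]
    · rintro (h | h)
      exacts [h.trans hss', h.2]
  have hdisj : Disjoint {x | q x ≤ s} W :=
    disjoint_left.2 fun x hx hx' => not_lt.2 hx hx'.1
  have hsub : {x | q x ≤ s'} ⊆ {x | q x ≤ S} := fun x hx => le_trans hx hs'S.le
  have hIα : IntegrableOn (fun x => q x ^ α) W μ := by
    have h1 : IntegrableOn (fun x => (max (q x) s) ^ α) {x | q x ≤ s'} μ :=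
      ContinuousOn.integrableOn_compact (hcle s')
        ((hq.max continuous_const).rpow_const fun x =>
          Or.inl (hs.trans_le (le_max_right _ _)).ne').continuousOn
    refine (h1.mono_set hWs').congr_fun (fun x hx => ?_) hWm
    simp only [max_eq_left hx.1.le]
  -- The cutoff equals `s ^ α - s' ^ α` on the inner ball, `q ^ α - s' ^ α` on the shell and zero
  -- outside. With `ψ = 1` the radial derivative drops out and only the factor `m` remains.
  have hL : ∫ x in {x | q x ≤ S}, (∫ v in (max s (min (q x) s'))..s',
      (m / 2 : ℝ) * (max v s) ^ (α - 1)) *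
        (radialDeriv m F p (fun _ => (1 : ℝ)) x + m * 1) ∂μ =
      m * (s ^ α * μ.real {x | q x ≤ s} + ∫ x in W, q x ^ α ∂μ -
        s' ^ α * μ.real {x | q x ≤ s'}) := by
    have e1 : ∀ x, (∫ v in (max s (min (q x) s'))..s',
        (m / 2 : ℝ) * (max v s) ^ (α - 1)) *
        (radialDeriv m F p (fun _ => (1 : ℝ)) x + m * 1) =
        ((max s (min (q x) s')) ^ α - s' ^ α) * m := by
      intro x
      rw [hprim _ (le_max_left _ _) (max_le hss' (min_le_right _ _)), hrd]
      ring
    simp only [e1]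
    rw [integral_mul_const, mul_comm]
    congr 1
    have e2 : ∫ x in {x | q x ≤ S}, ((max s (min (q x) s')) ^ α - s' ^ α) ∂μ =
        ∫ x in {x | q x ≤ s'}, ((max s (min (q x) s')) ^ α - s' ^ α) ∂μ := by
      refine setIntegral_eq_of_subset_of_forall_sdiff_eq_zero (hmle S) hsub fun x hx => ?_
      have h1 : s' ≤ q x := (not_le.1 hx.2).le
      rw [min_eq_right h1, max_eq_right hss', sub_self]
    have hc : Continuous fun x => (max s (min (q x) s')) ^ α :=
      ((continuous_const.max (hq.min continuous_const)).rpow_const fun x =>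
        Or.inl (hs.trans_le (le_max_left _ _)).ne')
    rw [e2, integral_sub (hc.continuousOn.integrableOn_compact (hcle s'))
      (integrableOn_const (hfin s')), setIntegral_const, smul_eq_mul, mul_comm (μ.real _)]
    congr 1
    rw [hsplit, setIntegral_union hdisj hWm
      (hc.continuousOn.integrableOn_compact (hcle s))
      ((hc.continuousOn.integrableOn_compact (hcle s')).mono_set hWs')]
    congr 1
    · rw [setIntegral_congr_fun (g := fun _ => s ^ α) (hmle s), setIntegral_const, smul_eq_mul,
        mul_comm]
      intro x hx
      simp only
      rw [max_eq_left ((min_le_left _ _).trans hx)]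
    · refine setIntegral_congr_fun hWm fun x hx => ?_
      rw [min_eq_left hx.2, max_eq_right hx.1.le]
  have hTI : IntegrableOn (fun x => q x ^ (α - 1) * tangentialSq m F p x) W μ := by
    have h1 : IntegrableOn (fun x => (max (q x) s) ^ (α - 1) * tangentialSq m F p x)
        {x | q x ≤ s'} μ := by
      refine ContinuousOn.integrableOn_compact (hcle s') (ContinuousOn.mul
        ((hq.max continuous_const).rpow_const fun x =>
          Or.inl (hs.trans_le (le_max_right _ _)).ne').continuousOn ?_)
      exact fun x hx =>
        (contMDiffAt_tangentialSq hF p (hS x (hsub hx))).continuousAt.continuousWithinAt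
    refine (h1.mono_set hWs').congr_fun (fun x hx => ?_) hWm
    simp only [max_eq_left hx.1.le]
  have hR : ∫ x in W, (m / 2 : ℝ) * (max (q x) s) ^ (α - 1) * (1 * tangentialSq m F p x) ∂μ =
      (m / 2 : ℝ) * ∫ x in W, q x ^ (α - 1) * tangentialSq m F p x ∂μ := by
    rw [← integral_const_mul]
    refine setIntegral_congr_fun hWm fun x hx => ?_
    rw [max_eq_left hx.1.le]
    ring
  have hfinal : ∫ x in W, q x ^ (α - 1) * (q x - tangentialSq m F p x) ∂μ =
      ∫ x in W, q x ^ α ∂μ - ∫ x in W, q x ^ (α - 1) * tangentialSq m F p x ∂μ := by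
    rw [← integral_sub hIα hTI]
    refine setIntegral_congr_fun hWm fun x hx => ?_
    have h1 : q x ^ α = q x ^ (α - 1) * q x := by
      rw [← Real.rpow_add_one (hs.trans hx.1).ne', sub_add_cancel]
    rw [h1]
    ring
  rw [hL, hR] at key
  rw [hfinal]
  unfold sqDensity
  have h2 : s ^ α * μ.real {x | q x ≤ s} + ∫ x in W, q x ^ α ∂μ -
      s' ^ α * μ.real {x | q x ≤ s'} =
      ∫ x in W, q x ^ (α - 1) * tangentialSq m F p x ∂μ := by
    apply mul_left_cancel₀ hm.ne'
    rw [key]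
    ring
  linarith

/-- The normalized shell integrals of `ψ` against the tangential part of the radial field converge
whenever the corresponding piecewise affine cutoff functions converge. -/
theorem tendsto_shell_integral (hF : IsMinimalImmersion m F) (hμ : IsAreaMeasure m F μ)
    (hproper : IsProperMap F) (p : EuclideanSpace ℝ (Fin n)) {S : ℝ}
    (hS : ∀ x, ‖F x - p‖ ^ 2 ≤ S → x ∈ (𝓡∂ m).interior M) {ψ : M → ℝ}
    (hψ : ∀ x, ‖F x - p‖ ^ 2 ≤ S → ContMDiffAt (𝓡∂ m) 𝓘(ℝ, ℝ) 1 ψ x)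
    {ι : Type*} {l : Filter ι} [l.IsCountablyGenerated] {a b : ι → ℝ}
    (hab : ∀ᶠ i in l, a i < b i ∧ b i < S) {D : Set ℝ} (hD : MeasurableSet D) (hDS : D ⊆ Iic S)
    (hlim : ∀ u, ∀ᶠ i in l, (b i - max (a i) (min u (b i))) / (b i - a i) =
      D.indicator (fun _ => 1) u) :
    Tendsto (fun i => 2 * (∫ x in {x | a i < ‖F x - p‖ ^ 2 ∧ ‖F x - p‖ ^ 2 ≤ b i},
        ψ x * tangentialSq m F p x ∂μ) / (b i - a i)) l
      (𝓝 (∫ x in {x | ‖F x - p‖ ^ 2 ∈ D}, (radialDeriv m F p ψ x + m * ψ x) ∂μ)) := by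
  have : LocallyCompactSpace M := Manifold.locallyCompact_of_finiteDimensional (𝓡∂ m)
  have : IsLocallyFiniteMeasure μ := hμ.isLocallyFiniteMeasure hF
  set q : M → ℝ := fun x => ‖F x - p‖ ^ 2 with hqdef
  have hq : Continuous q := by have := hproper.continuous; fun_prop
  set K : Set M := {x | q x ≤ S} with hK
  have hKc : IsCompact K := isCompact_sublevel hproper p S
  have hKm : MeasurableSet K := hKc.measurableSet
  set A : M → ℝ := fun x => radialDeriv m F p ψ x + m * ψ x with hA
  have hAc : ContinuousOn A K := continuousOn_radialDeriv_add hF p hS hψ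
  have hAi : IntegrableOn A K μ := hAc.integrableOn_compact hKc
  have h1 : ∫ x in {x | q x ∈ D}, A x ∂μ = ∫ x in K, D.indicator (fun _ => 1) (q x) * A x ∂μ := by
    have hDm : MeasurableSet {x | q x ∈ D} := hq.measurable hD
    have h2 : ∀ x, D.indicator (fun _ => 1) (q x) * A x = {x | q x ∈ D}.indicator A x := by
      intro x
      by_cases hx : q x ∈ D
      · rw [indicator_of_mem hx, indicator_of_mem (show x ∈ {x | q x ∈ D} from hx), one_mul]
      · rw [indicator_of_notMem hx, indicator_of_notMem (show x ∉ {x | q x ∈ D} from hx), zero_mul]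
    simp only [h2]
    rw [setIntegral_indicator hDm, inter_eq_right.2 (show {x | q x ∈ D} ⊆ K from fun x hx => hDS hx)]
  rw [h1]
  have h3 : Tendsto (fun i => ∫ x in K, (b i - max (a i) (min (q x) (b i))) / (b i - a i) * A x ∂μ)
      l (𝓝 (∫ x in K, D.indicator (fun _ => 1) (q x) * A x ∂μ)) := by
    -- The affine cutoffs take values in `[0, 1]`, so the integrands are dominated by `|A|`, which
    -- is integrable on the compact `K`.
    refine tendsto_integral_filter_of_dominated_convergence (fun x => |A x|)
      (Eventually.of_forall fun i => ?_) ?_ hAi.abs (ae_of_all _ fun x => ?_)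
    · have hc : Continuous fun x => (b i - max (a i) (min (q x) (b i))) / (b i - a i) :=
        (continuous_const.sub (continuous_const.max (hq.min continuous_const))).div_const _
      exact (hc.continuousOn.mul hAc).aestronglyMeasurable hKm
    · filter_upwards [hab] with i hi
      refine ae_of_all _ fun x => ?_
      rw [norm_mul, Real.norm_eq_abs, Real.norm_eq_abs]
      refine mul_le_of_le_one_left (abs_nonneg _) ?_
      have h4 : max (a i) (min (q x) (b i)) ≤ b i := max_le hi.1.le (min_le_right _ _)
      have h5 := le_max_left (a i) (min (q x) (b i))
      rw [abs_of_nonneg (div_nonneg (by linarith) (by linarith)), div_le_one (by linarith)]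
      linarith
    · refine Tendsto.mul_const _ (tendsto_const_nhds.congr' ?_)
      filter_upwards [hlim (q x)] with i hi using hi.symm
  refine h3.congr' ?_
  filter_upwards [hab] with i hi
  have key := integral_shell_eq hF hμ hproper p hS hψ hi.1.le hi.2 (g := fun _ => 1)
    continuous_const
  simp only [one_mul, intervalIntegral.integral_const, smul_eq_mul, mul_one] at key
  rw [← key, ← integral_div]
  refine integral_congr_ae (ae_of_all _ fun x => ?_)
  simp only [hA, hqdef]
  ring

/-- The cutoff is `1` up to and including level `s` and falls to `0` at `t`, so it converges to the
indicator of the closed sublevel. -/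
lemma tendsto_shell_integral_right (hF : IsMinimalImmersion m F) (hμ : IsAreaMeasure m F μ)
    (hproper : IsProperMap F) (p : EuclideanSpace ℝ (Fin n)) {S : ℝ}
    (hS : ∀ x, ‖F x - p‖ ^ 2 ≤ S → x ∈ (𝓡∂ m).interior M) {ψ : M → ℝ}
    (hψ : ∀ x, ‖F x - p‖ ^ 2 ≤ S → ContMDiffAt (𝓡∂ m) 𝓘(ℝ, ℝ) 1 ψ x) {s : ℝ} (hs : s < S) :
    Tendsto (fun t => 2 * (∫ x in {x | s < ‖F x - p‖ ^ 2 ∧ ‖F x - p‖ ^ 2 ≤ t},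
        ψ x * tangentialSq m F p x ∂μ) / (t - s)) (𝓝[>] s)
      (𝓝 (∫ x in {x | ‖F x - p‖ ^ 2 ≤ s}, (radialDeriv m F p ψ x + m * ψ x) ∂μ)) := by
  refine tendsto_shell_integral hF hμ hproper p hS hψ (a := fun _ => s) (b := fun t => t)
    (D := Iic s) ?_ measurableSet_Iic (Iic_subset_Iic.2 hs.le) fun u => ?_
  · filter_upwards [Ioo_mem_nhdsGT hs] with t ht using ht
  · rcases le_or_gt u s with hu | hu
    · filter_upwards [self_mem_nhdsWithin] with t ht
      rw [indicator_of_mem (show u ∈ Iic s from hu), max_eq_left ((min_le_left _ _).trans hu),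
        div_self (sub_pos.2 ht).ne']
    · filter_upwards [Ioo_mem_nhdsGT hu] with t ht
      rw [indicator_of_notMem (show u ∉ Iic s from not_le.2 hu), min_eq_right ht.2.le,
        max_eq_right ht.1.le, sub_self, zero_div]

/-- Here the cutoff already vanishes on the level `s` itself, so only the open sublevel appears. The
two one-sided limits agree once the level set is null. -/
lemma tendsto_shell_integral_left (hF : IsMinimalImmersion m F) (hμ : IsAreaMeasure m F μ)
    (hproper : IsProperMap F) (p : EuclideanSpace ℝ (Fin n)) {S : ℝ}
    (hS : ∀ x, ‖F x - p‖ ^ 2 ≤ S → x ∈ (𝓡∂ m).interior M) {ψ : M → ℝ}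
    (hψ : ∀ x, ‖F x - p‖ ^ 2 ≤ S → ContMDiffAt (𝓡∂ m) 𝓘(ℝ, ℝ) 1 ψ x) {s : ℝ} (hs : s < S) :
    Tendsto (fun t => 2 * (∫ x in {x | t < ‖F x - p‖ ^ 2 ∧ ‖F x - p‖ ^ 2 ≤ s},
        ψ x * tangentialSq m F p x ∂μ) / (s - t)) (𝓝[<] s)
      (𝓝 (∫ x in {x | ‖F x - p‖ ^ 2 < s}, (radialDeriv m F p ψ x + m * ψ x) ∂μ)) := by
  refine tendsto_shell_integral hF hμ hproper p hS hψ (a := fun t => t) (b := fun _ => s)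
    (D := Iio s) ?_ measurableSet_Iio (fun u hu => (hu.trans hs).le) fun u => ?_
  · filter_upwards [self_mem_nhdsWithin] with t ht using ⟨ht, hs⟩
  · rcases lt_or_ge u s with hu | hu
    · filter_upwards [Ioo_mem_nhdsLT hu] with t ht
      rw [indicator_of_mem (show u ∈ Iio s from hu), min_eq_left hu.le, max_eq_left ht.1.le,
        div_self (sub_pos.2 ht.2).ne']
    · filter_upwards [self_mem_nhdsWithin] with t ht
      rw [indicator_of_notMem (show u ∉ Iio s from not_lt.2 hu), min_eq_right hu,
        max_eq_right (le_of_lt ht), sub_self, zero_div]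

end Density

/-! ### Differentiability of the area and sign of the derivative -/

section Shell

variable {n : ℕ} {M : Type*} [TopologicalSpace M] {F : M → EuclideanSpace ℝ (Fin n)}

/-- A property that holds near a level set of the distance holds in a shell. -/
lemma exists_shell_forall (hproper : IsProperMap F) (p : EuclideanSpace ℝ (Fin n)) (s : ℝ)
    {P : M → Prop} (h : ∀ x, ‖F x - p‖ ^ 2 = s → ∀ᶠ y in 𝓝 x, P y) :
    ∃ δ > 0, ∀ y, |‖F y - p‖ ^ 2 - s| < δ → P y := by
  have hq : Continuous fun x => ‖F x - p‖ ^ 2 := by have := hproper.continuous; fun_prop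
  -- On the compact set of points of a larger ball near which the property may fail, the distance of
  -- `q` from `s` is positive, hence bounded away from zero. The `1` in the final width keeps the
  -- shell inside that ball.
  have hK : IsCompact ({x | ‖F x - p‖ ^ 2 ≤ s + 1} \ interior {y | P y}) :=
    (isCompact_sublevel hproper p (s + 1)).diff isOpen_interior
  obtain ⟨a, ha, hle⟩ := hK.exists_forall_le' (f := fun x => |‖F x - p‖ ^ 2 - s|)
    (hq.sub continuous_const).abs.continuousOn (a := 0) (fun x hx => by
      rw [abs_pos, sub_ne_zero]
      exact fun hxs => hx.2 (mem_interior_iff_mem_nhds.2 (h x hxs)))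
  refine ⟨min 1 a, lt_min one_pos ha, fun y hy => ?_⟩
  by_contra hn
  have h1 := hle y ⟨?_, fun hy' => hn (interior_subset hy')⟩
  · exact not_lt.2 h1 (hy.trans_le (min_le_right _ _))
  · have := (abs_lt.1 (hy.trans_le (min_le_left _ _))).2
    simp only [mem_ofPred_eq]
    linarith

end Shell

/-- A globally smooth substitute for `1 / t`: it agrees with it for `t ≥ c` and vanishes for `t ≤ c
/ 2`. -/
lemma contDiff_smoothTransition_mul_inv {c : ℝ} (hc : 0 < c) :
    ContDiff ℝ 1 fun t : ℝ => Real.smoothTransition (2 * t / c - 1) * t⁻¹ := by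
  rw [contDiff_iff_contDiffAt]
  intro t
  rcases lt_or_ge t (c / 2) with ht | ht
  · have : (fun t : ℝ => Real.smoothTransition (2 * t / c - 1) * t⁻¹) =ᶠ[𝓝 t] fun _ => 0 := by
      filter_upwards [gt_mem_nhds ht] with u hu
      rw [Real.smoothTransition.zero_of_nonpos, zero_mul]
      rw [sub_nonpos, div_le_one hc]
      linarith
    exact contDiffAt_const.congr_of_eventuallyEq this
  · have ht0 : t ≠ 0 := by linarith
    exact (Real.smoothTransition.contDiff.comp (by fun_prop)).contDiffAt.mul (contDiffAt_inv ℝ ht0)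

lemma hasDerivAt_of_tendsto_left_right {f : ℝ → ℝ} {s d : ℝ}
    (hl : Tendsto (fun t => (f s - f t) / (s - t)) (𝓝[<] s) (𝓝 d))
    (hr : Tendsto (fun t => (f t - f s) / (t - s)) (𝓝[>] s) (𝓝 d)) : HasDerivAt f d s := by
  rw [hasDerivAt_iff_tendsto_slope, ← nhdsLT_sup_nhdsGT, tendsto_sup]
  refine ⟨hl.congr fun t => ?_, hr.congr fun t => ?_⟩
  · rw [slope_def_field, ← neg_sub (f t), ← neg_sub t, neg_div_neg_eq]
  · rw [slope_def_field]

section Derivative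

variable {m n : ℕ} [NeZero m] {M : Type*} [TopologicalSpace M]
  [ChartedSpace (EuclideanHalfSpace m) M] [IsManifold (𝓡∂ m) ∞ M]
  [T2Space M] [SecondCountableTopology M] [MeasurableSpace M] [BorelSpace M]
  {F : M → EuclideanSpace ℝ (Fin n)} {μ : Measure M}

lemma measureReal_sublevel_sub (hF : IsMinimalImmersion m F) (hμ : IsAreaMeasure m F μ)
    (hproper : IsProperMap F) (p : EuclideanSpace ℝ (Fin n)) {s t : ℝ} (hst : s ≤ t) :
    μ.real {x | ‖F x - p‖ ^ 2 ≤ t} - μ.real {x | ‖F x - p‖ ^ 2 ≤ s} =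
      μ.real {x | s < ‖F x - p‖ ^ 2 ∧ ‖F x - p‖ ^ 2 ≤ t} := by
  have : LocallyCompactSpace M := Manifold.locallyCompact_of_finiteDimensional (𝓡∂ m)
  have : IsLocallyFiniteMeasure μ := hμ.isLocallyFiniteMeasure hF
  have hc := isCompact_sublevel hproper p
  have hsub : {x | ‖F x - p‖ ^ 2 ≤ s} ⊆ {x | ‖F x - p‖ ^ 2 ≤ t} := fun x hx => le_trans hx hst
  rw [← measureReal_sdiff hsub (hc s).measurableSet (hc t).measure_lt_top.ne]
  congr 1
  ext x
  simp only [Set.mem_sdiff, mem_ofPred_eq, not_le]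
  exact and_comm

/-- If `M` is nowhere tangent to a sphere, then the area of the part of `M` inside a concentric
sphere is differentiable at that radius. -/
theorem exists_hasDerivAt_measure_sublevel (hF : IsMinimalImmersion m F)
    (hμ : IsAreaMeasure m F μ) (hproper : IsProperMap F) (p : EuclideanSpace ℝ (Fin n)) {s S : ℝ}
    (hS : ∀ x, ‖F x - p‖ ^ 2 ≤ S → x ∈ (𝓡∂ m).interior M) (hsS : s < S)
    (hT : ∀ x, ‖F x - p‖ ^ 2 = s → tangentialSq m F p x ≠ 0) :
    ∃ d, HasDerivAt (fun t => μ.real {x | ‖F x - p‖ ^ 2 ≤ t}) d s := by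
  have : LocallyCompactSpace M := Manifold.locallyCompact_of_finiteDimensional (𝓡∂ m)
  have : IsLocallyFiniteMeasure μ := hμ.isLocallyFiniteMeasure hF
  set q : M → ℝ := fun x => ‖F x - p‖ ^ 2 with hqdef
  have hq : Continuous q := by have := hproper.continuous; fun_prop
  have hTc : ∀ x, q x ≤ S → ContinuousAt (tangentialSq m F p) x := fun x hx =>
    (contMDiffAt_tangentialSq hF p (hS x hx)).continuousAt
  have hlevel : IsCompact {x | q x = s} :=
    (isCompact_sublevel hproper p s).of_isClosed_subset (isClosed_eq hq continuous_const)
      fun x hx => le_of_eq hx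
  obtain ⟨c, hc, hcT⟩ := hlevel.exists_forall_le' (f := tangentialSq m F p) (a := 0)
    (fun x hx => (hTc x (le_trans (le_of_eq hx) hsS.le)).continuousWithinAt)
    (fun x hx => (tangentialSq_nonneg p x).lt_of_ne' (hT x hx))
  obtain ⟨δ, hδ, hδT⟩ := exists_shell_forall hproper p s (P := fun y => c / 2 < tangentialSq m F p y)
    fun x hx => (hTc x (le_trans (le_of_eq hx) hsS.le)).eventually
      (lt_mem_nhds ((half_lt_self hc).trans_le (hcT x hx)))
  have hc2 : 0 < c / 2 := half_pos hc
  -- On the shell `tangentialSq` exceeds `c / 2`, so `ψ` is its reciprocal there and the shell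
  -- integral becomes the area of the shell. Elsewhere `ψ` stays `C¹` even where `M` is tangent to
  -- spheres.
  set κ : ℝ → ℝ := fun t => Real.smoothTransition (2 * t / (c / 2) - 1) * t⁻¹ with hκ
  set ψ : M → ℝ := fun x => κ (tangentialSq m F p x) with hψdef
  have hψ : ∀ x, q x ≤ S → ContMDiffAt (𝓡∂ m) 𝓘(ℝ, ℝ) 1 ψ x := fun x hx =>
    ((contDiff_smoothTransition_mul_inv hc2).contMDiff.contMDiffAt).comp x
      ((contMDiffAt_tangentialSq hF p (hS x hx)).of_le (mod_cast le_top))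
  have hψT : ∀ x, |q x - s| < δ → ψ x * tangentialSq m F p x = 1 := by
    intro x hx
    have h1 := hδT x hx
    simp only [hψdef, hκ]
    rw [Real.smoothTransition.one_of_one_le, one_mul, inv_mul_cancel₀ (hc2.trans h1).ne']
    rw [le_sub_iff_add_le, le_div_iff₀ hc2]
    linarith
  have hWm : ∀ a b, MeasurableSet {x | a < q x ∧ q x ≤ b} := fun a b =>
    (measurableSet_lt measurable_const hq.measurable).inter
      (measurableSet_le hq.measurable measurable_const)
  have hW : ∀ a b, s - δ < a → b < s + δ →
      ∫ x in {x | a < q x ∧ q x ≤ b}, ψ x * tangentialSq m F p x ∂μ =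
        μ.real {x | a < q x ∧ q x ≤ b} := by
    intro a b ha hb
    rw [setIntegral_congr_fun (g := fun _ => 1) (hWm a b), setIntegral_const, smul_eq_mul, mul_one]
    intro x hx
    refine hψT x (abs_lt.2 ⟨?_, ?_⟩) <;> linarith [hx.1, hx.2]
  have hR := tendsto_shell_integral_right hF hμ hproper p hS hψ hsS
  have hL := tendsto_shell_integral_left hF hμ hproper p hS hψ hsS
  have hL' : Tendsto (fun t => 2 * μ.real {x | t < q x ∧ q x ≤ s} / (s - t)) (𝓝[<] s)
      (𝓝 (∫ x in {x | q x < s}, (radialDeriv m F p ψ x + m * ψ x) ∂μ)) := by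
    refine hL.congr' ?_
    filter_upwards [Ioo_mem_nhdsLT (show s - δ < s by linarith)] with t ht
    rw [hW t s ht.1 (by linarith)]
  -- The level set lies in every shell `(t, s]`, and the area of these shells is `O(s - t)` by the
  -- left limit.
  have hzero : μ {x | q x = s} = 0 := by
    have h1 : Tendsto (fun t => 2 * μ.real {x | t < q x ∧ q x ≤ s} / (s - t) * ((s - t) / 2))
        (𝓝[<] s) (𝓝 0) := by
      have h2 : Tendsto (fun t : ℝ => (s - t) / 2) (𝓝[<] s) (𝓝 0) := by
        have h3 : Tendsto (fun t : ℝ => (s - t) / 2) (𝓝 s) (𝓝 ((s - s) / 2)) :=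
          Continuous.tendsto (by fun_prop) s
        rw [sub_self, zero_div] at h3
        exact h3.mono_left nhdsWithin_le_nhds
      simpa using hL'.mul h2
    have h4 : μ.real {x | q x = s} ≤ 0 := by
      refine ge_of_tendsto h1 ?_
      filter_upwards [self_mem_nhdsWithin] with t ht
      have ht' : 0 < s - t := sub_pos.2 ht
      have h5 : 2 * μ.real {x | t < q x ∧ q x ≤ s} / (s - t) * ((s - t) / 2) =
          μ.real {x | t < q x ∧ q x ≤ s} := by field_simp
      rw [h5]
      refine measureReal_mono (fun x hx => ?_) ?_
      · exact ⟨lt_of_lt_of_eq ht hx.symm, le_of_eq hx⟩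
      · exact ((measure_mono fun x hx => hx.2).trans_lt
          (isCompact_sublevel hproper p s).measure_lt_top).ne
    have h6 := le_antisymm h4 measureReal_nonneg
    rwa [measureReal_eq_zero_iff hlevel.measure_lt_top.ne] at h6
  have heq : ∫ x in {x | q x < s}, (radialDeriv m F p ψ x + m * ψ x) ∂μ =
      ∫ x in {x | q x ≤ s}, (radialDeriv m F p ψ x + m * ψ x) ∂μ := by
    refine setIntegral_congr_set ?_
    refine (Filter.eventuallyEq_set.2 ?_)
    have h1 : ∀ᵐ x ∂μ, q x ≠ s := measure_eq_zero_iff_ae_notMem.1 hzero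
    filter_upwards [h1] with x hx
    exact ⟨fun h => le_of_lt h, fun h => lt_of_le_of_ne h hx⟩
  refine ⟨(∫ x in {x | q x ≤ s}, (radialDeriv m F p ψ x + m * ψ x) ∂μ) / 2,
    hasDerivAt_of_tendsto_left_right ?_ ?_⟩
  · rw [← heq]
    refine (hL'.div_const 2).congr' ?_
    filter_upwards [self_mem_nhdsWithin] with t ht
    rw [measureReal_sublevel_sub hF hμ hproper p (le_of_lt ht)]
    ring
  · refine (hR.div_const 2).congr' ?_
    filter_upwards [Ioo_mem_nhdsGT (show s < s + δ by linarith)] with t ht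
    rw [hW s t (by linarith) ht.2, measureReal_sublevel_sub hF hμ hproper p ht.1.le]
    ring

lemma sqDensity_monotoneOn (hF : IsMinimalImmersion m F) (hμ : IsAreaMeasure m F μ)
    (hproper : IsProperMap F) (p : EuclideanSpace ℝ (Fin n)) {S : ℝ}
    (hS : ∀ x, ‖F x - p‖ ^ 2 ≤ S → x ∈ (𝓡∂ m).interior M) :
    MonotoneOn (sqDensity m F μ p) (Ioo 0 S) := by
  intro s hs t ht hst
  rw [← sub_nonneg, sqDensity_sub_eq hF hμ hproper p hS hs.1 hst ht.2]
  refine integral_nonneg fun x => mul_nonneg (Real.rpow_nonneg (sq_nonneg _) _) ?_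
  exact sub_nonneg.2 (tangentialSq_le p x)

lemma sqDensity_deriv_nonneg (hF : IsMinimalImmersion m F) (hμ : IsAreaMeasure m F μ)
    (hproper : IsProperMap F) (p : EuclideanSpace ℝ (Fin n)) {s S d : ℝ}
    (hS : ∀ x, ‖F x - p‖ ^ 2 ≤ S → x ∈ (𝓡∂ m).interior M) (hs : 0 < s) (hsS : s < S)
    (hd : HasDerivAt (sqDensity m F μ p) d s) : 0 ≤ d := by
  refine ge_of_tendsto (hd.tendsto_slope.mono_left (nhdsGT_le_nhdsNE s)) ?_
  filter_upwards [Ioo_mem_nhdsGT hsS] with t ht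
  rw [slope_def_field]
  exact div_nonneg (sub_nonneg.2 (sqDensity_monotoneOn hF hμ hproper p hS ⟨hs, hsS⟩
    ⟨hs.trans ht.1, ht.2⟩ ht.1.le)) (sub_nonneg.2 ht.1.le)

/-- On thin shells `q - T < ε` by compactness, so the monotonicity formula bounds the increments of
the density by a constant times `ε` times the increments of the area. Dividing gives `d ≤ C ε a` for
every `ε > 0`. -/
lemma sqDensity_deriv_eq_zero_of_orthogonal (hF : IsMinimalImmersion m F)
    (hμ : IsAreaMeasure m F μ) (hproper : IsProperMap F) (p : EuclideanSpace ℝ (Fin n))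
    {s S d a : ℝ} (hS : ∀ x, ‖F x - p‖ ^ 2 ≤ S → x ∈ (𝓡∂ m).interior M) (hs : 0 < s) (hsS : s < S)
    (ha : HasDerivAt (fun t => μ.real {x | ‖F x - p‖ ^ 2 ≤ t}) a s)
    (hd : HasDerivAt (sqDensity m F μ p) d s)
    (hN : ∀ x, ‖F x - p‖ ^ 2 = s → tangentialSq m F p x = ‖F x - p‖ ^ 2) : d = 0 := by
  refine le_antisymm ?_ (sqDensity_deriv_nonneg hF hμ hproper p hS hs hsS hd)
  have : LocallyCompactSpace M := Manifold.locallyCompact_of_finiteDimensional (𝓡∂ m)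
  have : IsLocallyFiniteMeasure μ := hμ.isLocallyFiniteMeasure hF
  have hq : Continuous fun x => ‖F x - p‖ ^ 2 := by have := hproper.continuous; fun_prop
  -- The exponent is negative, so this bounds the weight on the part of `M` outside the sphere.
  set C : ℝ := s ^ (-(m / 2 : ℝ) - 1) with hC
  have hC0 : 0 < C := Real.rpow_pos_of_pos hs _
  have hε : ∀ ε > 0, d ≤ C * ε * a := by
    intro ε hε
    obtain ⟨δ, hδ, hδN⟩ := exists_shell_forall hproper p s
      (P := fun y => ‖F y - p‖ ^ 2 - tangentialSq m F p y < ε) fun x hx => by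
        have hc : ContinuousAt (fun y => ‖F y - p‖ ^ 2 - tangentialSq m F p y) x :=
          hq.continuousAt.sub
            (contMDiffAt_tangentialSq hF p (hS x (hx.le.trans hsS.le))).continuousAt
        exact hc.eventually (gt_mem_nhds (by beta_reduce; rw [hN x hx, sub_self]; exact hε))
    refine le_of_tendsto_of_tendsto (hd.tendsto_slope.mono_left (nhdsGT_le_nhdsNE s))
      ((ha.tendsto_slope.mono_left (nhdsGT_le_nhdsNE s)).const_mul (C * ε)) ?_
    filter_upwards [Ioo_mem_nhdsGT hsS, Ioo_mem_nhdsGT (show s < s + δ by linarith)] with t ht ht'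
    rw [slope_def_field, slope_def_field, ← mul_div_assoc]
    have h1 : 0 < t - s := sub_pos.2 ht.1
    refine div_le_div_of_nonneg_right ?_ h1.le
    rw [sqDensity_sub_eq hF hμ hproper p hS hs ht.1.le ht.2,
      measureReal_sublevel_sub hF hμ hproper p ht.1.le]
    have h2 := norm_setIntegral_le_of_norm_le_const (μ := μ) (C := C * ε)
      (s := {x | s < ‖F x - p‖ ^ 2 ∧ ‖F x - p‖ ^ 2 ≤ t})
      (f := fun x => (‖F x - p‖ ^ 2) ^ (-(m / 2 : ℝ) - 1) *
        (‖F x - p‖ ^ 2 - tangentialSq m F p x)) ?_ fun x hx => ?_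
    · exact (le_abs_self _).trans h2
    · exact (measure_mono fun x hx => hx.2).trans_lt
        (isCompact_sublevel hproper p t).measure_lt_top
    · have h3 := hδN x (abs_lt.2 ⟨by linarith [hx.1], by linarith [hx.2, ht'.2]⟩)
      have h4 : 0 ≤ ‖F x - p‖ ^ 2 - tangentialSq m F p x := sub_nonneg.2 (tangentialSq_le p x)
      rw [Real.norm_eq_abs, abs_of_nonneg (mul_nonneg (Real.rpow_nonneg (sq_nonneg _) _) h4)]
      refine mul_le_mul ?_ h3.le h4 hC0.le
      refine Real.rpow_le_rpow_of_nonpos hs hx.1.le ?_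
      have : (0 : ℝ) ≤ m := Nat.cast_nonneg m
      linarith
  have hlim : Tendsto (fun ε : ℝ => C * ε * a) (𝓝[>] 0) (𝓝 0) := by
    have h3 : Tendsto (fun ε : ℝ => C * ε * a) (𝓝 0) (𝓝 (C * 0 * a)) :=
      Continuous.tendsto (by fun_prop) 0
    rw [mul_zero, zero_mul] at h3
    exact h3.mono_left nhdsWithin_le_nhds
  refine ge_of_tendsto hlim ?_
  filter_upwards [self_mem_nhdsWithin] with ε h using hε ε h

end Derivative

/-! ### Rigidity when the derivative vanishes -/

section Rigidity

variable {m n : ℕ} [NeZero m] {M : Type*} [TopologicalSpace M]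
  [ChartedSpace (EuclideanHalfSpace m) M] {F : M → EuclideanSpace ℝ (Fin n)}

lemma radialDeriv_real_comp (p : EuclideanSpace ℝ (Fin n)) {u : M → ℝ} {h : ℝ → ℝ} {h' : ℝ} {x : M}
    (hu : MDifferentiableAt (𝓡∂ m) 𝓘(ℝ, ℝ) u x) (hh : HasDerivAt h h' (u x)) :
    radialDeriv m F p (fun z => h (u z)) x = h' * radialDeriv m F p u x := by
  have h3 := (hh.hasFDerivAt.hasMFDerivAt.comp x hu.hasMFDerivAt).mfderiv
  have h4 : (fun z => h (u z)) = h ∘ u := rfl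
  unfold radialDeriv
  rw [h4, h3]
  exact mul_comm (G := ℝ) _ _

lemma radialDeriv_congr (p : EuclideanSpace ℝ (Fin n)) {u v : M → ℝ} {x : M}
    (h : u =ᶠ[𝓝 x] v) : radialDeriv m F p u x = radialDeriv m F p v x := by
  unfold radialDeriv
  rw [h.mfderiv_eq]
  rfl

variable [IsManifold (𝓡∂ m) ∞ M]

/-- At an interior point the chart expression has an unconstrained local minimum, so its full
differential vanishes. -/
lemma radialDeriv_eq_zero_of_isLocalMin (hF : IsMinimalImmersion m F)
    (p : EuclideanSpace ℝ (Fin n)) {u : M → ℝ} {x : M} (hxi : x ∈ (𝓡∂ m).interior M)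
    (hu : ContMDiffAt (𝓡∂ m) 𝓘(ℝ, ℝ) 1 u x) (hmin : IsLocalMin u x) :
    radialDeriv m F p u x = 0 := by
  have hxs := mem_extChartAt_source (I := 𝓡∂ m) x
  have hmem := halfSpace_mem_nhds_of_subset isOpen_interior (interior_extChartAt_target_subset x)
    (mem_interior_extChartAt_target hxs hxi)
  rw [radialDeriv_eq_fderivWithin hF p hxs hu, fderivWithin_of_mem_nhds hmem]
  have h1 : IsLocalMin (u ∘ (extChartAt (𝓡∂ m) x).symm) (extChartAt (𝓡∂ m) x x) := by
    have h2 := continuousAt_extChartAt_symm (I := 𝓡∂ m) x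
    unfold ContinuousAt at h2
    rw [extChartAt_to_inv] at h2
    have h3 := h2.eventually hmin
    unfold IsLocalMin IsMinFilter
    simpa only [Function.comp_apply, extChartAt_to_inv] using h3
  rw [h1.fderiv_eq_zero]
  rfl

/-- The squared distance to `p` has no local minimum where `M` is not tangent to the sphere. -/
lemma frequently_normSq_lt (hF : IsMinimalImmersion m F) (p : EuclideanSpace ℝ (Fin n)) {x : M}
    (hxi : x ∈ (𝓡∂ m).interior M) (hT : tangentialSq m F p x ≠ 0) :
    ∃ᶠ y in 𝓝 x, ‖F y - p‖ ^ 2 < ‖F x - p‖ ^ 2 := by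
  intro h
  have hmin : IsLocalMin (fun y => ‖F y - p‖ ^ 2) x := h.mono fun y hy => not_lt.1 hy
  have hsm : ContMDiff (𝓡∂ m) 𝓘(ℝ, ℝ) 1 fun y => ‖F y - p‖ ^ 2 := by
    have h1 : ContDiff ℝ 1 fun w : EuclideanSpace ℝ (Fin n) => ‖w - p‖ ^ 2 :=
      (contDiff_id.sub contDiff_const).norm_sq ℝ
    exact h1.contMDiff.comp (hF.smooth.of_le (mod_cast le_top))
  have h1 := radialDeriv_eq_zero_of_isLocalMin hF p hxi hsm.contMDiffAt hmin
  rw [radialDeriv_comp_normSq hF p (h := fun u => u) (hasDerivAt_id _)] at h1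
  apply hT
  linarith

variable [T2Space M] [SecondCountableTopology M] [MeasurableSpace M] [BorelSpace M] {μ : Measure M}

/-- Near a point at which `M` is not tangent to the sphere there is a function `ψ`, supported in a
prescribed neighborhood of the point, whose first variation along the radial field inside the sphere
is positive. -/
lemma exists_cutoff (hF : IsMinimalImmersion m F) (hμ : IsAreaMeasure m F μ)
    (hproper : IsProperMap F) (p : EuclideanSpace ℝ (Fin n)) {s S : ℝ}
    (hS : ∀ x, ‖F x - p‖ ^ 2 ≤ S → x ∈ (𝓡∂ m).interior M) (hsS : s < S) {x₀ : M}
    (hx₀ : ‖F x₀ - p‖ ^ 2 = s) (hT : tangentialSq m F p x₀ ≠ 0) {U : Set M} (hU : U ∈ 𝓝 x₀) :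
    ∃ S' > s, S' ≤ S ∧ ∃ ψ : M → ℝ,
      (∀ x, ‖F x - p‖ ^ 2 ≤ S' → ContMDiffAt (𝓡∂ m) 𝓘(ℝ, ℝ) 1 ψ x) ∧
      (∀ x, x ∉ U → ψ x = 0) ∧
      0 < ∫ x in {x | ‖F x - p‖ ^ 2 ≤ s}, (radialDeriv m F p ψ x + m * ψ x) ∂μ := by
  have : LocallyCompactSpace M := Manifold.locallyCompact_of_finiteDimensional (𝓡∂ m)
  have : IsLocallyFiniteMeasure μ := hμ.isLocallyFiniteMeasure hF
  have hm : (0 : ℝ) < m := by exact_mod_cast Nat.pos_of_ne_zero (NeZero.ne m)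
  have hFc := hproper.continuous
  have hx₀i : x₀ ∈ (𝓡∂ m).interior M := hS x₀ (hx₀.le.trans hsS.le)
  -- The second term has zero gradient at `F x₀`, so `φ` still increases to first order along the
  -- radial field there; away from `F x₀` it makes `φ` drop below `q`, which localizes superlevel
  -- sets.
  set φ : EuclideanSpace ℝ (Fin n) → ℝ := fun w => ‖w - p‖ ^ 2 - ‖w - F x₀‖ ^ 2 with hφ
  have hφC : ContDiff ℝ ∞ φ :=
    ((contDiff_id.sub contDiff_const).norm_sq ℝ).sub ((contDiff_id.sub contDiff_const).norm_sq ℝ)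
  set σ : M → ℝ := fun x => φ (F x) with hσ
  have hσC : ContMDiff (𝓡∂ m) 𝓘(ℝ, ℝ) 1 σ :=
    (hφC.contMDiff.comp hF.smooth).of_le (mod_cast le_top)
  have hσ₀ : radialDeriv m F p σ x₀ = 2 * tangentialSq m F p x₀ := by
    have h1 := (((hasFDerivAt_id (𝕜 := ℝ) (F x₀)).sub_const p).norm_sq).sub
      ((hasFDerivAt_id (F x₀)).sub_const (F x₀)).norm_sq
    refine (radialDeriv_comp hF p h1).trans ?_
    simp only [id, sub_self, map_zero, ContinuousLinearMap.zero_comp, smul_zero, sub_zero,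
      _root_.smul_apply, ContinuousLinearMap.comp_apply, ContinuousLinearMap.id_apply,
      innerSL_apply_apply, nsmul_eq_mul, inner_starProjection_tangentPlane]
    norm_num
  have hσpos : ∀ᶠ x in 𝓝 x₀, 0 < radialDeriv m F p σ x := by
    refine (continuousAt_radialDeriv hF p hx₀i hσC.contMDiffAt).eventually (lt_mem_nhds ?_)
    rw [hσ₀]
    exact mul_pos two_pos ((tangentialSq_nonneg p x₀).lt_of_ne' hT)
  obtain ⟨V, hVo, hxV, -, hVinj⟩ := hF.exists_isOpen_injOn x₀
  -- On this compact neighbourhood `σ` increases along the field and `F` is injective; injectivity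
  -- keeps `F x` away from `F x₀` outside the interior and yields `δ`.
  obtain ⟨C, hC, hCsub, hCc⟩ := local_compact_nhds
    (Filter.inter_mem (Filter.inter_mem hU (hVo.mem_nhds hxV)) hσpos)
  have hx₀C : x₀ ∈ interior C := mem_interior_iff_mem_nhds.2 hC
  obtain ⟨δ, hδ, hδle⟩ := (hCc.diff isOpen_interior).exists_forall_le'
    (f := fun x => ‖F x - F x₀‖ ^ 2) (a := 0) (Continuous.continuousOn (by fun_prop))
    (fun x hx => by
      refine pow_pos (norm_pos_iff.2 (sub_ne_zero.2 fun h => hx.2 ?_)) 2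
      rw [hVinj (hCsub hx.1).1.2 hxV h]
      exact hx₀C)
  -- On `C` outside its interior and where `q ≤ s + δ / 4`, `σ ≤ s - 3δ / 4`, below the threshold `s
  -- - δ / 2`, whereas `σ x₀ = s` is above it. So in that ball the truncation of `e` to `C` creates
  -- no jump.
  set e : M → ℝ := fun x => expNegInvGlue (σ x - s + δ / 2) with he
  set ψ : M → ℝ := C.indicator e with hψ
  set S' : ℝ := min S (s + δ / 4) with hS'
  have hE : ContDiff ℝ 1 fun t : ℝ => expNegInvGlue (t - s + δ / 2) :=
    (expNegInvGlue.contDiff (n := 1)).comp (by fun_prop)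
  have heC : ContMDiff (𝓡∂ m) 𝓘(ℝ, ℝ) 1 e := hE.contMDiff.comp hσC
  have hloc : ∀ x, ‖F x - p‖ ^ 2 ≤ S' →
      (x ∈ interior C ∧ ψ =ᶠ[𝓝 x] e) ∨ ψ =ᶠ[𝓝 x] fun _ => 0 := by
    intro x hx
    by_cases hxi : x ∈ interior C
    · refine Or.inl ⟨hxi, ?_⟩
      filter_upwards [isOpen_interior.mem_nhds hxi] with y hy
      exact indicator_of_mem (interior_subset hy) e
    right
    by_cases hxC : x ∈ C
    · have h1 : σ x - s + δ / 2 < 0 := by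
        have h2 := hδle x ⟨hxC, hxi⟩
        have h3 := hx.trans (min_le_right _ _)
        simp only [hσ, hφ]
        linarith
      have h4 : ∀ᶠ y in 𝓝 x, σ y - s + δ / 2 < 0 :=
        ((hσC.continuous.sub continuous_const).add continuous_const).continuousAt.eventually
          (gt_mem_nhds h1)
      filter_upwards [h4] with y hy
      refine indicator_apply_eq_zero.2 fun _ => ?_
      exact expNegInvGlue.zero_of_nonpos hy.le
    · filter_upwards [hCc.isClosed.isOpen_compl.mem_nhds hxC] with y hy
      exact indicator_of_notMem hy e
  have hψC : ∀ x, ‖F x - p‖ ^ 2 ≤ S' → ContMDiffAt (𝓡∂ m) 𝓘(ℝ, ℝ) 1 ψ x := by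
    intro x hx
    rcases hloc x hx with ⟨-, h⟩ | h
    · exact heC.contMDiffAt.congr_of_eventuallyEq h
    · exact contMDiffAt_const.congr_of_eventuallyEq h
  have hsS' : s < S' := lt_min hsS (by linarith)
  have hψ0 : ∀ x, 0 ≤ ψ x := fun x => indicator_nonneg (fun _ _ => expNegInvGlue.nonneg _) x
  have hLψ : ∀ x, ‖F x - p‖ ^ 2 ≤ S' → 0 ≤ radialDeriv m F p ψ x := by
    intro x hx
    rcases hloc x hx with ⟨hxC, h⟩ | h
    · rw [radialDeriv_congr p h, he, radialDeriv_real_comp p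
        (hσC.contMDiffAt.mdifferentiableAt one_ne_zero)
        ((hE.differentiable one_ne_zero (σ x)).hasDerivAt)]
      -- An increasing function of `σ`, and `σ` increases along the field on `C`.
      refine mul_nonneg (Monotone.deriv_nonneg fun a b hab => ?_) (hCsub (interior_subset hxC)).2.le
      exact expNegInvGlue.monotone (by linarith)
    · rw [radialDeriv_of_eventuallyEq_zero p h]
  refine ⟨S', hsS', min_le_left _ _, ψ, hψC,
    fun x hx => indicator_of_notMem (fun h => hx (hCsub h).1.1) e, ?_⟩
  have hKc := isCompact_sublevel hproper p s
  have hK : ∀ x ∈ {x | ‖F x - p‖ ^ 2 ≤ s}, ‖F x - p‖ ^ 2 ≤ S' := fun x hx => hx.trans hsS'.le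
  have hint : IntegrableOn (fun x => radialDeriv m F p ψ x + m * ψ x)
      {x | ‖F x - p‖ ^ 2 ≤ s} μ :=
    (continuousOn_radialDeriv_add hF p (fun x hx => hS x ((hK x hx).trans (min_le_left _ _)))
      fun x hx => hψC x (hK x hx)).integrableOn_compact hKc
  rw [setIntegral_pos_iff_support_of_nonneg_ae ?_ hint]
  · have hWo : IsOpen (interior C ∩ ({x | 0 < σ x - s + δ / 2} ∩ {x | ‖F x - p‖ ^ 2 < s})) :=
      isOpen_interior.inter ((isOpen_lt continuous_const
        ((hσC.continuous.sub continuous_const).add continuous_const)).inter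
        (isOpen_lt (by fun_prop) continuous_const))
    have hσx₀ : 0 < σ x₀ - s + δ / 2 := by
      simp only [hσ, hφ, sub_self, norm_zero, hx₀]
      norm_num
      exact hδ
    have hev : ∀ᶠ y in 𝓝 x₀, y ∈ interior C ∧ 0 < σ y - s + δ / 2 :=
      (isOpen_interior.eventually_mem hx₀C).and
        (((hσC.continuous.sub continuous_const).add continuous_const).continuousAt.eventually
          (lt_mem_nhds hσx₀))
    -- As `x₀` lies on the sphere itself, strict positivity is sought at a nearby point inside: `x₀`
    -- is not a local minimum of `q`, so there are such points in the region where `ψ > 0`.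
    obtain ⟨y, hy1, hy2, hy3⟩ := ((frequently_normSq_lt hF p hx₀i hT).and_eventually hev).exists
    rw [hx₀] at hy1
    refine (hμ.pos_of_isOpen hF hWo ⟨hy2, hy3, hy1⟩ (hS y (hy1.le.trans hsS.le))).trans_le
      (measure_mono fun z hz => ⟨?_, le_of_lt (show ‖F z - p‖ ^ 2 < s from hz.2.2)⟩)
    have h1 : 0 < ψ z := by
      rw [hψ, indicator_of_mem (interior_subset hz.1)]
      exact expNegInvGlue.pos_of_pos hz.2.1
    exact (add_pos_of_nonneg_of_pos (hLψ z (hz.2.2.le.trans hsS'.le)) (mul_pos hm h1)).ne'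
  · refine (ae_restrict_iff' hKc.measurableSet).2 (ae_of_all _ fun x hx => ?_)
    exact add_nonneg (hLψ x (hK x hx)) (mul_nonneg hm.le (hψ0 x))

/-- If the density is stationary to first order at some radius, then `M` is orthogonal to the
sphere wherever it is not tangent to it. -/
theorem orthogonal_of_sqDensity_deriv_eq_zero (hF : IsMinimalImmersion m F)
    (hμ : IsAreaMeasure m F μ) (hproper : IsProperMap F) (p : EuclideanSpace ℝ (Fin n)) {s S : ℝ}
    (hS : ∀ x, ‖F x - p‖ ^ 2 ≤ S → x ∈ (𝓡∂ m).interior M) (hs : 0 < s) (hsS : s < S)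
    (hd : HasDerivAt (sqDensity m F μ p) 0 s) {x₀ : M} (hx₀ : ‖F x₀ - p‖ ^ 2 = s)
    (hT : tangentialSq m F p x₀ ≠ 0) : tangentialSq m F p x₀ = ‖F x₀ - p‖ ^ 2 := by
  by_contra hN
  have : LocallyCompactSpace M := Manifold.locallyCompact_of_finiteDimensional (𝓡∂ m)
  have : IsLocallyFiniteMeasure μ := hμ.isLocallyFiniteMeasure hF
  set q : M → ℝ := fun x => ‖F x - p‖ ^ 2 with hqdef
  have hq : Continuous q := by have := hproper.continuous; fun_prop
  have hTc : ∀ x, q x ≤ S → ContinuousAt (tangentialSq m F p) x := fun x hx =>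
    (contMDiffAt_tangentialSq hF p (hS x hx)).continuousAt
  set D : M → ℝ := fun x => q x ^ (-(m / 2 : ℝ) - 1) * (q x - tangentialSq m F p x) with hD
  have hq₀ : 0 < q x₀ := lt_of_lt_of_eq hs hx₀.symm
  have hDc : ∀ x, 0 < q x → q x ≤ S → ContinuousAt D x := fun x hx hxS =>
    (hq.continuousAt.rpow_const (Or.inl hx.ne')).mul (hq.continuousAt.sub (hTc x hxS))
  have hD0 : ∀ x, 0 ≤ D x := fun x =>
    mul_nonneg (Real.rpow_nonneg (sq_nonneg _) _) (sub_nonneg.2 (tangentialSq_le p x))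
  have hDx₀ : 0 < D x₀ := mul_pos (Real.rpow_pos_of_pos hq₀ _)
    (sub_pos.2 ((tangentialSq_le p x₀).lt_of_ne hN))
  have hU : {x | D x₀ / 2 < D x} ∈ 𝓝 x₀ :=
    (hDc x₀ hq₀ (hx₀.le.trans hsS.le)).eventually (lt_mem_nhds (half_lt_self hDx₀))
  obtain ⟨S', hsS', hS'S, ψ, hψC, hψU, hpos⟩ := exists_cutoff hF hμ hproper p hS hsS hx₀ hT hU
  have hS₁ : ∀ x, q x ≤ S' → x ∈ (𝓡∂ m).interior M := fun x hx => hS x (hx.trans hS'S)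
  have hKc : IsCompact {x | q x ≤ S'} := isCompact_sublevel hproper p S'
  have hBc := continuousOn_mul_tangentialSq hF p (K := {x | q x ≤ S'}) hS₁ hψC
  obtain ⟨c, hc⟩ := hKc.exists_bound_of_continuousOn hBc
  -- `c` bounds `ψ T` on the ball and `D > D x₀ / 2` where `ψ` may be nonzero, so `c'` times the
  -- monotonicity integrand dominates `ψ T`.
  set c' : ℝ := c / (D x₀ / 2) with hc'
  have hle : ∀ x, q x ≤ S' → ψ x * tangentialSq m F p x ≤ c' * D x := by
    intro x hx
    have h1 := hc x hx
    have h0 : 0 ≤ c' := div_nonneg ((norm_nonneg _).trans h1) (half_pos hDx₀).le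
    by_cases hxU : x ∈ {x | D x₀ / 2 < D x}
    · calc ψ x * tangentialSq m F p x ≤ c := (le_abs_self _).trans h1
        _ = c' * (D x₀ / 2) := (div_mul_cancel₀ _ (half_pos hDx₀).ne').symm
        _ ≤ c' * D x := mul_le_mul_of_nonneg_left (le_of_lt hxU) h0
    · rw [hψU x hxU, zero_mul]
      exact mul_nonneg h0 (hD0 x)
  have hlim := tendsto_shell_integral_right hF hμ hproper p hS₁ hψC hsS'
  have hlim0 := ((hd.tendsto_slope.mono_left (nhdsGT_le_nhdsNE s)).const_mul (2 * c'))
  rw [mul_zero] at hlim0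
  -- The shell quotients of `ψ T` tend to a positive number but are at most `2 c'` times difference
  -- quotients of the density, which tend to zero.
  refine not_le.2 hpos (le_of_tendsto_of_tendsto hlim hlim0 ?_)
  filter_upwards [Ioo_mem_nhdsGT hsS'] with t ht
  rw [slope_def_field, sqDensity_sub_eq hF hμ hproper p hS₁ hs ht.1.le ht.2, ← mul_div_assoc]
  refine div_le_div_of_nonneg_right ?_ (sub_pos.2 ht.1).le
  rw [mul_assoc]
  have hWm : MeasurableSet {x | s < q x ∧ q x ≤ t} :=
    (measurableSet_lt measurable_const hq.measurable).inter
      (measurableSet_le hq.measurable measurable_const)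
  have hWK : {x | s < q x ∧ q x ≤ t} ⊆ {x | q x ≤ S'} := fun x hx => le_trans hx.2 ht.2.le
  have hcs : IsCompact {x | s ≤ q x ∧ q x ≤ t} :=
    hKc.of_isClosed_subset ((isClosed_le continuous_const hq).inter
      (isClosed_le hq continuous_const)) fun x hx => le_trans hx.2 ht.2.le
  have hDi : IntegrableOn D {x | s < q x ∧ q x ≤ t} μ := by
    refine (ContinuousOn.integrableOn_compact hcs fun x hx => ?_).mono_set
      fun x (hx : s < q x ∧ q x ≤ t) => ⟨hx.1.le, hx.2⟩
    exact (hDc x (hs.trans_le hx.1) ((hx.2.trans ht.2.le).trans hS'S)).continuousWithinAt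
  refine mul_le_mul_of_nonneg_left ?_ zero_le_two
  rw [← integral_const_mul]
  exact setIntegral_mono_on ((hBc.integrableOn_compact hKc).mono_set hWK) (hDi.const_mul c') hWm
    fun x hx => hle x (hWK hx)

end Rigidity

/-! ### Passage to radii and the density ratio -/

section DistToBoundary

variable {m n : ℕ} [NeZero m] {M : Type*} [TopologicalSpace M]
  [ChartedSpace (EuclideanHalfSpace m) M] {F : M → EuclideanSpace ℝ (Fin n)}

/-- The strict inequality leaves room for a slightly larger ball still free of boundary points; the
shell arguments need this margin. -/
lemma exists_sublevel_subset_interior (p : EuclideanSpace ℝ (Fin n)) {r : ℝ} (hr : 0 ≤ r)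
    (h : ENNReal.ofReal r < distToBoundary m F p) :
    ∃ S > r ^ 2, ∀ x, ‖F x - p‖ ^ 2 ≤ S → x ∈ (𝓡∂ m).interior M := by
  obtain ⟨r', hr', h1, h2⟩ := ENNReal.lt_iff_exists_real_btwn.1 h
  rw [ENNReal.ofReal_lt_ofReal_iff_of_nonneg hr] at h1
  refine ⟨r' ^ 2, pow_lt_pow_left₀ h1 hr two_ne_zero, fun x hx => ?_⟩
  rw [← (𝓡∂ m).compl_boundary]
  intro hxb
  refine not_le.2 h2 ((infEDist_le_edist_of_mem (mem_image_of_mem F hxb)).trans ?_)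
  rw [edist_comm, edist_dist, dist_eq_norm]
  exact ENNReal.ofReal_le_ofReal ((pow_le_pow_iff_left₀ (norm_nonneg _) hr' two_ne_zero).1 hx)

end DistToBoundary

section DensityRatio

lemma unitBallVolume_pos (m : ℕ) : 0 < unitBallVolume m :=
  ENNReal.toReal_pos (measure_ball_pos _ _ one_pos).ne' measure_ball_lt_top.ne

variable {m n : ℕ} {M : Type*} {F : M → EuclideanSpace ℝ (Fin n)}

lemma preimage_closedBall_eq (p : EuclideanSpace ℝ (Fin n)) {r : ℝ} (hr : 0 ≤ r) :
    F ⁻¹' closedBall p r = {x | ‖F x - p‖ ^ 2 ≤ r ^ 2} := by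
  ext x
  rw [mem_preimage, mem_closedBall, dist_eq_norm, mem_ofPred_eq,
    pow_le_pow_iff_left₀ (norm_nonneg _) hr two_ne_zero]

lemma mem_sphere_iff_normSq (p : EuclideanSpace ℝ (Fin n)) {r : ℝ} (hr : 0 ≤ r) (x : M) :
    F x ∈ sphere p r ↔ ‖F x - p‖ ^ 2 = r ^ 2 := by
  rw [mem_sphere, dist_eq_norm, pow_left_inj₀ (norm_nonneg _) hr two_ne_zero]

variable [MeasurableSpace M] {μ : Measure M}

lemma area_closedBall_eq (hμ : IsAreaMeasure m F μ) (p : EuclideanSpace ℝ (Fin n)) {r : ℝ}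
    (hr : 0 ≤ r) : area m F (closedBall p r) = μ {x | ‖F x - p‖ ^ 2 ≤ r ^ 2} := by
  rw [hμ.area_eq _ isClosed_closedBall.measurableSet, preimage_closedBall_eq p hr]

lemma densityRatio_eq (hμ : IsAreaMeasure m F μ) (p : EuclideanSpace ℝ (Fin n)) {r : ℝ}
    (hr : 0 < r) :
    densityRatio m F p r = (unitBallVolume m)⁻¹ * sqDensity m F μ p (r ^ 2) := by
  have h1 : ((r ^ 2 : ℝ)) ^ (-(m / 2 : ℝ)) = (r ^ m)⁻¹ := by
    rw [Real.rpow_neg (sq_nonneg r), ← Real.rpow_natCast r 2, ← Real.rpow_mul hr.le]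
    congr 1
    rw [← Real.rpow_natCast r m]
    congr 1
    push_cast
    ring
  rw [densityRatio, area_closedBall_eq hμ p hr.le, sqDensity, h1, Measure.real, div_eq_mul_inv,
    mul_inv]
  ring

lemma hasDerivAt_densityRatio (hμ : IsAreaMeasure m F μ) (p : EuclideanSpace ℝ (Fin n)) {r d : ℝ}
    (hr : 0 < r) (hd : HasDerivAt (sqDensity m F μ p) d (r ^ 2)) :
    HasDerivAt (densityRatio m F p) ((unitBallVolume m)⁻¹ * (d * (2 * r))) r := by
  have h1 : HasDerivAt (fun t : ℝ => t ^ 2) (2 * r) r := by simpa using hasDerivAt_pow 2 r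
  refine ((hd.comp_of_eq r h1 rfl).const_mul _).congr_of_eventuallyEq ?_
  filter_upwards [lt_mem_nhds hr] with t ht using densityRatio_eq hμ p ht

/-- For positive radii the substitution `s = r²` is inverted by the square root, so a
differentiability hypothesis on the density ratio can be transferred back. -/
lemma hasDerivAt_sqDensity (hμ : IsAreaMeasure m F μ) (p : EuclideanSpace ℝ (Fin n)) {r d : ℝ}
    (hr : 0 < r) (hd : HasDerivAt (densityRatio m F p) d r) :
    HasDerivAt (sqDensity m F μ p) (unitBallVolume m * (d * (1 / (2 * r)))) (r ^ 2) := by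
  have hr2 : √(r ^ 2) = r := Real.sqrt_sq hr.le
  have h1 := Real.hasDerivAt_sqrt (pow_pos hr 2).ne'
  rw [hr2] at h1
  have h2 : HasDerivAt (densityRatio m F p) d √(r ^ 2) := by rwa [hr2]
  refine ((h2.comp_of_eq (r ^ 2) h1 rfl).const_mul (unitBallVolume m)).congr_of_eventuallyEq ?_
  filter_upwards [lt_mem_nhds (pow_pos hr 2)] with t ht
  rw [Function.comp_apply, densityRatio_eq hμ p (Real.sqrt_pos.2 ht), Real.sq_sqrt ht.le,
    mul_inv_cancel_left₀ (unitBallVolume_pos m).ne']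

variable [TopologicalSpace M] [NeZero m] [ChartedSpace (EuclideanHalfSpace m) M]
  [IsManifold (𝓡∂ m) ∞ M] [T2Space M] [SecondCountableTopology M] [BorelSpace M]

lemma area_closedBall_lt_top (hF : IsMinimalImmersion m F) (hμ : IsAreaMeasure m F μ)
    (hproper : IsProperMap F) (p : EuclideanSpace ℝ (Fin n)) (r : ℝ) :
    area m F (closedBall p r) < ⊤ := by
  have : LocallyCompactSpace M := Manifold.locallyCompact_of_finiteDimensional (𝓡∂ m)
  have : IsLocallyFiniteMeasure μ := hμ.isLocallyFiniteMeasure hF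
  rw [hμ.area_eq _ isClosed_closedBall.measurableSet]
  exact (hproper.isCompact_preimage (isCompact_closedBall p r)).measure_lt_top

lemma densityRatio_le_of_lt (hF : IsMinimalImmersion m F) (hμ : IsAreaMeasure m F μ)
    (hproper : IsProperMap F) (p : EuclideanSpace ℝ (Fin n)) {a t : ℝ} (ha : 0 < a) (hat : a ≤ t)
    (ht : ENNReal.ofReal t < distToBoundary m F p) :
    densityRatio m F p a ≤ densityRatio m F p t := by
  have ht0 : 0 < t := ha.trans_le hat
  obtain ⟨S, htS, hS⟩ := exists_sublevel_subset_interior p ht0.le ht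
  have hat2 : a ^ 2 ≤ t ^ 2 := pow_le_pow_left₀ ha.le hat 2
  rw [densityRatio_eq hμ p ha, densityRatio_eq hμ p ht0]
  exact mul_le_mul_of_nonneg_left (sqDensity_monotoneOn hF hμ hproper p hS
    ⟨pow_pos ha 2, hat2.trans_lt htS⟩ ⟨pow_pos ht0 2, htS⟩ hat2)
    (inv_nonneg.2 (unitBallVolume_pos m).le)

/-- The endpoint `r = dist(p, ∂M)` is reached without continuity of the area: for `t < b` the area
at `t` is at most that at `b`, and with the latter frozen the quotient is continuous in `t`. -/
lemma densityRatio_monotoneOn (hF : IsMinimalImmersion m F) (hμ : IsAreaMeasure m F μ)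
    (hproper : IsProperMap F) (p : EuclideanSpace ℝ (Fin n)) :
    MonotoneOn (densityRatio m F p) {r : ℝ | 0 < r ∧ ENNReal.ofReal r ≤ distToBoundary m F p} := by
  rintro a ⟨ha, -⟩ b ⟨hb, hbd⟩ hab
  rcases hab.eq_or_lt with rfl | hab
  · exact le_rfl
  have hω := unitBallVolume_pos m
  have hlim : Tendsto
      (fun t : ℝ => (area m F (closedBall p b)).toReal / (unitBallVolume m * t ^ m)) (𝓝[<] b)
      (𝓝 (densityRatio m F p b)) := by
    have h1 : ContinuousAt
        (fun t : ℝ => (area m F (closedBall p b)).toReal / (unitBallVolume m * t ^ m)) b :=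
      continuousAt_const.div (by fun_prop) (mul_pos hω (pow_pos hb m)).ne'
    exact h1.tendsto.mono_left nhdsWithin_le_nhds
  refine ge_of_tendsto hlim ?_
  filter_upwards [Ioo_mem_nhdsLT hab] with t ht
  have ht0 : 0 < t := ha.trans ht.1
  refine (densityRatio_le_of_lt hF hμ hproper p ha ht.1.le
    (((ENNReal.ofReal_lt_ofReal_iff hb).2 ht.2).trans_le hbd)).trans ?_
  unfold densityRatio
  refine div_le_div_of_nonneg_right ?_ (mul_pos hω (pow_pos ht0 m)).le
  refine ENNReal.toReal_mono (area_closedBall_lt_top hF hμ hproper p b).ne ?_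
  exact lintegral_mono_set (closedBall_subset_closedBall ht.2.le)

/-- The part of the monotonicity theorem about radii of differentiability. -/
lemma densityRatio_deriv (hF : IsMinimalImmersion m F) (hμ : IsAreaMeasure m F μ)
    (hproper : IsProperMap F) (p : EuclideanSpace ℝ (Fin n)) {r d : ℝ} (hr : 0 < r)
    (hrd : ENNReal.ofReal r < distToBoundary m F p) (hd : HasDerivAt (densityRatio m F p) d r) :
    0 ≤ d ∧ (d = 0 → ∀ x : M, F x ∈ sphere p r → ¬ TangentToSphereAt m F p x →
      OrthogonalToSphereAt m F p x) := by
  obtain ⟨S, hrS, hS⟩ := exists_sublevel_subset_interior p hr.le hrd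
  have hd' := hasDerivAt_sqDensity hμ p hr hd
  constructor
  · have h1 := sqDensity_deriv_nonneg hF hμ hproper p hS (pow_pos hr 2) hrS hd'
    have h2 : 0 < unitBallVolume m * (1 / (2 * r)) :=
      mul_pos (unitBallVolume_pos m) (by positivity)
    refine nonneg_of_mul_nonneg_left (b := unitBallVolume m * (1 / (2 * r))) ?_ h2
    linarith
  · rintro rfl x hx hxT
    rw [zero_mul, mul_zero] at hd'
    rw [orthogonalToSphereAt_iff]
    rw [tangentToSphereAt_iff] at hxT
    exact orthogonal_of_sqDensity_deriv_eq_zero hF hμ hproper p hS (pow_pos hr 2) hrS hd'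
      ((mem_sphere_iff_normSq p hr.le x).1 hx) hxT

/-- The part of the monotonicity theorem about spheres to which `M` is nowhere tangent. -/
lemma exists_hasDerivAt_densityRatio (hF : IsMinimalImmersion m F) (hμ : IsAreaMeasure m F μ)
    (hproper : IsProperMap F) (p : EuclideanSpace ℝ (Fin n)) {r : ℝ} (hr : 0 < r)
    (hrd : ENNReal.ofReal r < distToBoundary m F p)
    (hT : ∀ x : M, F x ∈ sphere p r → ¬ TangentToSphereAt m F p x) :
    ∃ d : ℝ, HasDerivAt (densityRatio m F p) d r ∧ 0 ≤ d ∧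
      (d = 0 ↔ ∀ x : M, F x ∈ sphere p r → OrthogonalToSphereAt m F p x) := by
  obtain ⟨S, hrS, hS⟩ := exists_sublevel_subset_interior p hr.le hrd
  have hr2 : 0 < r ^ 2 := pow_pos hr 2
  obtain ⟨a, ha⟩ := exists_hasDerivAt_measure_sublevel hF hμ hproper p hS hrS fun x hx => by
    rw [Ne, ← tangentToSphereAt_iff]
    exact hT x ((mem_sphere_iff_normSq p hr.le x).2 hx)
  have hd := (Real.hasDerivAt_rpow_const (p := -(m / 2 : ℝ)) (Or.inl hr2.ne')).mul ha
  have hΘ := hasDerivAt_densityRatio hμ p hr hd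
  obtain ⟨h0, h1⟩ := densityRatio_deriv hF hμ hproper p hr hrd hΘ
  refine ⟨_, hΘ, h0, fun h x hx => h1 h x hx (hT x hx), fun h => ?_⟩
  rw [sqDensity_deriv_eq_zero_of_orthogonal hF hμ hproper p hS hr2 hrS ha hd fun x hx =>
    (orthogonalToSphereAt_iff p x).1 (h x ((mem_sphere_iff_normSq p hr.le x).2 hx)),
    zero_mul, mul_zero]

end DensityRatio

end MinimalSubmanifold

theorem mainTheorem1 {m n : ℕ} [NeZero m] {M : Type*} [TopologicalSpace M] [T2Space M]
    [SecondCountableTopology M] [ChartedSpace (EuclideanHalfSpace m) M] [IsManifold (𝓡∂ m) ∞ M]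
    (F : M → EuclideanSpace ℝ (Fin n)) (hF : IsMinimalImmersion m F) (hproper : IsProperMap F)
    (p : EuclideanSpace ℝ (Fin n)) :
    -- all areas are finite
    (∀ r : ℝ, area m F (closedBall p r) < ⊤) ∧
    -- the density ratio is nondecreasing for `0 < r ≤ dist(p, ∂M)`
    MonotoneOn (densityRatio m F p) {r : ℝ | 0 < r ∧ ENNReal.ofReal r ≤ distToBoundary m F p} ∧
    -- if `M` is nowhere tangent to the sphere, then the derivative exists and is nonnegative, with
    -- equality if and only if `M` meets the sphere orthogonally
    (∀ r : ℝ, 0 < r → ENNReal.ofReal r < distToBoundary m F p →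
      (∀ x : M, F x ∈ sphere p r → ¬ TangentToSphereAt m F p x) →
      ∃ d : ℝ, HasDerivAt (densityRatio m F p) d r ∧ 0 ≤ d ∧
        (d = 0 ↔ ∀ x : M, F x ∈ sphere p r → OrthogonalToSphereAt m F p x)) ∧
    -- wherever the derivative exists, it is nonnegative, and it vanishes only if `M` meets the
    -- sphere orthogonally at each point where it is not tangent to the sphere
    (∀ r d : ℝ, 0 < r → ENNReal.ofReal r < distToBoundary m F p →
      HasDerivAt (densityRatio m F p) d r →
      0 ≤ d ∧ (d = 0 → ∀ x : M, F x ∈ sphere p r → ¬ TangentToSphereAt m F p x →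
        OrthogonalToSphereAt m F p x)) := by
  -- The statement involves no σ-algebra on `M`; the area measure lives on the Borel one.
  let _ : MeasurableSpace M := borel M
  have : BorelSpace M := ⟨rfl⟩
  obtain ⟨μ, hμ⟩ := hF.exists_isAreaMeasure
  exact ⟨area_closedBall_lt_top hF hμ hproper p, densityRatio_monotoneOn hF hμ hproper p,
    fun r hr hrd hT => exists_hasDerivAt_densityRatio hF hμ hproper p hr hrd hT,
    fun r d hr hrd hd => densityRatio_deriv hF hμ hproper p hr hrd hd⟩
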